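/- **The algebra $\widehat{\mathcal D}_x^{\pm}$.** Let $\mathcal D$ be the associative algebra with basis $t^kD^l$ ($k\in\mathbb Z$, $l\ge 0$, $D=t\,d/dt$) and product $t^rf(D)\cdot t^sg(D)=t^{r+s}f(D+s)g(D)$, viewed as a Lie algebra under the commutator. Let $\widehat{\mathcal D}=\mathcal D\oplus\mathbb C C$ be its central extension by the 2-cocycle $\Psi(t^rf(D),t^sg(D))=\sum_{-r\le k\le -1}f(k)g(k+r)$ if $r=-s>0$ (skew-symmetric, and $0$ if $r+s\ne0$ or $r=s=0$). Fix a sign $\pm$. Let $\mathcal D_x^\pm\subset \mathcal D$ be the Lie subalgebra spanned by the elements $t^kf(D)D$ with $f\in\mathbb C[x]$ and $f(w)=(\pm1)^kf(-w-k)$, and let $\widehat{\mathcal D}_x^\pm=\mathcal D_x^\pm\oplus\mathbb CC$. It is graded by $\deg t^kf(D)D=k$, $\deg C=0$. **The algebra $\mathcal L_\pm^{[m]}$.** Let $m\ge0$ and $R_m=\mathbb C[u]/(u^{m+1})$, with involution $a(u)\mapsto a(-u)$. Let $\widetilde{gl}_\infty^{[m]}$ be the algebra of matrices $A=(a_{ij})_{i,j\in\mathbb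 Z}$ over $R_m$ with finitely many nonzero diagonals, $J=\sum_{j\le0}E_{jj}$, and $\widehat{gl}_\infty^{[m]}=\widetilde{gl}_\infty^{[m]}\oplus R_m$ the central extension by the $R_m$-valued cocycle $\mathrm{tr}([J,A]B)$. Let $\overline{\mathcal L}_\pm^{[m]}$ consist of the matrices $A$ with $$a_{ij}(u)=-(\mp1)^{i+j}a_{-j,-i}(-u)\quad(ij>0\text{ or }i=j=0),\qquad a_{ij}(u)=(\mp1)^{i+j}a_{-j,-i}(-u)\quad(ij<0),$$ $$a_{-i,0}(u)=(\mp1)^i\,u\,a_{0,i}(-u),\qquad a_{i,0}(u)=-(\mp1)^i\,u\,a_{0,-i}(-u)\quad(i>0),$$ and let $\mathcal L_\pm^{[m]}=\overline{\mathcal L}_\pm^{[m]}\oplus R_m\subset\widehat{gl}_\infty^{[m]}$, graded by $\deg E_{ij}=j-i$, $\deg R_m=0$. **The homomorphism.** Let $T$ be the automorphism of $\widetilde{gl}_\infty^{[m]}$ multiplying the $(i,j)$ entry by $\prod_{i\le k<j,\,k\ne0}(u-k)$ if $i\le j$ and by $\prod_{j\le k<i,\,k\ne0}(u-k)^{-1}$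 if $i>j$. Let $\widehat\varphi_0^{[m],\pm}:\widehat{\mathcal D}_x^\pm\to\mathcal L_\pm^{[m]}$ be the homomorphism of Lie algebras $$\sum_kt^kf_k(D)+cC\ \longmapsto\ T\Big(\sum_{k}\sum_{j\in\mathbb Z}f_k(u-j)E_{j-k,j}\Big)+\alpha(f_0)+c,$$ where $\alpha:\mathbb C[x]\to R_m$ is the linear map $\alpha(x^l)=-\frac{B_{l+1}(u)-B_{l+1}(0)}{l+1}$ ($B_n$ the Bernoulli polynomials), that is, $\alpha(e^{xD})=-\frac{e^{xu}-1}{e^x-1}$ on generating series. **Modules.** For a $\mathbb Z$-graded Lie algebra $\mathfrak g=\bigoplus_n\mathfrak g_n$ and $\lambda\in\mathfrak g_0^*$, $L(\mathfrak g,\lambda)$ denotes the irreducible $\mathbb Z$-graded highest weight module with highest weight $\lambda$: it is generated by a nonzero vector $v$ of degree $0$ with $hv=\lambda(h)v$ for $h\in\mathfrak g_0$ and $\mathfrak g_nv=0$ for $n>0$. It is called quasifinite if its homogeneous components are finite-dimensional. For $\lambda\in(\mathcal L_\pm^{[m]})_0^*$ put, for $i\in\mathbb Z_+$ and $0\le j\le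 m$, $$c_j=\lambda(u^j),\qquad {}^\pm\lambda_i^{(j)}=\lambda\big(u^jE_{ii}-(-u)^jE_{-i,-i}\big),\qquad {}^\pm h_i^{(j)}={}^\pm\lambda_i^{(j)}-{}^\pm\lambda_{i+1}^{(j)}+\delta_{i,0}c_j .$$ **Exponents.** For $\lambda\in(\widehat{\mathcal D}_x^\pm)_0^*$ put $c_0=\lambda(C)$ and $\Delta_\lambda(x)=\sum_{l\text{ even}}-\lambda(D^{l+1})\frac{x^l}{l!}$. Let $e^+$ be a finite set of complex numbers $e$ with nonzero even polynomials (multiplicities) $q_e(x)$, and $e^-$ a finite set of complex numbers $e$ with nonzero odd polynomials $r_e(x)$; in each set the numbers are distinct up to sign. An irreducible quasifinite highest weight module $L(\widehat{\mathcal D}_x^\pm,\lambda)$ is denoted $L(\widehat{\mathcal D}_x^\pm;e^+,e^-)$ if $$\Delta_\lambda(x)=\frac{d}{dx}\Big(\frac{\phi(x)}{2\sinh(x/2)}\Big),\qquad \phi(0)=0,\qquad \phi(x)+c_0\cosh(x/2)=\sum_{e\in e^+}q_e(x)\cosh(ex)+\sum_{e\in e^-}r_e(x)\sinh(ex)$$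 for a formal power series $\phi$. (If $e^-$ contained $0$, its term would vanish, so $0\notin e^-$ is required.) **Proposition.** Let $\lambda\in(\mathcal L_\pm^{[m]})_0^*$ be such that $L(\mathcal L_\pm^{[m]},\lambda)$ is quasifinite. Then ${}^\pm h_j^{(i)}=0$ for all but finitely many pairs $(j,i)$ with $j\in\mathbb Z_+$, $0\le i\le m$, and $L(\mathcal L_\pm^{[m]},\lambda)$, regarded as a $\widehat{\mathcal D}_x^\pm$-module via $\widehat\varphi_0^{[m],\pm}$, is irreducible and isomorphic to $L(\widehat{\mathcal D}_x^\pm;e^+,e^-)$, where $e^+$ and $e^-$ consist of the exponents $-j-\frac12$, $j\in\mathbb Z_+$, with multiplicities $$\sum_{\substack{0\le i\le m\\ i\text{ even}}}\frac{{}^\pm h_j^{(i)}x^i}{i!}\qquad\text{and}\qquad\sum_{\substack{0\le i\le m\\ i\text{ odd}}}\frac{{}^\pm h_j^{(i)}x^i}{i!}$$ respectively (exponents with zero multiplicity are omitted). In particular it is isomorphic to every $\widehat{\mathcal D}_x^\pm$-module of the form $L(\widehat{\mathcal D}_x^\pm;e^+,e^-)$ with these exponents and multiplicities. -/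

import Mathlib

open Polynomial

noncomputable section

set_option linter.unusedSectionVars false

namespace WInfinity

/-- The operators `∑ₖ tᵏ fₖ(D)` with `fₖ ∈ ℂ[x]`, almost all zero; the value at `k` is `fₖ`. -/
def DiffOp : Type := ℤ →₀ ℂ[X]

namespace DiffOp

instance : AddCommGroup DiffOp := inferInstanceAs (AddCommGroup (ℤ →₀ ℂ[X]))

instance : Module ℂ DiffOp := inferInstanceAs (Module ℂ (ℤ →₀ ℂ[X]))

/-- The operator `tᵏ f(D)`. -/
def mono (k : ℤ) : ℂ[X] →ₗ[ℂ] DiffOp := Finsupp.lsingle k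

/-- The polynomial `fₖ` in `F = ∑ₖ tᵏ fₖ(D)`. -/
def coeff (k : ℤ) : DiffOp →ₗ[ℂ] ℂ[X] :=
  (Finsupp.lapply k : (ℤ →₀ ℂ[X]) →ₗ[ℂ] ℂ[X])

/-- The linear map on `DiffOp` with prescribed restrictions to the spaces `{tᵏ f(D)}`. -/
def lift {M : Type*} [AddCommGroup M] [Module ℂ M] (h : ℤ → ℂ[X] →ₗ[ℂ] M) : DiffOp →ₗ[ℂ] M :=
  (Finsupp.lsum ℂ h : (ℤ →₀ ℂ[X]) →ₗ[ℂ] M)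

@[simp] lemma lift_mono {M : Type*} [AddCommGroup M] [Module ℂ M] (h : ℤ → ℂ[X] →ₗ[ℂ] M)
    (k : ℤ) (f : ℂ[X]) : lift h (mono k f) = h k f := by
  simp only [lift, mono]
  exact (Finsupp.lsum_single ℂ h k f)

/-- The bilinear map on `DiffOp` with prescribed values on the pairs `(tʳ f(D), tˢ g(D))`. -/
def lift₂ {M : Type*} [AddCommGroup M] [Module ℂ M] (h : ℤ → ℤ → ℂ[X] →ₗ[ℂ] ℂ[X] →ₗ[ℂ] M) :
    DiffOp →ₗ[ℂ] DiffOp →ₗ[ℂ] M :=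
  lift fun r => (lift fun s => (h r s).flip).flip

@[simp] lemma lift₂_mono {M : Type*} [AddCommGroup M] [Module ℂ M]
    (h : ℤ → ℤ → ℂ[X] →ₗ[ℂ] ℂ[X] →ₗ[ℂ] M) (r s : ℤ) (f g : ℂ[X]) :
    lift₂ h (mono r f) (mono s g) = h r s f g := by
  simp [lift₂]

lemma induction {p : DiffOp → Prop} (F : DiffOp) (h0 : p 0) (hadd : ∀ F G, p F → p G → p (F + G))
    (hmono : ∀ k f, p (mono k f)) : p F :=
  Finsupp.induction_linear (motive := p) F h0 hadd hmono

lemma coeff_mono (k l : ℤ) (f : ℂ[X]) : coeff l (mono k f) = if k = l then f else 0 := by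
  classical
  exact Finsupp.single_apply

lemma ext {F G : DiffOp} (h : ∀ k, coeff k F = coeff k G) : F = G := Finsupp.ext h

/-- The product of the associative algebra of differential operators,
`tʳ f(D) · tˢ g(D) = tʳ⁺ˢ f(D + s) g(D)`. -/
def mulBilin : DiffOp →ₗ[ℂ] DiffOp →ₗ[ℂ] DiffOp :=
  lift₂ fun r s => LinearMap.mk₂ ℂ (fun f g => mono (r + s) (f.comp (X + C (s : ℂ)) * g))
    (by intros; simp [add_mul]) (by intros; simp) (by intros; simp [mul_add]) (by intros; simp)

instance : Mul DiffOp := ⟨fun F G => mulBilin F G⟩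

lemma mul_def (F G : DiffOp) : F * G = mulBilin F G := rfl

lemma mono_mul_mono (r s : ℤ) (f g : ℂ[X]) :
    mono r f * mono s g = mono (r + s) (f.comp (X + C (s : ℂ)) * g) := by
  simp [mul_def, mulBilin]

protected lemma mul_assoc' (F G H : DiffOp) : F * G * H = F * (G * H) := by
  induction F using induction with
  | h0 => simp [mul_def]
  | hadd F F' h h' => simp only [mul_def, map_add, LinearMap.add_apply] at *; rw [h, h']
  | hmono r f =>
  induction G using induction with
  | h0 => simp [mul_def]
  | hadd F F' h h' => simp only [mul_def, map_add, LinearMap.add_apply] at *; rw [h, h']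
  | hmono s g =>
  induction H using induction with
  | h0 => simp [mul_def]
  | hadd F F' h h' => simp only [mul_def, map_add] at *; rw [h, h']
  | hmono q e =>
    rw [mono_mul_mono, mono_mul_mono, mono_mul_mono, mono_mul_mono, add_assoc]
    congr 1
    simp only [mul_comp, comp_assoc, add_comp, X_comp, C_comp, Int.cast_add, C_add]
    rw [mul_assoc, add_assoc, add_comm (C (q : ℂ))]

instance : One DiffOp := ⟨mono 0 1⟩

lemma one_def : (1 : DiffOp) = mono 0 1 := rfl

protected lemma one_mul' (F : DiffOp) : 1 * F = F := by
  induction F using induction with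
  | h0 => simp [mul_def]
  | hadd F F' h h' => simp only [mul_def, map_add] at *; rw [h, h']
  | hmono r f => simp [one_def, mono_mul_mono]

protected lemma mul_one' (F : DiffOp) : F * 1 = F := by
  induction F using induction with
  | h0 => simp [mul_def]
  | hadd F F' h h' => simp only [mul_def, map_add, LinearMap.add_apply] at *; rw [h, h']
  | hmono r f => simp [one_def, mono_mul_mono]

instance : Ring DiffOp where
  neg_add_cancel := neg_add_cancel
  zsmul := (· • ·)
  sub_eq_add_neg := sub_eq_add_neg
  zsmul_zero' := SubNegMonoid.zsmul_zero'
  zsmul_succ' := SubNegMonoid.zsmul_succ'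
  zsmul_neg' := SubNegMonoid.zsmul_neg'
  one_mul := DiffOp.one_mul'
  mul_one := DiffOp.mul_one'
  left_distrib F G H := by simp [mul_def]
  right_distrib F G H := by simp [mul_def]
  zero_mul F := by simp [mul_def]
  mul_zero F := by simp [mul_def]
  mul_assoc := DiffOp.mul_assoc'

instance : LieRing DiffOp := LieRing.ofAssociativeRing

lemma lie_def (F G : DiffOp) : ⁅F, G⁆ = F * G - G * F := rfl

instance : LieAlgebra ℂ DiffOp where
  toModule := inferInstance
  lie_smul c F G := by simp [lie_def, mul_def, smul_sub]

/-- The bracket of the Lie algebra of differential operators. -/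
lemma lie_mono_mono (r s : ℤ) (f g : ℂ[X]) :
    ⁅mono r f, mono s g⁆ =
      mono (r + s) (f.comp (X + C (s : ℂ)) * g - f * g.comp (X + C (r : ℂ))) := by
  rw [lie_def, mono_mul_mono, mono_mul_mono, add_comm s r, ← map_sub, mul_comm _ f]

end DiffOp

/-! ### Infinite matrices with finitely many nonzero diagonals -/

section Matrices

variable (R : Type*) [CommRing R] [Algebra ℂ R]

/-- The vector `vⱼ` of the free `R`-module with basis `(vⱼ)`, `j ∈ ℤ`. -/
abbrev basisVec {R : Type*} [CommRing R] (j : ℤ) : ℤ →₀ R := Finsupp.single j 1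

/-- The matrix entry `A i j`, i.e. the coefficient of `vᵢ` in `A vⱼ`. -/
def matEntry {R : Type*} [CommRing R] (A : Module.End R (ℤ →₀ R)) (i j : ℤ) : R :=
  A (basisVec j) i

lemma matEntry_ext {R : Type*} [CommRing R] {A B : Module.End R (ℤ →₀ R)}
    (h : ∀ i j, matEntry A i j = matEntry B i j) : A = B := by
  refine Finsupp.lhom_ext' fun j => LinearMap.ext_ring ?_
  ext i
  exact h i j

lemma matEntry_mul {R : Type*} [CommRing R] (A B : Module.End R (ℤ →₀ R)) (i j : ℤ) :
    matEntry (A * B) i j = ∑ᶠ k, matEntry A i k * matEntry B k j := by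
  have h : B (basisVec j) = (B (basisVec j)).sum fun k r => r • basisVec k := by
    simp
  unfold matEntry
  rw [Module.End.mul_apply]
  conv_lhs => rw [h]
  rw [Finsupp.sum, map_sum, Finsupp.finsetSum_apply,
    finsum_eq_sum_of_support_subset (s := (B (basisVec j)).support)]
  · refine Finset.sum_congr rfl fun k _ => ?_
    rw [map_smul, Finsupp.smul_apply, smul_eq_mul, mul_comm]
  · intro k hk
    simp only [Function.mem_support] at hk
    simp only [Finset.mem_coe, Finsupp.mem_support_iff]
    exact fun h0 => hk (by rw [h0, mul_zero])

/-- The associative algebra of matrices `(a i j)`, `i, j ∈ ℤ`, with entries in `R` and finitely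
many nonzero diagonals, realized as operators on the free `R`-module with basis `(vⱼ)`. -/
def glInf : Subalgebra ℂ (Module.End R (ℤ →₀ R)) where
  carrier := {A | ∃ N : ℤ, ∀ i j : ℤ, N < |i - j| → matEntry A i j = 0}
  mul_mem' := by
    rintro A B ⟨N, hN⟩ ⟨M, hM⟩
    refine ⟨N + M, fun i j h => ?_⟩
    rw [matEntry_mul]
    refine finsum_eq_zero_of_forall_eq_zero fun k => ?_
    rcases lt_or_ge N |i - k| with h1 | h1
    · rw [hN _ _ h1, zero_mul]
    · rw [hM, mul_zero]
      have := abs_sub_le i k j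
      omega
  add_mem' := by
    rintro A B ⟨N, hN⟩ ⟨M, hM⟩
    refine ⟨max N M, fun i j h => ?_⟩
    have h1 := hN i j (lt_of_le_of_lt (le_max_left _ _) h)
    have h2 := hM i j (lt_of_le_of_lt (le_max_right _ _) h)
    simp only [matEntry] at *
    simp [h1, h2]
  algebraMap_mem' c := by
    refine ⟨0, fun i j h => ?_⟩
    have : j ≠ i := by rintro rfl; simp at h
    simp [matEntry, Module.algebraMap_end_apply, this]


variable {R}

/-- The operator `∑ⱼ a j • E (j - k) j`, i.e. the matrix concentrated on a single diagonal. -/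
def diagonalOp (k : ℤ) (a : ℤ → R) : Module.End R (ℤ →₀ R) :=
  Finsupp.linearCombination R fun j => Finsupp.single (j - k) (a j)

lemma matEntry_diagonalOp (k : ℤ) (a : ℤ → R) (i j : ℤ) :
    matEntry (diagonalOp k a) i j = if j - k = i then a j else 0 := by
  classical
  simp [matEntry, diagonalOp, Finsupp.single_apply]

lemma diagonalOp_mem (k : ℤ) (a : ℤ → R) : diagonalOp k a ∈ glInf R := by
  refine ⟨|k|, fun i j h => ?_⟩
  rw [matEntry_diagonalOp, if_neg]
  rintro rfl
  simp at h

lemma diagonalOp_mul (r s : ℤ) (a b : ℤ → R) :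
    diagonalOp r a * diagonalOp s b = diagonalOp (r + s) fun j => a (j - s) * b j := by
  refine Finsupp.lhom_ext' fun j => LinearMap.ext_ring ?_
  simp [diagonalOp, mul_comm, sub_sub, add_comm r s]

/-- The matrix with entry `r` at the place `(i, j)` and zeros elsewhere. -/
def matUnit (i j : ℤ) (r : R) : Module.End R (ℤ →₀ R) :=
  diagonalOp (j - i) fun l => if l = j then r else 0

lemma matEntry_matUnit (i j : ℤ) (r : R) (k l : ℤ) :
    matEntry (matUnit i j r) k l = if k = i ∧ l = j then r else 0 := by
  rw [matUnit, matEntry_diagonalOp]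
  by_cases h : l = j
  · subst h
    by_cases h' : k = i
    · subst h'; simp
    · have : ¬ i = k := fun h => h' h.symm
      simp [h', this]
  · simp [h]

instance : Ring (glInf R) := @Subalgebra.toRing ℂ (Module.End R (ℤ →₀ R)) _ _ _ (glInf R)

instance : LieRing (glInf R) := LieRing.ofAssociativeRing

lemma glInf_lie_def (A B : glInf R) : ⁅A, B⁆ = A * B - B * A := rfl

instance : LieAlgebra ℂ (glInf R) where
  toModule := inferInstance
  lie_smul c A B := by simp [glInf_lie_def, smul_sub]

variable (R) in
/-- The matrix `J = ∑_{j ≤ 0} E j j`. -/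
def matJ : glInf R := ⟨diagonalOp 0 fun j => if j ≤ 0 then 1 else 0, diagonalOp_mem _ _⟩

/-- The two-cocycle `C(A, B) = tr([J, A] B)`. The diagonal of `[J, A] B` has finitely many nonzero
entries. -/
def trCocycle (A B : glInf R) : R := ∑ᶠ i : ℤ, matEntry (⁅matJ R, A⁆ * B : glInf R).1 i i

/-- The indicator of the non-positive integers. -/
def theta (R : Type*) [CommRing R] (i : ℤ) : R := if i ≤ 0 then 1 else 0

lemma matEntry_add (A B : Module.End R (ℤ →₀ R)) (i j : ℤ) :
    matEntry (A + B) i j = matEntry A i j + matEntry B i j := by simp [matEntry]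

lemma matEntry_sub (A B : Module.End R (ℤ →₀ R)) (i j : ℤ) :
    matEntry (A - B) i j = matEntry A i j - matEntry B i j := by simp [matEntry]

lemma matEntry_smul (c : ℂ) (A : Module.End R (ℤ →₀ R)) (i j : ℤ) :
    matEntry (c • A) i j = c • matEntry A i j := by simp [matEntry]

lemma matEntry_diag_mul (a : ℤ → R) (A : Module.End R (ℤ →₀ R)) (i j : ℤ) :
    matEntry (diagonalOp 0 a * A) i j = a i * matEntry A i j := by
  rw [matEntry_mul, finsum_eq_single _ i]
  · simp [matEntry_diagonalOp]
  · intro k hk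
    simp [matEntry_diagonalOp, hk]

lemma matEntry_mul_diag (a : ℤ → R) (A : Module.End R (ℤ →₀ R)) (i j : ℤ) :
    matEntry (A * diagonalOp 0 a) i j = matEntry A i j * a j := by
  rw [matEntry_mul, finsum_eq_single _ j]
  · simp [matEntry_diagonalOp]
  · intro k hk
    simp [matEntry_diagonalOp, hk.symm]

lemma matEntry_lie_matJ (A : glInf R) (i j : ℤ) :
    matEntry (⁅matJ R, A⁆ : glInf R).1 i j = (theta R i - theta R j) * matEntry A.1 i j := by
  rw [glInf_lie_def]
  have : ((matJ R * A - A * matJ R : glInf R) : Module.End R (ℤ →₀ R)) =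
    (matJ R).1 * A.1 - A.1 * (matJ R).1 := rfl
  rw [this, matEntry_sub, matJ, matEntry_diag_mul, matEntry_mul_diag]
  unfold theta
  ring

/-- `A` vanishes outside of the diagonals at distance at most `N`. -/
def Band (N : ℤ) (A : Module.End R (ℤ →₀ R)) : Prop :=
  ∀ i j : ℤ, N < |i - j| → matEntry A i j = 0

lemma Band.mono {N M : ℤ} {A : Module.End R (ℤ →₀ R)} (h : Band N A) (hNM : N ≤ M) : Band M A :=
  fun i j hij => h i j (lt_of_le_of_lt hNM hij)

lemma exists_band (A : glInf R) : ∃ N : ℤ, 0 ≤ N ∧ Band N A.1 := by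
  obtain ⟨N, hN⟩ := A.2
  exact ⟨max N 0, le_max_right _ _, Band.mono hN (le_max_left _ _)⟩

lemma theta_eq {i j : ℤ} (h : (0 < i ↔ 0 < j)) : theta R i - theta R j = 0 := by
  unfold theta
  by_cases hi : i ≤ 0
  · have : j ≤ 0 := by omega
    simp [hi, this]
  · have : ¬ j ≤ 0 := by omega
    simp [hi, this]

lemma theta_mul_eq_zero {N : ℤ} {A : Module.End R (ℤ →₀ R)} (h : Band N A) {i j : ℤ}
    (hij : N < |i| ∨ N < |j|) : (theta R i - theta R j) * matEntry A i j = 0 := by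
  rcases lt_or_ge N |i - j| with h1 | h1
  · rw [h i j h1, mul_zero]
  · rw [theta_eq, zero_mul]
    rw [lt_abs, lt_abs] at hij
    rw [abs_le] at h1
    omega

lemma theta_mul_eq_zero' {N : ℤ} {A : Module.End R (ℤ →₀ R)} (h : Band N A) {i j : ℤ}
    (hij : N < |i| ∨ N < |j|) : (theta R i - theta R j) * matEntry A j i = 0 := by
  rw [← neg_sub, neg_mul, theta_mul_eq_zero h hij.symm, neg_zero]

lemma finsum_eq_box {N : ℤ} {f : ℤ → R} (h : ∀ i, N < |i| → f i = 0) :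
    ∑ᶠ i, f i = ∑ i ∈ Finset.Icc (-N) N, f i := by
  refine finsum_eq_sum_of_support_subset _ fun i hi => ?_
  simp only [Function.mem_support] at hi
  rw [Finset.coe_Icc, Set.mem_Icc, ← abs_le]
  by_contra h'
  exact hi (h i (not_le.mp h'))

lemma trCocycle_eq_left {N : ℤ} {A : glInf R} (h : Band N A.1) (B : glInf R) :
    trCocycle A B = ∑ i ∈ Finset.Icc (-N) N, ∑ k ∈ Finset.Icc (-N) N,
      (theta R i - theta R k) * matEntry A.1 i k * matEntry B.1 k i := by
  unfold trCocycle
  have key : ∀ i, matEntry (⁅matJ R, A⁆ * B : glInf R).1 i i =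
      ∑ k ∈ Finset.Icc (-N) N,
        (theta R i - theta R k) * matEntry A.1 i k * matEntry B.1 k i := by
    intro i
    have : (⁅matJ R, A⁆ * B : glInf R).1 = (⁅matJ R, A⁆ : glInf R).1 * B.1 := rfl
    rw [this, matEntry_mul]
    simp_rw [matEntry_lie_matJ]
    exact finsum_eq_box fun k hk => by rw [theta_mul_eq_zero h (Or.inr hk), zero_mul]
  simp_rw [key]
  refine finsum_eq_box fun i hi => Finset.sum_eq_zero fun k _ => ?_
  rw [theta_mul_eq_zero h (Or.inl hi), zero_mul]

lemma trCocycle_add_left (A A' B : glInf R) :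
    trCocycle (A + A') B = trCocycle A B + trCocycle A' B := by
  obtain ⟨N, hN0, hN⟩ := exists_band A
  obtain ⟨M, hM0, hM⟩ := exists_band A'
  have h1 := hN.mono (le_add_of_nonneg_right hM0)
  have h2 := hM.mono (le_add_of_nonneg_left hN0)
  have h3 : Band (N + M) (A + A').1 := fun i j h => by
    rw [show (A + A').1 = A.1 + A'.1 from rfl, matEntry_add, h1 i j h, h2 i j h, add_zero]
  rw [trCocycle_eq_left h1, trCocycle_eq_left h2, trCocycle_eq_left h3]
  simp_rw [← Finset.sum_add_distrib]
  refine Finset.sum_congr rfl fun i _ => Finset.sum_congr rfl fun k _ => ?_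
  rw [show (A + A').1 = A.1 + A'.1 from rfl, matEntry_add]
  ring

lemma trCocycle_add_right (A B B' : glInf R) :
    trCocycle A (B + B') = trCocycle A B + trCocycle A B' := by
  obtain ⟨N, hN0, hN⟩ := exists_band A
  rw [trCocycle_eq_left hN, trCocycle_eq_left hN, trCocycle_eq_left hN]
  simp_rw [← Finset.sum_add_distrib]
  refine Finset.sum_congr rfl fun i _ => Finset.sum_congr rfl fun k _ => ?_
  rw [show (B + B').1 = B.1 + B'.1 from rfl, matEntry_add]
  ring

lemma trCocycle_smul_right (c : ℂ) (A B : glInf R) :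
    trCocycle A (c • B) = c • trCocycle A B := by
  obtain ⟨N, hN0, hN⟩ := exists_band A
  rw [trCocycle_eq_left hN, trCocycle_eq_left hN]
  simp_rw [Finset.smul_sum]
  refine Finset.sum_congr rfl fun i _ => Finset.sum_congr rfl fun k _ => ?_
  rw [show (c • B).1 = c • B.1 from rfl, matEntry_smul, mul_smul_comm]

lemma trCocycle_skew (A B : glInf R) : trCocycle A B = - trCocycle B A := by
  obtain ⟨N, hN0, hN⟩ := exists_band A
  obtain ⟨M, hM0, hM⟩ := exists_band B
  have h1 := hN.mono (le_add_of_nonneg_right hM0)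
  have h2 := hM.mono (le_add_of_nonneg_left hN0)
  rw [trCocycle_eq_left h1, trCocycle_eq_left h2, Finset.sum_comm]
  simp_rw [← Finset.sum_neg_distrib]
  refine Finset.sum_congr rfl fun i _ => Finset.sum_congr rfl fun k _ => ?_
  ring

lemma trCocycle_smul_left (c : ℂ) (A B : glInf R) :
    trCocycle (c • A) B = c • trCocycle A B := by
  rw [trCocycle_skew, trCocycle_smul_right, trCocycle_skew A B, smul_neg]

lemma trCocycle_self (A : glInf R) : trCocycle A A = 0 := by
  have h := trCocycle_skew A A
  have h2 : (2 : ℂ) • trCocycle A A = 0 := by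
    rw [two_smul]
    nth_rewrite 1 [h]
    simp
  have h3 : ((2 : ℂ)⁻¹ * 2) • trCocycle A A = 0 := by rw [mul_smul, h2, smul_zero]
  simpa using h3

lemma trCocycle_lie (A B D : glInf R) :
    trCocycle A ⁅B, D⁆ = trCocycle ⁅A, B⁆ D + trCocycle B ⁅A, D⁆ := by
  obtain ⟨NA, hA0, hA⟩ := exists_band A
  obtain ⟨NB, hB0, hB⟩ := exists_band B
  obtain ⟨ND, hD0, hD⟩ := exists_band D
  obtain ⟨N, hN⟩ : ∃ N, N = NA + NB + ND := ⟨_, rfl⟩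
  have mul_box : ∀ {M K : ℤ} {X Y : glInf R}, Band M X.1 → M + K ≤ N → ∀ i j, |i| ≤ K →
      matEntry (X * Y : glInf R).1 i j =
        ∑ l ∈ Finset.Icc (-N) N, matEntry X.1 i l * matEntry Y.1 l j := by
    intro M K X Y hX hMK i j hi
    rw [show (X * Y : glInf R).1 = X.1 * Y.1 from rfl, matEntry_mul]
    refine finsum_eq_box fun l hl => ?_
    rw [hX, zero_mul]
    have := abs_sub_abs_le_abs_sub l i
    rw [abs_sub_comm] at this
    omega
  have lie_box : ∀ {M M' K : ℤ} {X Y : glInf R}, Band M X.1 → M + K ≤ N → Band M' Y.1 →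
      M' + K ≤ N → ∀ i j, |i| ≤ K →
      matEntry (⁅X, Y⁆ : glInf R).1 i j =
        ∑ l ∈ Finset.Icc (-N) N,
          (matEntry X.1 i l * matEntry Y.1 l j - matEntry Y.1 i l * matEntry X.1 l j) := by
    intro M M' K X Y hX h hY h' i j hi
    rw [glInf_lie_def, show (X * Y - Y * X : glInf R).1 = (X * Y).1 - (Y * X).1 from rfl,
      matEntry_sub, mul_box hX h i j hi, mul_box hY h' i j hi, Finset.sum_sub_distrib]
  have main : ∀ {M M' K : ℤ} {Z X Y : glInf R}, Band K Z.1 → Band M X.1 → Band M' Y.1 →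
      0 ≤ K → 0 ≤ M → 0 ≤ M' → M + M' + K = N →
      trCocycle Z ⁅X, Y⁆ = ∑ i ∈ Finset.Icc (-N) N, ∑ k ∈ Finset.Icc (-N) N,
        ∑ l ∈ Finset.Icc (-N) N, (theta R i - theta R k) * matEntry Z.1 i k *
          (matEntry X.1 k l * matEntry Y.1 l i - matEntry Y.1 k l * matEntry X.1 l i) := by
    intro M M' K Z X Y hZ hX hY hK hM hM' hN
    rw [trCocycle_eq_left (hZ.mono (by omega : K ≤ N))]
    refine Finset.sum_congr rfl fun i _ => Finset.sum_congr rfl fun k _ => ?_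
    rw [← Finset.mul_sum]
    rcases le_or_gt |k| K with hk | hk
    · rw [lie_box hX (by omega) hY (by omega) k i hk]
    · rw [theta_mul_eq_zero hZ (Or.inr hk), zero_mul, zero_mul]
  rw [trCocycle_skew ⁅A, B⁆ D, main hA hB hD hA0 hB0 hD0 (by omega),
    main hB hA hD hB0 hA0 hD0 (by omega), main hD hA hB hD0 hA0 hB0 (by omega)]
  set s := Finset.Icc (-N) N
  have rot : ∀ f : ℤ → ℤ → ℤ → R, ∑ i ∈ s, ∑ k ∈ s, ∑ l ∈ s, f k l i =
      ∑ i ∈ s, ∑ k ∈ s, ∑ l ∈ s, f i k l := by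
    intro f
    symm
    rw [Finset.sum_congr rfl fun i _ => Finset.sum_comm, Finset.sum_comm]
  have rot' : ∀ f : ℤ → ℤ → ℤ → R, ∑ i ∈ s, ∑ k ∈ s, ∑ l ∈ s, f l i k =
      ∑ i ∈ s, ∑ k ∈ s, ∑ l ∈ s, f i k l := fun f => (rot fun i k l => f l i k).symm
  let P : ℤ → ℤ → ℤ → R := fun i k l => matEntry A.1 i k * matEntry B.1 k l * matEntry D.1 l i
  let Q : ℤ → ℤ → ℤ → R := fun i k l => matEntry A.1 i k * matEntry D.1 k l * matEntry B.1 l i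
  have e2 : ∑ i ∈ s, ∑ k ∈ s, ∑ l ∈ s, (theta R i - theta R k) * matEntry D.1 i k *
      (matEntry A.1 k l * matEntry B.1 l i - matEntry B.1 k l * matEntry A.1 l i) =
      ∑ i ∈ s, ∑ k ∈ s, ∑ l ∈ s, ((theta R l - theta R i) * P i k l -
        (theta R k - theta R l) * Q i k l) := by
    simp_rw [Finset.sum_sub_distrib]
    rw [← rot fun i k l => (theta R l - theta R i) * P i k l,
      ← rot' fun i k l => (theta R k - theta R l) * Q i k l]
    simp_rw [← Finset.sum_sub_distrib]
    refine Finset.sum_congr rfl fun i _ => Finset.sum_congr rfl fun k _ =>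
      Finset.sum_congr rfl fun l _ => ?_
    simp only [P, Q]
    ring
  have e3 : ∑ i ∈ s, ∑ k ∈ s, ∑ l ∈ s, (theta R i - theta R k) * matEntry B.1 i k *
      (matEntry A.1 k l * matEntry D.1 l i - matEntry D.1 k l * matEntry A.1 l i) =
      ∑ i ∈ s, ∑ k ∈ s, ∑ l ∈ s, ((theta R l - theta R i) * Q i k l -
        (theta R k - theta R l) * P i k l) := by
    simp_rw [Finset.sum_sub_distrib]
    rw [← rot fun i k l => (theta R l - theta R i) * Q i k l,
      ← rot' fun i k l => (theta R k - theta R l) * P i k l]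
    simp_rw [← Finset.sum_sub_distrib]
    refine Finset.sum_congr rfl fun i _ => Finset.sum_congr rfl fun k _ =>
      Finset.sum_congr rfl fun l _ => ?_
    simp only [P, Q]
    ring
  rw [e2, e3]
  simp_rw [← Finset.sum_neg_distrib, ← Finset.sum_add_distrib]
  refine Finset.sum_congr rfl fun i _ => Finset.sum_congr rfl fun k _ =>
    Finset.sum_congr rfl fun l _ => ?_
  simp only [P, Q]
  ring

variable (R)

/-- `trCocycle` as a bilinear map. -/
def trBilin : glInf R →ₗ[ℂ] glInf R →ₗ[ℂ] R :=
  LinearMap.mk₂ ℂ trCocycle trCocycle_add_left trCocycle_smul_left trCocycle_add_right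
    trCocycle_smul_right

open LieModule.Cohomology in
/-- The two-cocycle `C` on `glInf R` with values in the trivial module `R`. -/
def glCocycle : twoCocycle ℂ (glInf R) (TrivialLieModule ℂ (glInf R) R) :=
  ⟨⟨(trBilin R).compr₂ (TrivialLieModule.equiv ℂ (glInf R) R).symm.toLinearMap,
    fun A => trCocycle_self A⟩,
    (mem_twoCocycle_iff_of_trivial ℂ (glInf R) _ _).mpr fun A B D => trCocycle_lie A B D⟩

/-- The central extension of the Lie algebra `glInf R` by `R` corresponding to the cocycle `C`;
its elements are the pairs `(A, z)` with `A ∈ glInf R` and `z ∈ R` central. -/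
abbrev glHat : Type _ := LieAlgebra.ofTwoCocycle (glCocycle R)

variable {R}

/-- The element `A + z` of `glHat R`. -/
def glHat.mk (A : glInf R) (z : R) : glHat R := ⟨(A, z)⟩

/-- The component of an element of `glHat R` in `glInf R`. -/
def glHat.mat (x : glHat R) : glInf R := x.carrier.1

/-- The component of an element of `glHat R` in the center `R`. -/
def glHat.cent (x : glHat R) : R := x.carrier.2

lemma glHat.lie_def (x y : glHat R) :
    ⁅x, y⁆ = glHat.mk ⁅x.mat, y.mat⁆ (trCocycle x.mat y.mat) := by
  rw [LieAlgebra.bracket_ofTwoCocycle]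
  simp only [trivial_lie_zero, add_zero, sub_zero]
  rfl

/-- The operator `∑ₖ ∑ⱼ fₖ(z - j) E (j - k) j` attached to `∑ₖ tᵏ fₖ(D)`. -/
def phi (z : R) : DiffOp →ₗ[ℂ] glInf R :=
  DiffOp.lift fun k =>
    { toFun := fun f => ⟨diagonalOp k fun j => aeval (z - (j : R)) f, diagonalOp_mem _ _⟩
      map_add' := fun f g => Subtype.ext <| matEntry_ext fun i j => by
        change _ = matEntry (diagonalOp _ _ + diagonalOp _ _) i j
        simp only [matEntry_add, matEntry_diagonalOp, map_add]
        split_ifs <;> simp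
      map_smul' := fun c f => Subtype.ext <| matEntry_ext fun i j => by
        change _ = matEntry (c • diagonalOp _ _) i j
        simp only [matEntry_smul, matEntry_diagonalOp, map_smul]
        split_ifs <;> simp }

lemma phi_mono (z : R) (k : ℤ) (f : ℂ[X]) :
    phi z (DiffOp.mono k f) =
      ⟨diagonalOp k fun j => aeval (z - (j : R)) f, diagonalOp_mem _ _⟩ := by
  simp [phi]

lemma matEntry_phi (z : R) (F : DiffOp) (i j : ℤ) :
    matEntry (phi z F).1 i j = aeval (z - (j : R)) (DiffOp.coeff (j - i) F) := by
  induction F using DiffOp.induction with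
  | h0 => simp [matEntry]
  | hadd F G hF hG =>
    rw [map_add, map_add, map_add, ← hF, ← hG, ← matEntry_add]
    rfl
  | hmono k f =>
    rw [phi_mono, matEntry_diagonalOp, DiffOp.coeff_mono]
    have : (j - k = i) ↔ (k = j - i) := by omega
    simp only [this]
    split_ifs <;> simp

lemma phi_mul (z : R) (F G : DiffOp) : phi z (F * G) = phi z F * phi z G := by
  induction F using DiffOp.induction with
  | h0 => simp
  | hadd F F' h h' => rw [add_mul, map_add, map_add, h, h', add_mul]
  | hmono r f =>
  induction G using DiffOp.induction with
  | h0 => simp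
  | hadd F F' h h' => rw [mul_add, map_add, map_add, h, h', mul_add]
  | hmono s g =>
    rw [DiffOp.mono_mul_mono, phi_mono, phi_mono, phi_mono]
    refine Subtype.ext ?_
    change _ = diagonalOp _ _ * diagonalOp _ _
    rw [diagonalOp_mul]
    refine congrArg (diagonalOp (r + s)) (funext fun j => ?_)
    rw [map_mul, aeval_comp]
    congr 2
    simp only [map_add, aeval_X, map_intCast, Int.cast_sub]
    ring_nf

lemma phi_lie (z : R) (F G : DiffOp) : phi z ⁅F, G⁆ = ⁅phi z F, phi z G⁆ := by
  rw [DiffOp.lie_def, glInf_lie_def, map_sub, phi_mul, phi_mul]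

/-- `∑_{-r ≤ m ≤ -1} h m` if `r ≥ 0`, and `-∑_{0 ≤ m ≤ -r-1} h m` if `r ≤ 0`. -/
def signedSum {M : Type*} [AddCommGroup M] (r : ℤ) (h : ℤ → M) : M :=
  ∑ m ∈ Finset.Ico (-r) 0, h m - ∑ m ∈ Finset.Ico 0 (-r), h m

lemma signedSum_zero {M : Type*} [AddCommGroup M] (h : ℤ → M) : signedSum 0 h = 0 := by
  simp [signedSum]

lemma signedSum_succ {M : Type*} [AddCommGroup M] (r : ℤ) (h : ℤ → M) :
    signedSum (r + 1) h = signedSum r h + h (-r - 1) := by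
  unfold signedSum
  rcases le_or_gt 0 r with hr | hr
  · rw [Finset.Ico_eq_empty (by omega : ¬ 0 < -r), Finset.Ico_eq_empty (by omega : ¬ 0 < -(r + 1))]
    have : Finset.Ico (-(r + 1)) 0 = insert (-r - 1) (Finset.Ico (-r) 0) := by
      ext x; simp only [Finset.mem_Ico, Finset.mem_insert]; omega
    rw [this, Finset.sum_insert (by simp)]
    simp [add_comm]
  · rw [Finset.Ico_eq_empty (by omega : ¬ -r < 0), Finset.Ico_eq_empty (by omega : ¬ -(r + 1) < 0)]
    have : Finset.Ico 0 (-r) = insert (-r - 1) (Finset.Ico 0 (-(r + 1))) := by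
      ext x; simp only [Finset.mem_Ico, Finset.mem_insert]; omega
    rw [this, Finset.sum_insert (by simp; omega)]
    simp

lemma signedSum_add {M : Type*} [AddCommGroup M] (r : ℤ) (h h' : ℤ → M) :
    signedSum r (fun m => h m + h' m) = signedSum r h + signedSum r h' := by
  simp only [signedSum, Finset.sum_add_distrib]
  abel

lemma signedSum_smul {M : Type*} [AddCommGroup M] [Module ℂ M] (r : ℤ) (c : ℂ) (h : ℤ → M) :
    signedSum r (fun m => c • h m) = c • signedSum r h := by
  simp only [signedSum, ← Finset.smul_sum, smul_sub]

lemma signedSum_mul (r : ℤ) (c : ℂ) (h : ℤ → ℂ) :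
    signedSum r (fun m => c * h m) = c * signedSum r h :=
  signedSum_smul r c h

lemma finsum_theta (r : ℤ) (h : ℤ → R) :
    ∑ᶠ m : ℤ, (theta R (-m - r) - theta R (-m)) * h m = signedSum r h := by
  have h1 : ∀ m : ℤ, (theta R (-m - r) - theta R (-m)) * h m =
      (if m ∈ Finset.Ico (-r) 0 then h m else 0) - (if m ∈ Finset.Ico 0 (-r) then h m else 0) := by
    intro m
    simp only [theta, Finset.mem_Ico]
    have e1 : (-m - r ≤ 0) ↔ -r ≤ m := by omega
    have e2 : (-m ≤ 0) ↔ 0 ≤ m := by omega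
    simp only [e1, e2]
    by_cases a : -r ≤ m <;> by_cases b : 0 ≤ m <;> simp [a, b, ← not_le]
  simp_rw [h1]
  rw [finsum_eq_box (N := |r|), Finset.sum_sub_distrib, Finset.sum_ite_mem, Finset.sum_ite_mem,
    Finset.inter_eq_right.mpr, Finset.inter_eq_right.mpr, signedSum]
  · intro x; simp only [Finset.mem_Ico, Finset.mem_Icc]
    have := neg_le_abs r; have := le_abs_self r; omega
  · intro x; simp only [Finset.mem_Ico, Finset.mem_Icc]
    have := neg_le_abs r; have := le_abs_self r; omega
  · intro x hx
    rw [lt_abs] at hx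
    have := neg_le_abs r; have := le_abs_self r
    have : ¬ x ∈ Finset.Ico (-r) 0 := by rw [Finset.mem_Ico]; omega
    have : ¬ x ∈ Finset.Ico 0 (-r) := by rw [Finset.mem_Ico]; omega
    simp [*]

lemma trCocycle_phi_mono (z : R) (r s : ℤ) (f g : ℂ[X]) :
    trCocycle (phi z (DiffOp.mono r f)) (phi z (DiffOp.mono s g)) =
      if r + s = 0 then signedSum r fun m => aeval (z + (m : R)) (f * g.comp (X + C (r : ℂ)))
      else 0 := by
  have key : ∀ i, matEntry (⁅matJ R, phi z (DiffOp.mono r f)⁆ * phi z (DiffOp.mono s g) :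
      glInf R).1 i i = if r + s = 0 then (theta R i - theta R (i + r)) *
        (aeval (z - ((i + r : ℤ) : R)) f * aeval (z - (i : R)) g) else 0 := by
    intro i
    have e : ∀ A B : glInf R, (A * B).1 = A.1 * B.1 := fun _ _ => rfl
    rw [e, matEntry_mul]
    simp_rw [matEntry_lie_matJ, phi_mono, matEntry_diagonalOp]
    rw [finsum_eq_single _ (i - s)]
    · by_cases h : r + s = 0
      · have h' : i - s = i + r := by omega
        simp [h, h', mul_assoc]
      · have h' : ¬ (i - s - r = i) := by omega
        simp [h, h']
    · intro k hk
      simp [hk.symm]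
  unfold trCocycle
  simp_rw [key]
  split_ifs with h
  · rw [← finsum_theta, ← finsum_comp_equiv ((Equiv.neg ℤ).trans (Equiv.subRight r))]
    refine finsum_congr fun m => ?_
    simp only [Equiv.trans_apply, Equiv.neg_apply, Equiv.subRight_apply, map_mul, aeval_comp]
    congr 2
    · congr 2; omega
    · push_cast; congr 1; simp
    · push_cast; simp; ring_nf
  · simp

end Matrices

section Extension

open LieModule.Cohomology

/-- The two-cocycle on the Lie algebra of differential operators, given on `tʳ f(D)`, `tˢ g(D)` by
`∑_{-r ≤ m ≤ -1} f(m) g(m + r)` for `r = -s > 0`, by skew-symmetry for `r = -s < 0`, and by `0` in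
all other cases. -/
def psi : DiffOp →ₗ[ℂ] DiffOp →ₗ[ℂ] ℂ :=
  DiffOp.lift₂ fun r s => LinearMap.mk₂ ℂ
    (fun f g => if r + s = 0 then
      signedSum r fun m => f.eval (m : ℂ) * g.eval ((m + r : ℤ) : ℂ) else 0)
    (by intros; split_ifs <;> simp [add_mul, signedSum_add])
    (by intros; split_ifs <;> simp [mul_assoc, signedSum_mul])
    (by intros; split_ifs <;> simp [mul_add, signedSum_add])
    (by intros; split_ifs <;> simp [mul_left_comm, signedSum_mul])

lemma psi_mono (r s : ℤ) (f g : ℂ[X]) : psi (DiffOp.mono r f) (DiffOp.mono s g) =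
    if r + s = 0 then signedSum r fun m => f.eval (m : ℂ) * g.eval ((m + r : ℤ) : ℂ) else 0 := by
  simp [psi]

lemma psi_eq (F G : DiffOp) : psi F G = trCocycle (phi (0 : ℂ) F) (phi (0 : ℂ) G) := by
  change psi F G = trBilin ℂ (phi (0 : ℂ) F) (phi (0 : ℂ) G)
  induction F using DiffOp.induction with
  | h0 => simp
  | hadd F F' h h' => simp only [map_add, LinearMap.add_apply, h, h']
  | hmono r f =>
  induction G using DiffOp.induction with
  | h0 => simp
  | hadd F F' h h' => simp only [map_add, h, h']
  | hmono s g =>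
    change _ = trCocycle _ _
    rw [trCocycle_phi_mono, psi_mono]
    simp [eval_comp]

/-- The cocycle `psi` with values in the trivial module `ℂ`. -/
def psiCocycle : twoCocycle ℂ DiffOp (TrivialLieModule ℂ DiffOp ℂ) :=
  ⟨⟨psi.compr₂ (TrivialLieModule.equiv ℂ DiffOp ℂ).symm.toLinearMap,
    fun F => (psi_eq F F).trans (trCocycle_self _)⟩,
    (mem_twoCocycle_iff_of_trivial ℂ DiffOp _ _).mpr fun F G H => by
      change psi F ⁅G, H⁆ = psi ⁅F, G⁆ H + psi G ⁅F, H⁆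
      rw [psi_eq, psi_eq, psi_eq, phi_lie, phi_lie, phi_lie, trCocycle_lie]⟩

/-- The central extension of the Lie algebra of differential operators by a one-dimensional center
`ℂ C`; its elements are the pairs `(F, c)`, standing for `F + c C`. -/
abbrev DiffOpHat : Type := LieAlgebra.ofTwoCocycle psiCocycle

/-- The element `F + c C` of the central extension. -/
def DiffOpHat.mk (F : DiffOp) (c : ℂ) : DiffOpHat := ⟨(F, c)⟩

/-- The component of `F + c C` in the algebra of differential operators. -/
def DiffOpHat.op (x : DiffOpHat) : DiffOp := x.carrier.1

/-- The coefficient of `F + c C` at the central element `C`. -/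
def DiffOpHat.cent (x : DiffOpHat) : ℂ := x.carrier.2

lemma DiffOpHat.lie_def (x y : DiffOpHat) : ⁅x, y⁆ = DiffOpHat.mk ⁅x.op, y.op⁆ (psi x.op y.op) := by
  rw [LieAlgebra.bracket_ofTwoCocycle]
  simp only [trivial_lie_zero, add_zero, sub_zero]
  rfl

end Extension

/-! ### The coboundary correcting the cocycles -/

section Alpha

variable {R : Type*} [CommRing R] [Algebra ℂ R]

/-- The linear operator `xˡ ↦ B_{l+1}(x) / (l + 1)` on polynomials, with the Bernoulli polynomials
`B`. Its value at `h` solves the difference equation `P(x + 1) - P(x) = h(x)`; formally, it maps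
`e^{ax}` to `e^{ax} / (e^a - 1)`, up to an additive constant. -/
def antidiff : ℂ[X] →ₗ[ℂ] ℂ[X] :=
  (Polynomial.basisMonomials ℂ).constr ℂ fun l =>
    ((l : ℂ) + 1)⁻¹ • (Polynomial.bernoulli (l + 1)).map (algebraMap ℚ ℂ)

lemma antidiff_X_pow (l : ℕ) : antidiff (X ^ l) =
    ((l : ℂ) + 1)⁻¹ • (Polynomial.bernoulli (l + 1)).map (algebraMap ℚ ℂ) := by
  have : (X ^ l : ℂ[X]) = Polynomial.basisMonomials ℂ l := by simp [X_pow_eq_monomial]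
  rw [this, antidiff, Module.Basis.constr_basis]

lemma antidiff_spec (h : ℂ[X]) : (antidiff h).comp (X + C 1) - antidiff h = h := by
  induction h using Polynomial.induction_on' with
  | add p q hp hq => rw [map_add, add_comp]; linear_combination hp + hq
  | monomial l a =>
    have e : (monomial l a : ℂ[X]) = a • X ^ l := by simp [smul_X_eq_monomial]
    rw [e, map_smul, smul_comp, ← smul_sub]
    congr 1
    rw [antidiff_X_pow, smul_comp, ← smul_sub]
    have h1 := congrArg (Polynomial.map (algebraMap ℚ ℂ)) (bernoulli_comp_one_add_X (l + 1))
    rw [map_comp] at h1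
    have h2 : (Polynomial.map (algebraMap ℚ ℂ) (1 + X)) = X + C 1 := by simp [add_comm]
    rw [h2] at h1
    rw [h1]
    have h3 : (l : ℂ) + 1 ≠ 0 := by exact_mod_cast Nat.succ_ne_zero l
    simp only [Polynomial.map_add, add_sub_cancel_left, add_tsub_cancel_right]
    have h4 : Polynomial.map (algebraMap ℚ ℂ) ((l + 1) • X ^ l) = ((l : ℂ) + 1) • X ^ l := by
      simp [nsmul_eq_mul, smul_eq_C_mul]
    rw [h4, smul_smul, inv_mul_cancel₀ h3, one_smul]

lemma eq_C_of_comp_eq {p : ℂ[X]} (h : p.comp (X + C 1) = p) : p = C (p.eval 0) := by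
  have h1 : ∀ n : ℕ, p.eval (n : ℂ) = p.eval 0 := by
    intro n
    induction n with
    | zero => simp
    | succ n ih =>
      rw [← ih]
      conv_rhs => rw [← h]
      simp [eval_comp]
  refine Polynomial.eq_of_infinite_eval_eq _ _ (Set.Infinite.mono ?_
    (Set.infinite_range_of_injective (Nat.cast_injective (R := ℂ))))
  rintro _ ⟨n, rfl⟩
  simp [h1]

/-- The linear map `ℂ[x] → R` given on the generating series `e^{xD}` by
`-(e^{xz} - 1) / (e^x - 1)`; thus `xˡ` goes to `-(B_{l+1}(z) - B_{l+1}(0)) / (l + 1)`. -/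
def alpha (z : R) : ℂ[X] →ₗ[ℂ] R :=
  -((aeval z).toLinearMap - (Algebra.linearMap ℂ R) ∘ₗ (Polynomial.leval 0)) ∘ₗ antidiff

lemma alpha_apply (z : R) (h : ℂ[X]) :
    alpha z h = -(aeval z (antidiff h) - algebraMap ℂ R ((antidiff h).eval 0)) := by
  simp [alpha]

lemma alpha_comp (z : R) (h : ℂ[X]) :
    alpha z (h.comp (X + C 1)) - alpha z h = -(aeval z h - algebraMap ℂ R (h.eval 0)) := by
  obtain ⟨c, hc⟩ : ∃ c, antidiff (h.comp (X + C 1)) = (antidiff h).comp (X + C 1) + C c := by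
    refine ⟨_, sub_eq_iff_eq_add'.mp (eq_C_of_comp_eq ?_)⟩
    have h1 := antidiff_spec (h.comp (X + C 1))
    have h2 := congrArg (fun p => p.comp (X + C 1)) (antidiff_spec h)
    simp only [sub_comp] at h2 ⊢
    linear_combination h1 - h2
  have h3 := antidiff_spec h
  have h4 : (antidiff h).comp (X + C 1) = antidiff h + h := by linear_combination h3
  rw [alpha_apply, alpha_apply, hc, h4]
  simp
  ring

lemma signedSum_alpha (z : R) (H : ℂ[X]) (r : ℤ) :
    (signedSum r fun m => aeval (z + (m : R)) H) -
      algebraMap ℂ R (signedSum r fun m => H.eval (m : ℂ)) =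
    alpha z (H.comp (X - C (r : ℂ))) - alpha z H := by
  have step : ∀ r : ℤ, alpha z (H.comp (X - C ((r + 1 : ℤ) : ℂ))) -
      alpha z (H.comp (X - C (r : ℂ))) =
      aeval (z + ((-r - 1 : ℤ) : R)) H - algebraMap ℂ R (H.eval ((-r - 1 : ℤ) : ℂ)) := by
    intro r
    have h := alpha_comp z (H.comp (X - C ((r + 1 : ℤ) : ℂ)))
    have e : (H.comp (X - C ((r + 1 : ℤ) : ℂ))).comp (X + C 1) = H.comp (X - C (r : ℂ)) := by
      rw [comp_assoc]
      congr 1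
      simp
    rw [e] at h
    have e2 : aeval z (H.comp (X - C ((r + 1 : ℤ) : ℂ))) = aeval (z + ((-r - 1 : ℤ) : R)) H := by
      rw [aeval_comp]
      congr 2
      simp
      ring
    have e3 : (H.comp (X - C ((r + 1 : ℤ) : ℂ))).eval 0 = H.eval ((-r - 1 : ℤ) : ℂ) := by
      rw [eval_comp]
      congr 1
      simp
      ring
    rw [e2, e3] at h
    linear_combination -h
  induction r using Int.induction_on with
  | zero => simp [signedSum_zero]
  | succ n ih =>
    have := step n
    rw [signedSum_succ, signedSum_succ, map_add]
    linear_combination ih - this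
  | pred n ih =>
    have := step (-n - 1)
    have h1 := signedSum_succ (-n - 1) fun m => aeval (z + (m : R)) H
    have h2 := signedSum_succ (-n - 1) fun m => H.eval (m : ℂ)
    rw [sub_add_cancel] at h1 h2 this
    rw [h1, h2, map_add] at ih
    linear_combination ih + this

lemma trCocycle_phi (z : R) (F G : DiffOp) : trCocycle (phi z F) (phi z G) =
    alpha z (DiffOp.coeff 0 ⁅F, G⁆) + algebraMap ℂ R (psi F G) := by
  change trBilin R (phi z F) (phi z G) = _
  induction F using DiffOp.induction with
  | h0 => simp
  | hadd F F' h h' =>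
    simp only [map_add, LinearMap.add_apply, h, h', add_lie]; ring
  | hmono r f =>
  induction G using DiffOp.induction with
  | h0 => simp
  | hadd F F' h h' => simp only [map_add, h, h', lie_add]; ring
  | hmono s g =>
    change trCocycle _ _ = _
    rw [trCocycle_phi_mono, psi_mono, DiffOp.lie_mono_mono, DiffOp.coeff_mono]
    split_ifs with h
    · obtain rfl : s = -r := by omega
      have := signedSum_alpha z (f * g.comp (X + C (r : ℂ))) r
      rw [map_sub]
      have e1 : (f * g.comp (X + C (r : ℂ))).comp (X - C (r : ℂ)) =
          f.comp (X + C ((-r : ℤ) : ℂ)) * g := by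
        rw [mul_comp, comp_assoc]
        simp [sub_eq_add_neg]
      rw [e1] at this
      simp only [eval_mul, eval_comp, eval_add, eval_X, eval_C] at this
      simp only [Int.cast_add]
      linear_combination this
    · simp

end Alpha

/-! ### The truncated polynomial algebra -/

section Truncated

variable (m : ℕ)

/-- The truncated polynomial algebra `ℂ[u] / (u ^ (m + 1))`. -/
abbrev TruncPoly : Type := AdjoinRoot (X ^ (m + 1) : ℂ[X])

/-- The class of `u` in `ℂ[u] / (u ^ (m + 1))`. -/
def truncU : TruncPoly m := AdjoinRoot.root (X ^ (m + 1) : ℂ[X])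

lemma truncU_pow : truncU m ^ (m + 1) = 0 := by
  rw [truncU, ← AdjoinRoot.mk_X, ← map_pow, AdjoinRoot.mk_self]

/-- The substitution `u ↦ -u` on `ℂ[u] / (u ^ (m + 1))`. -/
def negU : TruncPoly m →ₐ[ℂ] TruncPoly m :=
  AdjoinRoot.liftAlgHom _ (Algebra.ofId ℂ _) (-truncU m) (by
    simp [neg_pow (truncU m), truncU_pow])

lemma negU_truncU : negU m (truncU m) = -truncU m := by
  simp [negU, truncU]

lemma negU_negU (x : TruncPoly m) : negU m (negU m x) = x := by
  have : (negU m).comp (negU m) = AlgHom.id ℂ _ := by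
    refine AdjoinRoot.algHom_ext ?_
    change negU m (negU m (truncU m)) = truncU m
    simp [negU_truncU]
  exact DFunLike.congr_fun this x

lemma isUnit_truncU_sub {k : ℤ} (hk : k ≠ 0) : IsUnit (truncU m - (k : TruncPoly m)) := by
  have h1 : IsUnit (-(k : TruncPoly m)) := by
    have : IsUnit (algebraMap ℂ (TruncPoly m) (k : ℂ)) :=
      (IsUnit.mk0 _ (Int.cast_ne_zero.mpr hk)).map _
    simpa using this
  rw [sub_eq_add_neg]
  exact IsNilpotent.isUnit_add_right_of_commute ⟨m + 1, truncU_pow m⟩ h1 (Commute.all _ _)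

/-- The factor `u - k` for `k ≠ 0`; the factor for `k = 0` is omitted from all products. -/
def factorU (k : ℤ) : (TruncPoly m)ˣ :=
  if h : k = 0 then 1 else (isUnit_truncU_sub m h).unit

lemma factorU_val {k : ℤ} (hk : k ≠ 0) : (factorU m k : TruncPoly m) = truncU m - k := by
  simp [factorU, hk]

/-- The scalar `∏_{i ≤ k < j, k ≠ 0} (u - k)` for `i < j`, `1` for `i = j`, and
`∏_{j ≤ k < i, k ≠ 0} (u - k)⁻¹` for `i > j`. -/
def tau (i j : ℤ) : (TruncPoly m)ˣ :=
  (∏ k ∈ Finset.Ico i j, factorU m k) * (∏ k ∈ Finset.Ico j i, factorU m k)⁻¹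

lemma tau_self (i : ℤ) : tau m i i = 1 := by simp [tau]

lemma tau_inv (i j : ℤ) : (tau m i j)⁻¹ = tau m j i := by simp [tau]

lemma tau_succ (i j : ℤ) : tau m i (j + 1) = tau m i j * factorU m j := by
  unfold tau
  rcases le_or_gt i j with h | h
  · rw [Finset.Ico_eq_empty (by omega : ¬ j < i), Finset.Ico_eq_empty (by omega : ¬ j + 1 < i)]
    have : Finset.Ico i (j + 1) = insert j (Finset.Ico i j) := by
      ext x; simp only [Finset.mem_Ico, Finset.mem_insert]; omega
    rw [this, Finset.prod_insert (by simp)]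
    simp [mul_comm]
  · rw [Finset.Ico_eq_empty (by omega : ¬ i < j), Finset.Ico_eq_empty (by omega : ¬ i < j + 1)]
    have : Finset.Ico j i = insert j (Finset.Ico (j + 1) i) := by
      ext x; simp only [Finset.mem_Ico, Finset.mem_insert]; omega
    rw [this, Finset.prod_insert (by simp)]
    simp

lemma tau_mul (i j l : ℤ) : tau m i j * tau m j l = tau m i l := by
  obtain ⟨n, rfl⟩ : ∃ n, l = j + n := ⟨l - j, by ring⟩
  induction n using Int.induction_on with
  | zero => simp [tau_self]
  | succ k ih => rw [← add_assoc, tau_succ, tau_succ, ← mul_assoc, ih]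
  | pred k ih =>
    have h1 := tau_succ m j (j + (-k - 1))
    have h2 := tau_succ m i (j + (-k - 1))
    have e : j + (-(k : ℤ) - 1) + 1 = j + -k := by ring
    rw [e] at h1 h2
    rw [h1, h2, ← mul_assoc] at ih
    exact mul_right_cancel ih

/-- The automorphism `T` of the matrix algebra multiplying the `(i, j)` entry by `tau i j`,
written as the conjugation by a diagonal matrix. -/
def twist : glInf (TruncPoly m) →ₗ[ℂ] glInf (TruncPoly m) where
  toFun A := ⟨diagonalOp 0 fun j => (tau m j 0 : TruncPoly m), diagonalOp_mem _ _⟩ * A *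
    ⟨diagonalOp 0 fun j => (tau m 0 j : TruncPoly m), diagonalOp_mem _ _⟩
  map_add' A B := by rw [mul_add, add_mul]
  map_smul' c A := by simp

lemma matEntry_twist (A : glInf (TruncPoly m)) (i j : ℤ) :
    matEntry (twist m A).1 i j = tau m i j * matEntry A.1 i j := by
  change matEntry (diagonalOp 0 _ * A.1 * diagonalOp 0 _) i j = _
  rw [matEntry_mul_diag, matEntry_diag_mul, ← tau_mul m i 0 j, Units.val_mul]
  ring

lemma twist_mul (A B : glInf (TruncPoly m)) : twist m (A * B) = twist m A * twist m B := by
  have : (⟨diagonalOp 0 fun j => (tau m 0 j : TruncPoly m), diagonalOp_mem _ _⟩ :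
      glInf (TruncPoly m)) * ⟨diagonalOp 0 fun j => (tau m j 0 : TruncPoly m), diagonalOp_mem _ _⟩
      = 1 := by
    refine Subtype.ext (matEntry_ext fun i j => ?_)
    change matEntry (diagonalOp 0 _ * diagonalOp 0 _) i j = matEntry 1 i j
    rw [diagonalOp_mul, matEntry_diagonalOp]
    simp only [sub_zero, add_zero]
    rw [← Units.val_mul, tau_mul, tau_self]
    simp [matEntry, Finsupp.single_apply]
  simp only [twist, LinearMap.coe_mk, AddHom.coe_mk]
  have h : ∀ d e X Y : glInf (TruncPoly m), e * d = 1 → d * (X * Y) * e = d * X * e * (d * Y * e) :=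
    fun d e X Y hed => by
      calc d * (X * Y) * e = d * X * 1 * Y * e := by simp only [mul_assoc, mul_one]
        _ = d * X * e * (d * Y * e) := by rw [← hed]; simp only [mul_assoc]
  exact h _ _ A B this

lemma twist_lie (A B : glInf (TruncPoly m)) : twist m ⁅A, B⁆ = ⁅twist m A, twist m B⁆ := by
  rw [glInf_lie_def, glInf_lie_def, map_sub, twist_mul, twist_mul]

lemma trCocycle_twist (A B : glInf (TruncPoly m)) :
    trCocycle (twist m A) (twist m B) = trCocycle A B := by
  have hJ : twist m (matJ _) = matJ _ := by
    refine Subtype.ext (matEntry_ext fun i j => ?_)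
    rw [matEntry_twist, matJ, matEntry_diagonalOp]
    by_cases h : j = i
    · simp [h, tau_self]
    · simp [h]
  unfold trCocycle
  refine finsum_congr fun i => ?_
  conv_lhs => rw [← hJ]
  rw [← twist_lie, ← twist_mul, matEntry_twist, tau_self]
  simp

/-- The homomorphism of central extensions
`∑ₖ tᵏ fₖ(D) + c C ↦ T (∑ₖ ∑ⱼ fₖ(u - j) E (j - k) j) + (alpha u f₀ + c)`. -/
def phiHat : DiffOpHat →ₗ⁅ℂ⁆ glHat (TruncPoly m) where
  toFun x := glHat.mk (twist m (phi (truncU m) x.op))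
    (alpha (truncU m) (DiffOp.coeff 0 x.op) + algebraMap ℂ (TruncPoly m) x.cent)
  map_add' x y := by
    have h1 : (x + y).op = x.op + y.op := rfl
    have h2 : (x + y).cent = x.cent + y.cent := rfl
    rw [h1, h2]
    simp only [map_add]
    rw [add_add_add_comm]
    rfl
  map_smul' c x := by
    have h1 : (c • x).op = c • x.op := rfl
    have h2 : (c • x).cent = c • x.cent := rfl
    rw [h1, h2]
    simp only [map_smul, RingHom.id_apply, Algebra.algebraMap_eq_smul_one,
      smul_assoc, ← smul_add]
    rfl
  map_lie' := by
    intro x y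
    rw [DiffOpHat.lie_def, glHat.lie_def]
    change glHat.mk (twist m (phi (truncU m) ⁅x.op, y.op⁆))
      (alpha (truncU m) (DiffOp.coeff 0 ⁅x.op, y.op⁆) +
        algebraMap ℂ (TruncPoly m) (psi x.op y.op)) =
      glHat.mk ⁅twist m (phi (truncU m) x.op), twist m (phi (truncU m) y.op)⁆
        (trCocycle (twist m (phi (truncU m) x.op)) (twist m (phi (truncU m) y.op)))
    rw [trCocycle_twist, trCocycle_phi, phi_lie, twist_lie]

end Truncated

/-! ### The Lie algebras `D_x^±` and `L_±^[m]`; the sign `±` is `ε : ℤˣ` -/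

section Subalgebras

/-- The differential operators that are multiples of `D` and are fixed by `-σ`, where
`σ (tᵏ f(D) D) = -(±t)ᵏ f(-D - k) D`. -/
def Dx (ε : ℤˣ) : Submodule ℂ DiffOp where
  carrier := {F | ∀ k : ℤ, ∃ f : ℂ[X], DiffOp.coeff k F = f * X ∧
    (ε ^ k) • f.comp (-X - C (k : ℂ)) = f}
  zero_mem' k := ⟨0, by simp⟩
  add_mem' := by
    intro F G hF hG k
    obtain ⟨f, hf, hf'⟩ := hF k
    obtain ⟨g, hg, hg'⟩ := hG k
    exact ⟨f + g, by rw [map_add, hf, hg, add_mul], by rw [add_comp, smul_add, hf', hg']⟩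
  smul_mem' := by
    intro c F hF k
    obtain ⟨f, hf, hf'⟩ := hF k
    exact ⟨c • f, by rw [map_smul, hf, smul_mul_assoc], by rw [smul_comp, smul_comm, hf']⟩

lemma mem_Dx_iff {ε : ℤˣ} {F : DiffOp} : F ∈ Dx ε ↔ ∀ k : ℤ, ∃ f : ℂ[X],
    DiffOp.coeff k F = f * X ∧ (ε ^ k) • f.comp (-X - C (k : ℂ)) = f := Iff.rfl

lemma mono_mem_Dx {ε : ℤˣ} {k : ℤ} {f : ℂ[X]} (h : (ε ^ k) • f.comp (-X - C (k : ℂ)) = f) :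
    DiffOp.mono k (f * X) ∈ Dx ε := by
  intro l
  rw [DiffOp.coeff_mono]
  split_ifs with hl
  · subst hl
    exact ⟨f, rfl, h⟩
  · exact ⟨0, by simp⟩

lemma DiffOp.eq_sum (F : DiffOp) :
    ∃ s : Finset ℤ, F = ∑ k ∈ s, DiffOp.mono k (DiffOp.coeff k F) := by
  refine ⟨Finsupp.support (M := ℂ[X]) F, ?_⟩
  exact (Finsupp.sum_single (M := ℂ[X]) F).symm

lemma Dx_induction {ε : ℤˣ} {p : DiffOp → Prop} {F : DiffOp} (hF : F ∈ Dx ε)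
    (h0 : p 0) (hadd : ∀ F G, p F → p G → p (F + G))
    (hmono : ∀ (k : ℤ) (f : ℂ[X]), (ε ^ k) • f.comp (-X - C (k : ℂ)) = f →
      p (DiffOp.mono k (f * X))) : p F := by
  obtain ⟨s, hs⟩ := DiffOp.eq_sum F
  rw [hs]
  refine Finset.sum_induction _ p hadd h0 fun k _ => ?_
  obtain ⟨f, hf, hf'⟩ := hF k
  rw [hf]
  exact hmono k f hf'

lemma exists_scalar (a : ℤˣ) : ∃ c : ℂ, c * c = 1 ∧
    ∀ {M : Type} [AddCommGroup M] [Module ℂ M] (x : M), a • x = c • x := by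
  rcases Int.units_eq_one_or a with rfl | rfl
  · exact ⟨1, by simp, by simp⟩
  · exact ⟨-1, by simp, by simp [Units.smul_def]⟩

lemma lie_mem_Dx {ε : ℤˣ} {F G : DiffOp} (hF : F ∈ Dx ε) (hG : G ∈ Dx ε) : ⁅F, G⁆ ∈ Dx ε := by
  refine Dx_induction (p := fun F => ⁅F, G⁆ ∈ Dx ε) hF (by simp) (fun F F' h h' => by rw [add_lie]; exact add_mem h h') ?_
  intro r f hf
  refine Dx_induction (p := fun G => ⁅DiffOp.mono r (f * X), G⁆ ∈ Dx ε) hG (by simp) (fun F F' h h' => by rw [lie_add]; exact add_mem h h') ?_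
  intro s g hg
  rw [DiffOp.lie_mono_mono]
  have e : (f * X).comp (X + C (s : ℂ)) * (g * X) - f * X * (g * X).comp (X + C (r : ℂ)) =
      (f.comp (X + C (s : ℂ)) * (X + C (s : ℂ)) * g -
        f * g.comp (X + C (r : ℂ)) * (X + C (r : ℂ))) * X := by
    simp only [mul_comp, X_comp]
    ring
  rw [e]
  refine mono_mem_Dx ?_
  obtain ⟨a, ha, ha'⟩ := exists_scalar (ε ^ r)
  obtain ⟨b, hb, hb'⟩ := exists_scalar (ε ^ s)
  rw [zpow_add, mul_smul, ha', hb']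
  rw [ha'] at hf
  rw [hb'] at hg
  have hf4 : f.comp (-X - C (r : ℂ)) = a • f := by
    conv_rhs => rw [← hf]
    rw [smul_smul, ha, one_smul]
  have hg4 : g.comp (-X - C (s : ℂ)) = b • g := by
    conv_rhs => rw [← hg]
    rw [smul_smul, hb, one_smul]
  have hf2 : (f.comp (X + C (s : ℂ))).comp (-X - C ((r + s : ℤ) : ℂ)) =
      f.comp (-X - C (r : ℂ)) := by
    rw [comp_assoc]; congr 1; simp; ring
  have hg2 : (g.comp (X + C (r : ℂ))).comp (-X - C ((r + s : ℤ) : ℂ)) =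
      g.comp (-X - C (s : ℂ)) := by
    rw [comp_assoc]; congr 1; simp; ring
  have hf3 : f.comp (-X - C ((r + s : ℤ) : ℂ)) =
      (f.comp (-X - C (r : ℂ))).comp (X + C (s : ℂ)) := by
    rw [comp_assoc]; congr 1; simp; ring
  have hg3 : g.comp (-X - C ((r + s : ℤ) : ℂ)) =
      (g.comp (-X - C (s : ℂ))).comp (X + C (r : ℂ)) := by
    rw [comp_assoc]; congr 1; simp; ring
  simp only [sub_comp, mul_comp, add_comp, X_comp, C_comp, hf2, hg2, hf3, hg3, hf4, hg4,
    smul_comp]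
  have hab : C a * C b * (C a * C b) = (1 : ℂ[X]) := by
    rw [← C_mul, ← C_mul, ← C_1]; congr 1; linear_combination (b * b) * ha + hb
  simp only [smul_eq_C_mul, Int.cast_add, C_add]
  linear_combination (f.comp (X + C (s : ℂ)) * (X + C (s : ℂ)) * g -
        f * g.comp (X + C (r : ℂ)) * (X + C (r : ℂ))) * hab

/-- The central extension of the Lie algebra `Dx ε` by `ℂ C`. -/
def DxHat (ε : ℤˣ) : LieSubalgebra ℂ DiffOpHat where
  carrier := {x | x.op ∈ Dx ε}
  zero_mem' := (Dx ε).zero_mem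
  add_mem' hx hy := (Dx ε).add_mem hx hy
  smul_mem' c _ hx := (Dx ε).smul_mem c hx
  lie_mem' := by
    intro x y hx hy
    rw [DiffOpHat.lie_def]
    exact lie_mem_Dx hx hy

/-- The matrices `A` satisfying the defining relations of the subalgebra of type `ε = ±`. -/
def Lbar (ε : ℤˣ) (m : ℕ) : Submodule ℂ (glInf (TruncPoly m)) where
  carrier := {A |
    (∀ i j : ℤ, 0 < i * j ∨ (i = 0 ∧ j = 0) →
      matEntry A.1 i j = -((-ε) ^ (i + j) • negU m (matEntry A.1 (-j) (-i)))) ∧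
    (∀ i j : ℤ, i * j < 0 →
      matEntry A.1 i j = (-ε) ^ (i + j) • negU m (matEntry A.1 (-j) (-i))) ∧
    (∀ i : ℤ, 0 < i →
      matEntry A.1 (-i) 0 = (-ε) ^ i • (truncU m * negU m (matEntry A.1 0 i))) ∧
    (∀ i : ℤ, 0 < i →
      matEntry A.1 i 0 = -((-ε) ^ i • (truncU m * negU m (matEntry A.1 0 (-i)))))}
  zero_mem' := by simp [matEntry]
  add_mem' := by
    rintro A B ⟨h1, h2, h3, h4⟩ ⟨g1, g2, g3, g4⟩
    have e : ∀ i j, matEntry (A + B).1 i j = matEntry A.1 i j + matEntry B.1 i j :=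
      fun i j => matEntry_add A.1 B.1 i j
    refine ⟨fun i j h => ?_, fun i j h => ?_, fun i h => ?_, fun i h => ?_⟩
    · rw [e, e, h1 i j h, g1 i j h, map_add, smul_add, neg_add]
    · rw [e, e, h2 i j h, g2 i j h, map_add, smul_add]
    · rw [e, e, h3 i h, g3 i h, map_add, mul_add, smul_add]
    · rw [e, e, h4 i h, g4 i h, map_add, mul_add, smul_add, neg_add]
  smul_mem' := by
    rintro c A ⟨h1, h2, h3, h4⟩
    have e : ∀ i j, matEntry (c • A).1 i j = c • matEntry A.1 i j :=
      fun i j => matEntry_smul c A.1 i j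
    refine ⟨fun i j h => ?_, fun i j h => ?_, fun i h => ?_, fun i h => ?_⟩
    · rw [e, e, h1 i j h, map_smul, smul_neg, smul_comm]
    · rw [e, e, h2 i j h, map_smul, smul_comm]
    · rw [e, e, h3 i h, map_smul, mul_smul_comm, smul_comm]
    · rw [e, e, h4 i h, map_smul, mul_smul_comm, smul_neg, smul_comm]

/-- The sign `aⁱ` as an element of a ring. -/
def zsign {R : Type*} [CommRing R] (a : ℤˣ) (i : ℤ) : R := (((a ^ i : ℤˣ) : ℤ) : R)

lemma zsign_smul {R : Type*} [CommRing R] (a : ℤˣ) (i : ℤ) (x : R) :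
    (a ^ i) • x = zsign a i * x := by
  rw [Units.smul_def, zsmul_eq_mul, zsign]

lemma zsign_add {R : Type*} [CommRing R] (a : ℤˣ) (i j : ℤ) :
    (zsign a (i + j) : R) = zsign a i * zsign a j := by
  simp [zsign, zpow_add]

lemma zsign_zero {R : Type*} [CommRing R] (a : ℤˣ) : (zsign a 0 : R) = 1 := by
  simp [zsign]

lemma zsign_mul_self {R : Type*} [CommRing R] (a : ℤˣ) (i : ℤ) :
    (zsign a i * zsign a i : R) = 1 := by
  rw [zsign, ← Int.cast_mul, ← Units.val_mul, Int.units_mul_self]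
  simp

lemma zsign_neg {R : Type*} [CommRing R] (a : ℤˣ) (i : ℤ) :
    (zsign a (-i) : R) = zsign a i := by
  rw [zsign, zsign, zpow_neg, Int.units_inv_eq_self]

lemma zsign_neg_left {R : Type*} [CommRing R] (a : ℤˣ) (i : ℤ) :
    (zsign (-a) i : R) = zsign (-1) i * zsign a i := by
  rw [zsign, zsign, zsign, ← Int.cast_mul, ← Units.val_mul, ← mul_zpow]
  simp

lemma negU_zsign (m : ℕ) (a : ℤˣ) (i : ℤ) : negU m (zsign a i) = zsign a i := by
  simp [zsign]

/-- The scalar `w 0 = u`, `w i = sign(i) (-ε) ^ i` used to write the relations uniformly. -/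
def wgt (ε : ℤˣ) (m : ℕ) (i : ℤ) : TruncPoly m :=
  if i = 0 then truncU m else zsign (-ε) i * (i.sign : TruncPoly m)

lemma wgt_zero (ε : ℤˣ) (m : ℕ) : wgt ε m 0 = truncU m := if_pos rfl

lemma wgt_pos (ε : ℤˣ) (m : ℕ) {i : ℤ} (hi : 0 < i) : wgt ε m i = zsign (-ε) i := by
  rw [wgt, if_neg (by omega), Int.sign_eq_one_of_pos hi]
  simp

lemma wgt_neg (ε : ℤˣ) (m : ℕ) {i : ℤ} (hi : i < 0) : wgt ε m i = -zsign (-ε) i := by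
  rw [wgt, if_neg (by omega), Int.sign_eq_neg_one_of_neg hi]
  simp

lemma Lbar_rel {ε : ℤˣ} {m : ℕ} {A : glInf (TruncPoly m)} (hA : A ∈ Lbar ε m) (i j : ℤ) :
    wgt ε m i * matEntry A.1 i j = -(negU m (matEntry A.1 (-j) (-i)) * wgt ε m j) := by
  obtain ⟨h1, h2, h3, h4⟩ := hA
  have hsi : (zsign (-ε) i * zsign (-ε) i : TruncPoly m) = 1 := zsign_mul_self _ _
  have hsj : (zsign (-ε) j * zsign (-ε) j : TruncPoly m) = 1 := zsign_mul_self _ _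
  simp only [zsign_smul] at h1 h2 h3 h4
  have hu := negU_truncU m
  rcases lt_trichotomy i 0 with hi | rfl | hi
  · rw [wgt_neg ε m hi]
    rcases lt_trichotomy j 0 with hj | rfl | hj
    · rw [wgt_neg ε m hj, h1 i j (Or.inl (mul_pos_of_neg_of_neg hi hj)), zsign_add]
      linear_combination (zsign (-ε) j * negU m (matEntry A.1 (-j) (-i))) * hsi
    · have := h3 (-i) (by omega)
      rw [neg_neg, zsign_neg] at this
      rw [wgt_zero, this, neg_zero]
      linear_combination (-(truncU m * negU m (matEntry A.1 0 (-i)))) * hsi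
    · rw [wgt_pos ε m hj, h2 i j (mul_neg_of_neg_of_pos hi hj), zsign_add]
      linear_combination (-(zsign (-ε) j * negU m (matEntry A.1 (-j) (-i)))) * hsi
  · rw [wgt_zero]
    rcases lt_trichotomy j 0 with hj | rfl | hj
    · have := h4 (-j) (by omega)
      rw [zsign_neg, neg_neg] at this
      rw [wgt_neg ε m hj, neg_zero, this]
      simp only [map_neg, map_mul, negU_negU, hu]
      have e : negU m (zsign (-ε) j) = zsign (-ε) j := negU_zsign _ _ _
      rw [e]
      linear_combination (-(truncU m * matEntry A.1 0 j)) * hsj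
    · have := h1 0 0 (Or.inr ⟨rfl, rfl⟩)
      simp only [add_zero, zsign_zero, one_mul, neg_zero] at this
      rw [wgt_zero, neg_zero]
      linear_combination truncU m * this
    · have := h3 j hj
      rw [wgt_pos ε m hj, neg_zero, this]
      simp only [map_mul, negU_negU, hu]
      have e : negU m (zsign (-ε) j) = zsign (-ε) j := negU_zsign _ _ _
      rw [e]
      linear_combination (-(truncU m * matEntry A.1 0 j)) * hsj
  · rw [wgt_pos ε m hi]
    rcases lt_trichotomy j 0 with hj | rfl | hj
    · rw [wgt_neg ε m hj, h2 i j (mul_neg_of_pos_of_neg hi hj), zsign_add]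
      linear_combination (zsign (-ε) j * negU m (matEntry A.1 (-j) (-i))) * hsi
    · have := h4 i hi
      rw [wgt_zero, this, neg_zero]
      linear_combination (-(truncU m * negU m (matEntry A.1 0 (-i)))) * hsi
    · rw [wgt_pos ε m hj, h1 i j (Or.inl (mul_pos hi hj)), zsign_add]
      linear_combination (-(zsign (-ε) j * negU m (matEntry A.1 (-j) (-i)))) * hsi

lemma mem_Lbar_of_rel {ε : ℤˣ} {m : ℕ} {A : glInf (TruncPoly m)}
    (h : ∀ i j, wgt ε m i * matEntry A.1 i j = -(negU m (matEntry A.1 (-j) (-i)) * wgt ε m j))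
    (h0 : matEntry A.1 0 0 = -negU m (matEntry A.1 0 0)) : A ∈ Lbar ε m := by
  refine ⟨fun i j hij => ?_, fun i j hij => ?_, fun i hi => ?_, fun i hi => ?_⟩
  · rw [zsign_smul, zsign_add]
    have hsi : (zsign (-ε) i * zsign (-ε) i : TruncPoly m) = 1 := zsign_mul_self _ _
    have h1 := h i j
    rcases hij with hij | ⟨rfl, rfl⟩
    · rcases pos_and_pos_or_neg_and_neg_of_mul_pos hij with ⟨hi, hj⟩ | ⟨hi, hj⟩
      · rw [wgt_pos ε m hi, wgt_pos ε m hj] at h1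
        linear_combination (-matEntry A.1 i j) * hsi + zsign (-ε) i * h1
      · rw [wgt_neg ε m hi, wgt_neg ε m hj] at h1
        linear_combination (-matEntry A.1 i j) * hsi - zsign (-ε) i * h1
    · simpa [zsign_zero] using h0
  · rw [zsign_smul, zsign_add]
    have hsi : (zsign (-ε) i * zsign (-ε) i : TruncPoly m) = 1 := zsign_mul_self _ _
    have h1 := h i j
    rcases mul_neg_iff.mp hij with ⟨hi, hj⟩ | ⟨hi, hj⟩
    · rw [wgt_pos ε m hi, wgt_neg ε m hj] at h1
      linear_combination (-matEntry A.1 i j) * hsi + zsign (-ε) i * h1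
    · rw [wgt_neg ε m hi, wgt_pos ε m hj] at h1
      linear_combination (-matEntry A.1 i j) * hsi - zsign (-ε) i * h1
  · rw [zsign_smul]
    have hsi : (zsign (-ε) i * zsign (-ε) i : TruncPoly m) = 1 := zsign_mul_self _ _
    have h1 := h (-i) 0
    rw [wgt_neg ε m (by omega), wgt_zero, zsign_neg, neg_zero, neg_neg] at h1
    linear_combination (-matEntry A.1 (-i) 0) * hsi - zsign (-ε) i * h1
  · rw [zsign_smul]
    have hsi : (zsign (-ε) i * zsign (-ε) i : TruncPoly m) = 1 := zsign_mul_self _ _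
    have h1 := h i 0
    rw [wgt_pos ε m hi, wgt_zero, neg_zero] at h1
    linear_combination (-matEntry A.1 i 0) * hsi + zsign (-ε) i * h1

lemma matEntry_mul_box {R : Type*} [CommRing R] [Algebra ℂ R] (A B : glInf R) (i j : ℤ) :
    ∃ N : ℤ, ∀ M, N ≤ M → matEntry (A * B).1 i j =
      ∑ k ∈ Finset.Icc (-M) M, matEntry A.1 i k * matEntry B.1 k j := by
  obtain ⟨N, hN0, hN⟩ := exists_band A
  refine ⟨N + |i|, fun M hM => ?_⟩
  rw [show (A * B).1 = A.1 * B.1 from rfl, matEntry_mul]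
  refine finsum_eq_box fun k hk => ?_
  rw [hN, zero_mul]
  have := abs_sub_abs_le_abs_sub k i
  rw [abs_sub_comm] at this
  omega

lemma sum_Icc_neg {M : Type*} [AddCommMonoid M] (N : ℤ) (f : ℤ → M) :
    ∑ k ∈ Finset.Icc (-N) N, f (-k) = ∑ k ∈ Finset.Icc (-N) N, f k := by
  refine Finset.sum_nbij' (fun k => -k) (fun k => -k) ?_ ?_ ?_ ?_ ?_ <;> intro k <;>
    simp only [Finset.mem_Icc, neg_neg, implies_true] <;> omega

lemma wgt_mul_matEntry_mul {ε : ℤˣ} {m : ℕ} {A B : glInf (TruncPoly m)} (hA : A ∈ Lbar ε m)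
    (hB : B ∈ Lbar ε m) (i j : ℤ) : wgt ε m i * matEntry (A * B).1 i j =
      negU m (matEntry (B * A).1 (-j) (-i)) * wgt ε m j := by
  obtain ⟨N, hN⟩ := matEntry_mul_box A B i j
  obtain ⟨N', hN'⟩ := matEntry_mul_box B A (-j) (-i)
  rw [hN _ (le_max_left N N'), hN' _ (le_max_right N N'), map_sum, Finset.mul_sum, Finset.sum_mul,
    ← sum_Icc_neg]
  refine Finset.sum_congr rfl fun k _ => ?_
  rw [← mul_assoc, Lbar_rel hA, map_mul, neg_neg]
  have := Lbar_rel hB (-k) j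
  rw [neg_neg] at this
  linear_combination (-negU m (matEntry A.1 k (-i))) * this

lemma lie_mem_Lbar {ε : ℤˣ} {m : ℕ} {A B : glInf (TruncPoly m)} (hA : A ∈ Lbar ε m)
    (hB : B ∈ Lbar ε m) : ⁅A, B⁆ ∈ Lbar ε m := by
  have e : ∀ i j, matEntry (⁅A, B⁆ : glInf (TruncPoly m)).1 i j =
      matEntry (A * B).1 i j - matEntry (B * A).1 i j := by
    intro i j
    rw [glInf_lie_def]
    exact matEntry_sub _ _ _ _
  refine mem_Lbar_of_rel (fun i j => ?_) ?_
  · rw [e, e, mul_sub, wgt_mul_matEntry_mul hA hB, wgt_mul_matEntry_mul hB hA, map_sub]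
    ring
  · obtain ⟨N, hN⟩ := matEntry_mul_box A B 0 0
    obtain ⟨N', hN'⟩ := matEntry_mul_box B A 0 0
    rw [e, hN _ (le_max_left N N'), hN' _ (le_max_right N N'), ← Finset.sum_sub_distrib, map_sum]
    conv_lhs => rw [← sum_Icc_neg]
    rw [← Finset.sum_neg_distrib]
    refine Finset.sum_congr rfl fun k _ => ?_
    rcases eq_or_ne k 0 with rfl | hk
    · simp [mul_comm]
    · have key : ∀ (l : ℤ) (X : glInf (TruncPoly m)), X ∈ Lbar ε m → l ≠ 0 →
          matEntry X.1 l 0 = -(wgt ε m l * truncU m * negU m (matEntry X.1 0 (-l))) := by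
        intro l X hX hl
        have h1 := Lbar_rel hX l 0
        rw [wgt_zero, neg_zero] at h1
        have h2 : wgt ε m l * wgt ε m l = 1 := by
          rcases lt_or_gt_of_ne hl with h | h
          · rw [wgt_neg ε m h, neg_mul_neg, zsign_mul_self]
          · rw [wgt_pos ε m h, zsign_mul_self]
        linear_combination (-matEntry X.1 l 0) * h2 + wgt ε m l * h1
      have hw : wgt ε m (-k) = -wgt ε m k := by
        rcases lt_or_gt_of_ne hk with h | h
        · rw [wgt_neg ε m h, wgt_pos ε m (by omega), zsign_neg, neg_neg]
        · rw [wgt_pos ε m h, wgt_neg ε m (by omega), zsign_neg]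
      have hc : negU m (wgt ε m k) = wgt ε m k := by
        have : negU m (zsign (-ε) k) = zsign (-ε) k := negU_zsign _ _ _
        rcases lt_or_gt_of_ne hk with h | h
        · rw [wgt_neg ε m h, map_neg, this]
        · rw [wgt_pos ε m h, this]
      have hk' : -k ≠ 0 := neg_ne_zero.mpr hk
      rw [key k A hA hk, key k B hB hk, key (-k) A hA hk', key (-k) B hB hk', neg_neg, hw]
      simp only [map_sub, map_mul, map_neg, negU_negU, hc, negU_truncU]
      ring

/-- The Lie algebra `L_±^[m]`: the central extension of `Lbar ε m` by `ℂ[u] / (u ^ (m + 1))`. -/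
def LHat (ε : ℤˣ) (m : ℕ) : LieSubalgebra ℂ (glHat (TruncPoly m)) where
  carrier := {x | x.mat ∈ Lbar ε m}
  zero_mem' := (Lbar ε m).zero_mem
  add_mem' hx hy := (Lbar ε m).add_mem hx hy
  smul_mem' c _ hx := (Lbar ε m).smul_mem c hx
  lie_mem' := by
    intro x y hx hy
    rw [glHat.lie_def]
    exact lie_mem_Lbar hx hy

lemma tau_zero_pred (m : ℕ) (j : ℤ) : tau m 0 (j + 1) = tau m 0 j * factorU m j := tau_succ m 0 j

lemma tau_reflect_pos (m : ℕ) (n : ℕ) :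
    (truncU m - ((n + 1 : ℤ) : TruncPoly m)) * (tau m 0 (n + 1) : TruncPoly m) =
      zsign (-1) (n + 1) * negU m (tau m (-(n + 1)) 0 : TruncPoly m) := by
  have hf : ∀ k : ℤ, k ≠ 0 → negU m (factorU m (-k) : TruncPoly m) = -(truncU m - (k : TruncPoly m)) := by
    intro k hk
    rw [factorU_val m (neg_ne_zero.mpr hk), map_sub, negU_truncU]
    simp
    ring
  have ht : ∀ k : ℤ, tau m (-(k + 1)) 0 = factorU m (-(k + 1)) * tau m (-k) 0 := by
    intro k
    have h1 := tau_succ m 0 (-(k + 1))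
    have e : -(k + 1) + 1 = -k := by ring
    rw [e, ← tau_inv, ← tau_inv m (-(k + 1))] at h1
    rw [inv_eq_iff_eq_inv] at h1
    rw [h1]
    simp
  have hs : ∀ k : ℤ, (zsign (-1) (k + 1) : TruncPoly m) = -zsign (-1) k := by
    intro k; rw [zsign_add]; simp [zsign]
  induction n with
  | zero =>
    have h1 := ht 0
    rw [neg_zero, tau_self, mul_one] at h1
    have h2 := tau_succ m 0 0
    rw [tau_self, one_mul] at h2
    simp only [Nat.cast_zero]
    rw [h1, h2, hs, zsign_zero]
    have := hf 1 one_ne_zero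
    simp only [zero_add]
    rw [this]
    simp [factorU]
  | succ n ih =>
    have h1 := ht (n + 1)
    have h2 := tau_succ m 0 (n + 1)
    push_cast at ih ⊢
    rw [h1, h2, Units.val_mul, Units.val_mul, map_mul, hs, hf _ (by omega),
      factorU_val m (by omega)]
    push_cast
    linear_combination (truncU m - (n + 1 + 1)) * ih

lemma tau_reflect_of_pos (m : ℕ) {j : ℤ} (hj : 0 < j) :
    (truncU m - (j : TruncPoly m)) * (tau m 0 j : TruncPoly m) =
      zsign (-1) j * negU m (tau m (-j) 0 : TruncPoly m) := by
  obtain ⟨n, rfl⟩ : ∃ n : ℕ, j = n + 1 := ⟨(j - 1).toNat, by omega⟩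
  exact tau_reflect_pos m n

lemma tau_reflect_of_neg (m : ℕ) {j : ℤ} (hj : j < 0) :
    (truncU m - (j : TruncPoly m)) * (tau m 0 j : TruncPoly m) =
      -(zsign (-1) j * negU m (tau m (-j) 0 : TruncPoly m)) := by
  have h := congrArg (negU m) (tau_reflect_of_pos m (j := -j) (by omega))
  have hz : negU m (zsign (-1) (-j)) = zsign (-1) j := by
    rw [zsign_neg]; exact negU_zsign _ _ _
  simp only [map_mul, map_sub, negU_truncU, negU_negU, neg_neg, hz, map_intCast] at h
  push_cast at h
  have h1 : (tau m 0 j : TruncPoly m) * (tau m j 0 : TruncPoly m) = 1 := by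
    rw [← Units.val_mul, tau_mul, tau_self, Units.val_one]
  have h2 : negU m (tau m 0 (-j) : TruncPoly m) * negU m (tau m (-j) 0 : TruncPoly m) = 1 := by
    rw [← map_mul, ← Units.val_mul, tau_mul, tau_self, Units.val_one, map_one]
  linear_combination (-(negU m (tau m (-j) 0 : TruncPoly m) * (tau m 0 j : TruncPoly m))) * h
    + (-(zsign (-1) j * negU m (tau m (-j) 0 : TruncPoly m))) * h1
    + (-(truncU m - j) * (tau m 0 j : TruncPoly m)) * h2

lemma tau_reflect (m : ℕ) (j : ℤ) :
    (truncU m - (j : TruncPoly m)) * (tau m 0 j : TruncPoly m) =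
      wgt 1 m j * negU m (tau m (-j) 0 : TruncPoly m) := by
  rcases lt_trichotomy j 0 with hj | rfl | hj
  · rw [tau_reflect_of_neg m hj, wgt_neg 1 m hj]; ring
  · simp [wgt_zero, tau_self]
  · rw [tau_reflect_of_pos m hj, wgt_pos 1 m hj]

lemma wgt_eq (ε : ℤˣ) (m : ℕ) (i : ℤ) : wgt ε m i = zsign ε i * wgt 1 m i := by
  rcases lt_trichotomy i 0 with h | rfl | h
  · rw [wgt_neg ε m h, wgt_neg 1 m h, zsign_neg_left]; ring
  · rw [wgt_zero, wgt_zero, zsign_zero, one_mul]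
  · rw [wgt_pos ε m h, wgt_pos 1 m h, zsign_neg_left]; ring

lemma negU_wgt_neg (m : ℕ) (i : ℤ) : negU m (wgt 1 m (-i)) = -wgt 1 m i := by
  rcases lt_trichotomy i 0 with h | rfl | h
  · rw [wgt_neg 1 m h, wgt_pos 1 m (by omega), zsign_neg, negU_zsign, neg_neg]
  · rw [neg_zero, wgt_zero, negU_truncU]
  · rw [wgt_pos 1 m h, wgt_neg 1 m (by omega), zsign_neg, map_neg, negU_zsign]

lemma negU_aeval (m : ℕ) (f : ℂ[X]) (x : TruncPoly m) :
    negU m (aeval x f) = aeval (negU m x) f := by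
  rw [aeval_algHom_apply]

lemma twist_phi_mem_Lbar {ε : ℤˣ} (m : ℕ) {F : DiffOp} (hF : F ∈ Dx ε) :
    twist m (phi (truncU m) F) ∈ Lbar ε m := by
  refine mem_Lbar_of_rel (fun i j => ?_) ?_
  · rw [matEntry_twist, matEntry_twist, matEntry_phi, matEntry_phi]
    have e : -i - -j = j - i := by ring
    rw [e]
    obtain ⟨f, hf, hf'⟩ := hF (j - i)
    rw [hf]
    have h1 : aeval (truncU m - (j : TruncPoly m)) f =
        zsign ε (j - i) * aeval (-truncU m + (i : TruncPoly m)) f := by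
      conv_lhs => rw [← hf']
      obtain ⟨a, -, ha⟩ := exists_scalar (ε ^ (j - i))
      rw [ha, map_smul, ← ha, zsign_smul, aeval_comp]
      congr 2
      simp
      ring_nf
    have h2 := tau_reflect m j
    have h3 := congrArg (negU m) (tau_reflect m (-i))
    have hi : negU m (truncU m - ((-i : ℤ) : TruncPoly m)) = -truncU m + i := by
      simp [negU_truncU]
    simp only [map_mul, negU_negU, neg_neg, negU_wgt_neg, hi] at h3
    have h4 : (zsign ε i * zsign ε (j - i) : TruncPoly m) = zsign ε j := by
      rw [← zsign_add]; congr 1; ring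
    simp only [map_mul, aeval_X, negU_aeval, hi]
    rw [h1, ← tau_mul m i 0 j, ← tau_mul m (-j) 0 (-i), wgt_eq ε m i, wgt_eq ε m j, Units.val_mul,
      Units.val_mul, map_mul]
    generalize (aeval (-truncU m + (i : TruncPoly m))) f = g
    linear_combination
      (zsign ε i * wgt 1 m i * (tau m i 0 : TruncPoly m) * zsign ε (j - i) * g) * h2 +
      (negU m (tau m (-j) 0 : TruncPoly m) * zsign ε j * wgt 1 m j * g) * h3 +
      (wgt 1 m i * (tau m i 0 : TruncPoly m) * g * wgt 1 m j *
        negU m (tau m (-j) 0 : TruncPoly m)) * h4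
  · rw [matEntry_twist, matEntry_phi]
    obtain ⟨f, hf, hf'⟩ := hF 0
    have h1 : f.comp (-X) = f := by simpa using hf'
    have h2 : aeval (-truncU m) f = aeval (truncU m) f := by
      conv_rhs => rw [← h1]
      simp [aeval_comp]
    simp [hf, tau_self, negU_aeval, negU_truncU, h2]

/-- The homomorphism `D̂_x^± → L_±^[m]` obtained by restricting `phiHat`. -/
def phiHatL (ε : ℤˣ) (m : ℕ) : DxHat ε →ₗ⁅ℂ⁆ LHat ε m where
  toFun x := ⟨phiHat m x.1, twist_phi_mem_Lbar m x.2⟩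
  map_add' x y := Subtype.ext ((phiHat m).map_add x.1 y.1)
  map_smul' c x := Subtype.ext ((phiHat m).map_smul c x.1)
  map_lie' {x y} := Subtype.ext ((phiHat m).map_lie x.1 y.1)

/-- The principal gradation of `D̂_x^±`: the component of degree `k` consists of the elements
`tᵏ f(D) D ∈ Dx ε`, and `C` has degree `0`. -/
def DxGrade (ε : ℤˣ) (k : ℤ) : Submodule ℂ (DxHat ε) where
  carrier := {x | (∀ l, l ≠ k → DiffOp.coeff l x.1.op = 0) ∧ (k ≠ 0 → x.1.cent = 0)}
  zero_mem' := ⟨fun l _ => map_zero _, fun _ => rfl⟩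
  add_mem' := by
    rintro x y ⟨hx, hx'⟩ ⟨hy, hy'⟩
    refine ⟨fun l hl => ?_, fun hk => ?_⟩
    · change DiffOp.coeff l (x.1.op + y.1.op) = 0
      rw [map_add, hx l hl, hy l hl, add_zero]
    · change x.1.cent + y.1.cent = 0
      rw [hx' hk, hy' hk, add_zero]
  smul_mem' := by
    rintro c x ⟨hx, hx'⟩
    refine ⟨fun l hl => ?_, fun hk => ?_⟩
    · change DiffOp.coeff l (c • x.1.op) = 0
      rw [map_smul, hx l hl, smul_zero]
    · change c • x.1.cent = 0
      rw [hx' hk, smul_zero]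

/-- The principal gradation of `L_±^[m]`: `E i j` has degree `j - i`, and the center has
degree `0`. -/
def LGrade (ε : ℤˣ) (m : ℕ) (k : ℤ) : Submodule ℂ (LHat ε m) where
  carrier := {x | (∀ i j, j - i ≠ k → matEntry x.1.mat.1 i j = 0) ∧ (k ≠ 0 → x.1.cent = 0)}
  zero_mem' := ⟨fun i j _ => rfl, fun _ => rfl⟩
  add_mem' := by
    rintro x y ⟨hx, hx'⟩ ⟨hy, hy'⟩
    refine ⟨fun i j hl => ?_, fun hk => ?_⟩
    · change matEntry (x.1.mat.1 + y.1.mat.1) i j = 0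
      rw [matEntry_add, hx i j hl, hy i j hl, add_zero]
    · change x.1.cent + y.1.cent = 0
      rw [hx' hk, hy' hk, add_zero]
  smul_mem' := by
    rintro c x ⟨hx, hx'⟩
    refine ⟨fun i j hl => ?_, fun hk => ?_⟩
    · change matEntry (c • x.1.mat.1) i j = 0
      rw [matEntry_smul, hx i j hl, smul_zero]
    · change c • x.1.cent = 0
      rw [hx' hk, smul_zero]

end Subalgebras

/-! ### Distinguished elements of degree zero -/

section Elements

/-- The element `D ^ (l + 1)` of degree zero, for even `l`. -/
def powD (ε : ℤˣ) (l : ℕ) (hl : Even l) : DxGrade ε 0 :=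
  ⟨⟨DiffOpHat.mk (DiffOp.mono 0 (X ^ l * X)) 0, mono_mem_Dx (by simp [hl.neg_pow])⟩, by
    refine ⟨fun k hk => ?_, fun h => (h rfl).elim⟩
    change DiffOp.coeff k (DiffOp.mono 0 (X ^ l * X)) = 0
    rw [DiffOp.coeff_mono, if_neg hk.symm]⟩

/-- The central element `C` of `D̂_x^±`. -/
def centD (ε : ℤˣ) : DxGrade ε 0 :=
  ⟨⟨DiffOpHat.mk 0 1, (Dx ε).zero_mem⟩, fun _ _ => map_zero _, fun h => (h rfl).elim⟩

/-- The matrix `a E i i - a(-u) E (-i) (-i)`, where `a(-u)` is obtained from `a` by `u ↦ -u`. -/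
def diagMat (m : ℕ) (i : ℤ) (a : TruncPoly m) : glInf (TruncPoly m) :=
  (⟨matUnit i i a, diagonalOp_mem _ _⟩ : glInf (TruncPoly m)) -
    ⟨matUnit (-i) (-i) (negU m a), diagonalOp_mem _ _⟩

lemma matEntry_diagMat (m : ℕ) (i : ℤ) (a : TruncPoly m) (k l : ℤ) :
    matEntry (diagMat m i a).1 k l =
      (if k = i ∧ l = i then a else 0) - if k = -i ∧ l = -i then negU m a else 0 := by
  change matEntry (matUnit i i a - matUnit (-i) (-i) (negU m a)) k l = _
  rw [matEntry_sub, matEntry_matUnit, matEntry_matUnit]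

lemma diagMat_mem_Lbar (ε : ℤˣ) (m : ℕ) (i : ℤ) (a : TruncPoly m) :
    diagMat m i a ∈ Lbar ε m := by
  have h : ∀ k l, negU m (matEntry (diagMat m i a).1 (-l) (-k)) =
      -matEntry (diagMat m i a).1 k l := by
    intro k l
    rw [matEntry_diagMat, matEntry_diagMat]
    have e1 : (-l = i ∧ -k = i) ↔ (k = -i ∧ l = -i) := by omega
    have e2 : (-l = -i ∧ -k = -i) ↔ (k = i ∧ l = i) := by omega
    simp only [e1, e2]
    split_ifs <;> simp [negU_negU]
  refine mem_Lbar_of_rel (fun k l => ?_) ?_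
  · rw [h]
    rcases eq_or_ne k l with rfl | hkl
    · ring
    · have e : matEntry (diagMat m i a).1 k l = 0 := by
        rw [matEntry_diagMat, if_neg (by omega), if_neg (by omega), sub_zero]
      simp [e]
  · have := h 0 0
    rw [neg_zero] at this
    rw [this, neg_neg]

/-- The element `uʲ E i i - (-u)ʲ E (-i) (-i)` of `L_±^[m]`. -/
def diagL (ε : ℤˣ) (m : ℕ) (i : ℤ) (j : ℕ) : LGrade ε m 0 :=
  ⟨⟨glHat.mk (diagMat m i (truncU m ^ j)) 0, diagMat_mem_Lbar ε m i _⟩, by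
    refine ⟨fun k l hkl => ?_, fun h => (h rfl).elim⟩
    change matEntry (diagMat m i (truncU m ^ j)).1 k l = 0
    rw [matEntry_diagMat, if_neg (by omega), if_neg (by omega), sub_zero]⟩

/-- The central element `uʲ` of `L_±^[m]`. -/
def centL (ε : ℤˣ) (m : ℕ) (j : ℕ) : LGrade ε m 0 :=
  ⟨⟨glHat.mk 0 (truncU m ^ j), (Lbar ε m).zero_mem⟩, fun _ _ _ => rfl, fun h => (h rfl).elim⟩

/-- The labels `λ_i^(j) = λ(uʲ E i i - (-u)ʲ E (-i) (-i))` of a functional `λ` on the degree zero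
part of `L_±^[m]`. -/
def labelL {ε : ℤˣ} {m : ℕ} (lam : LGrade ε m 0 →ₗ[ℂ] ℂ) (i : ℤ) (j : ℕ) : ℂ :=
  lam (diagL ε m i j)

/-- The numbers `h_i^(j) = λ_i^(j) - λ_{i+1}^(j) + δ_{i,0} c_j`, with central charges
`c_j = λ(uʲ)`. -/
def labelH {ε : ℤˣ} {m : ℕ} (lam : LGrade ε m 0 →ₗ[ℂ] ℂ) (i : ℤ) (j : ℕ) : ℂ :=
  labelL lam i j - labelL lam (i + 1) j + if i = 0 then lam (centL ε m j) else 0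

end Elements

/-! ### Irreducible highest weight modules over graded Lie algebras -/

section HighestWeight

/-- `V = ⨁ₙ 𝒱 n` is a `ℤ`-graded irreducible highest weight module with highest weight
`lam ∈ (𝔤₀)*` and highest weight vector `v ∈ 𝒱 0` over the Lie algebra `𝔤` with homogeneous
components `𝒢 n`. Up to isomorphism, this is the module `L(𝔤, lam)`. -/
structure IsIrreducibleHighestWeight {𝔤 : Type*} [LieRing 𝔤] [LieAlgebra ℂ 𝔤]
    (𝒢 : ℤ → Submodule ℂ 𝔤) {V : Type*} [AddCommGroup V] [Module ℂ V] [LieRingModule 𝔤 V]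
    [LieModule ℂ 𝔤 V] (𝒱 : ℤ → Submodule ℂ V) (v : V) (lam : 𝒢 0 →ₗ[ℂ] ℂ) : Prop where
  isInternal : DirectSum.IsInternal 𝒱
  lie_mem : ∀ i j : ℤ, ∀ x ∈ 𝒢 i, ∀ w ∈ 𝒱 j, ⁅x, w⁆ ∈ 𝒱 (i + j)
  mem_zero : v ∈ 𝒱 0
  ne_zero : v ≠ 0
  weight : ∀ h : 𝒢 0, ⁅(h : 𝔤), v⁆ = lam h • v
  lie_pos : ∀ i : ℤ, 0 < i → ∀ x ∈ 𝒢 i, ⁅x, v⁆ = 0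
  generates : LieSubmodule.lieSpan ℂ 𝔤 {v} = ⊤
  irreducible : LieModule.IsIrreducible ℂ 𝔤 V

/-- A graded vector space is quasifinite if its homogeneous components are finite-dimensional. -/
def IsQuasifinite {V : Type*} [AddCommGroup V] [Module ℂ V] (𝒱 : ℤ → Submodule ℂ V) : Prop :=
  ∀ j : ℤ, FiniteDimensional ℂ (𝒱 j)

/-- The vector space `V` of a module over the Lie algebra `𝔥`, regarded as a module over `𝔤` via
the homomorphism `f : 𝔤 → 𝔥`. -/
@[nolint unusedArguments]
def Pullback {𝔤 𝔥 : Type*} [LieRing 𝔤] [LieAlgebra ℂ 𝔤] [LieRing 𝔥] [LieAlgebra ℂ 𝔥]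
    (_f : 𝔤 →ₗ⁅ℂ⁆ 𝔥) (V : Type*) : Type _ := V

section

variable {𝔤 𝔥 : Type*} [LieRing 𝔤] [LieAlgebra ℂ 𝔤] [LieRing 𝔥] [LieAlgebra ℂ 𝔥]
  (f : 𝔤 →ₗ⁅ℂ⁆ 𝔥) (V : Type*) [AddCommGroup V] [Module ℂ V] [LieRingModule 𝔥 V]
  [LieModule ℂ 𝔥 V]

instance : AddCommGroup (Pullback f V) := inferInstanceAs (AddCommGroup V)

instance : Module ℂ (Pullback f V) := inferInstanceAs (Module ℂ V)

instance : LieRingModule 𝔤 (Pullback f V) := LieRingModule.compLieHom V f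

instance : LieModule ℂ 𝔤 (Pullback f V) := LieModule.compLieHom V f

end

end HighestWeight

/-! ### Exponents and multiplicities -/

section Exponents

/-- The formal power series `e^{ax}`. -/
def expS (a : ℂ) : PowerSeries ℂ := PowerSeries.rescale a (PowerSeries.exp ℂ)

/-- The formal power series `cosh(ax)`. -/
def coshS (a : ℂ) : PowerSeries ℂ := PowerSeries.C (1 / 2) * (expS a + expS (-a))

/-- The formal power series `sinh(ax)`. -/
def sinhS (a : ℂ) : PowerSeries ℂ := PowerSeries.C (1 / 2) * (expS a - expS (-a))

/-- The generating series `Δ(x) = ∑_{l even} Δ_l xˡ / l!` of the labels `Δ_l = -λ(Dˡ D)` of a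
functional `λ` on the degree zero part of `D̂_x^±`. -/
def DeltaSeries {ε : ℤˣ} (lam : DxGrade ε 0 →ₗ[ℂ] ℂ) : PowerSeries ℂ :=
  PowerSeries.mk fun l => if hl : Even l then -lam (powD ε l hl) / (l.factorial : ℂ) else 0

/-- The functional `λ` on the degree zero part of `D̂_x^±` has the even type exponents `e` with
multiplicities `eP e` for `e` in the support of `eP`, and the odd type exponents `e` with
multiplicities `eM e` for `e` in the support of `eM`. That is,
`Δ(x) = d/dx (φ(x) / (2 sinh(x/2)))` with a series `φ` such that `φ(0) = 0` and
`φ(x) + cosh(x/2) c₀ = ∑_e eP_e(x) cosh(e x) + ∑_e eM_e(x) sinh(e x)`,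
where `c₀ = λ(C)`, the multiplicities are even resp. odd polynomials, and the exponents are
distinct up to sign. -/
structure HasExponents {ε : ℤˣ} (lam : DxGrade ε 0 →ₗ[ℂ] ℂ) (eP eM : ℂ →₀ ℂ[X]) : Prop where
  even : ∀ e, (eP e).comp (-X) = eP e
  odd : ∀ e, (eM e).comp (-X) = -eM e
  even_distinct : ∀ e ∈ eP.support, -e ∈ eP.support → e = 0
  odd_distinct : ∀ e ∈ eM.support, -e ∉ eM.support
  expansion : ∃ φ Γ : PowerSeries ℂ, PowerSeries.constantCoeff φ = 0 ∧
    PowerSeries.C 2 * sinhS (1 / 2) * Γ = φ ∧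
    PowerSeries.derivative ℂ Γ = DeltaSeries lam ∧
    φ + PowerSeries.C (lam (centD ε)) * coshS (1 / 2) =
      (eP.sum fun e q => (q : PowerSeries ℂ) * coshS e) +
        eM.sum fun e r => (r : PowerSeries ℂ) * sinhS e

/-- `W` is (isomorphic to) the module `L(D̂_x^±; e⁺, e⁻)`: the irreducible quasifinite highest
weight module over `D̂_x^±` with even type exponents and multiplicities `eP` and odd type exponents
and multiplicities `eM`. -/
def IsModuleWithExponents (ε : ℤˣ) (W : Type*) [AddCommGroup W] [Module ℂ W]
    [LieRingModule (DxHat ε) W] [LieModule ℂ (DxHat ε) W] (eP eM : ℂ →₀ ℂ[X]) : Prop :=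
  ∃ (𝒲 : ℤ → Submodule ℂ W) (w : W) (lam : DxGrade ε 0 →ₗ[ℂ] ℂ),
    IsIrreducibleHighestWeight (DxGrade ε) 𝒲 w lam ∧ IsQuasifinite 𝒲 ∧ HasExponents lam eP eM

end Exponents

end WInfinity

end

universe v w

open WInfinity

/-!
The restriction of a quasifinite module `L(L_±^[m], λ)` to `D̂_x^±` stays irreducible because the
image of `D̂_x^±` is dense in the following sense. On a component of degree `n`, an element of
`L_±^[m]` of degree `k` whose entries lie far from the origin acts by zero
(`exists_far_lie_eq_zero`). For `k ≠ 0`, the adjoint action of the diagonal matrix with entries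
`j ^ 3` multiplies the entries on the diagonal `k` by scalars each occurring finitely often, while
on the finite-dimensional space of maps between the two components it satisfies a polynomial
equation; dividing by the values of this polynomial gives the claim. For `k = 0`, a far diagonal
matrix is a bracket of a shift matrix and a far matrix of degree `-1`. On the other hand, modulo
the center and far matrices, every homogeneous element is the image of a single `tᵏ f(D) D`, by
Hermite interpolation at the integers (`exists_isFar_sub_phiHatL`). A subspace stable under
`D̂_x^±` is stable under `D`, which acts on the component of degree `n` by a constant plus `n`;
so the subspace is graded, hence stable under `L_±^[m]` (`eq_bot_or_eq_top_of_phiHatL_mem`).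

The exponents determine the highest weight, since `2 sinh(x/2)` is not a zero divisor
(`HasExponents.unique`), and irreducible highest weight modules with equal highest weights are
isomorphic (`IsIrreducibleHighestWeight.nonempty_equiv`): the submodule of `V ⊕ W` generated by the
pair of highest weight vectors is the graph of an isomorphism.

The exponents of the restricted module come from a computation with generating series
(`hasExponents_phiHatL₀`). Let `Λⱼ = λ(e^{ux} E_{jj} - e^{-ux} E_{-j,-j})` and let `c(x)` be the
generating series of the central charges. By the vanishing of `λ` on far matrices, the values
`λ(D ^ (l + 1)) / (l + 1)!`, for `l` even, are the odd coefficients of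
`G = Λ₀ / 2 + ∑_{j > 0} e^{-jx} Λⱼ + A`, where `(e^x - 1) A = c(0) - c(x)`. Minus the odd part of
`G` is thus an antiderivative of `Δ`. Summation by parts shows that
`-(e^{x/2} - e^{-x/2}) G + c(0) e^{-x/2}` equals
`∑ⱼ (Λⱼ - Λⱼ₊₁ + δ_{j,0} c(x)) e^{-(j + 1/2) x}` up to the odd series `cosh(x/2) Λ₀`, and the
even part of the latter sum is the required combination of hyperbolic functions
(`expansion_identity`).
-/

noncomputable section

namespace WInfinity

/-! ### Uniqueness of irreducible highest weight modules -/

section Uniqueness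

variable {𝔤 : Type*} [LieRing 𝔤] [LieAlgebra ℂ 𝔤] {𝒢 : ℤ → Submodule ℂ 𝔤}

lemma eq_bot_or_eq_top_of_lie_mem {V : Type*} [AddCommGroup V] [Module ℂ V] [LieRingModule 𝔤 V]
    [LieModule ℂ 𝔤 V] [LieModule.IsIrreducible ℂ 𝔤 V] (A : Submodule ℂ V)
    (hA : ∀ (x : 𝔤), ∀ a ∈ A, ⁅x, a⁆ ∈ A) : A = ⊥ ∨ A = ⊤ := by
  let B : LieSubmodule ℂ 𝔤 V := { A with lie_mem := fun {x a} ha => hA x a ha }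
  rcases eq_bot_or_eq_top B with h | h
  · left
    exact congrArg LieSubmodule.toSubmodule h
  · right
    exact congrArg LieSubmodule.toSubmodule h

lemma mem_of_homogeneous (h𝒢 : ⨆ i, 𝒢 i = ⊤) {M : Type*} [AddCommGroup M] [Module ℂ M]
    (f : 𝔤 →ₗ[ℂ] M) (N : Submodule ℂ M) (h : ∀ i, ∀ x ∈ 𝒢 i, f x ∈ N) (x : 𝔤) : f x ∈ N := by
  have h1 : ⨆ i, 𝒢 i ≤ N.comap f := iSup_le fun i x hx => h i x hx
  exact h1 (h𝒢 ▸ Submodule.mem_top)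

variable {V W : Type*} [AddCommGroup V] [Module ℂ V] [LieRingModule 𝔤 V] [LieModule ℂ 𝔤 V]
  [AddCommGroup W] [Module ℂ W] [LieRingModule 𝔤 W] [LieModule ℂ 𝔤 W]

variable (V W) in
/-- The action of `𝔤` on the direct sum of the modules `V` and `W`. -/
def prodAct : 𝔤 →ₗ[ℂ] V × W →ₗ[ℂ] V × W where
  toFun x := (LieModule.toEnd ℂ 𝔤 V x).prodMap (LieModule.toEnd ℂ 𝔤 W x)
  map_add' x y := by ext <;> simp
  map_smul' c x := by ext <;> simp

@[simp] lemma prodAct_apply (x : 𝔤) (p : V × W) : prodAct V W x p = (⁅x, p.1⁆, ⁅x, p.2⁆) := rfl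

lemma prodAct_comm (x y : 𝔤) (p : V × W) :
    prodAct V W x (prodAct V W y p) = prodAct V W y (prodAct V W x p) + prodAct V W ⁅x, y⁆ p := by
  ext <;> simp

variable (𝒢) in
/-- The span of the vectors obtained from `p ∈ V ⊕ W` by applying at most `n` homogeneous elements
of negative degree. -/
def wordSpan (p : V × W) : ℕ → Submodule ℂ (V × W)
  | 0 => Submodule.span ℂ {p}
  | n + 1 => wordSpan p n ⊔
      Submodule.span ℂ {z | ∃ i < 0, ∃ y ∈ 𝒢 i, ∃ s ∈ wordSpan p n, z = prodAct V W y s}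

lemma wordSpan_mono (p : V × W) : Monotone (wordSpan 𝒢 p) :=
  monotone_nat_of_le_succ fun _ => le_sup_left

lemma prodAct_mem_wordSpan_succ {p : V × W} {n : ℕ} {i : ℤ} (hi : i < 0) {y : 𝔤} (hy : y ∈ 𝒢 i)
    {s : V × W} (hs : s ∈ wordSpan 𝒢 p n) : prodAct V W y s ∈ wordSpan 𝒢 p (n + 1) :=
  Submodule.mem_sup_right (Submodule.subset_span ⟨i, hi, y, hy, s, hs, rfl⟩)

/-- Elements of nonnegative degree do not increase the length of words applied to a highest
weight vector; this replaces the triangular decomposition of the enveloping algebra. -/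
lemma prodAct_mem_wordSpan (hbr : ∀ i j, ∀ x ∈ 𝒢 i, ∀ y ∈ 𝒢 j, ⁅x, y⁆ ∈ 𝒢 (i + j)) {p : V × W}
    (hp : ∀ i, 0 ≤ i → ∀ x ∈ 𝒢 i, prodAct V W x p ∈ Submodule.span ℂ {p}) (n : ℕ) :
    ∀ i, 0 ≤ i → ∀ x ∈ 𝒢 i, ∀ s ∈ wordSpan 𝒢 p n, prodAct V W x s ∈ wordSpan 𝒢 p n := by
  induction n with
  | zero =>
    intro i hi x hx s hs
    obtain ⟨c, rfl⟩ := Submodule.mem_span_singleton.mp hs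
    rw [map_smul]
    exact Submodule.smul_mem _ _ (hp i hi x hx)
  | succ n ih =>
    intro i hi x hx s hs
    have key : wordSpan 𝒢 p (n + 1) ≤ (wordSpan 𝒢 p (n + 1)).comap (prodAct V W x) := by
      refine sup_le (fun t ht => ?_) (Submodule.span_le.mpr ?_)
      · exact wordSpan_mono p n.le_succ (ih i hi x hx t ht)
      · rintro _ ⟨j, hj, y, hy, t, ht, rfl⟩
        change prodAct V W x (prodAct V W y t) ∈ wordSpan 𝒢 p (n + 1)
        rw [prodAct_comm]
        refine add_mem (prodAct_mem_wordSpan_succ hj hy (ih i hi x hx t ht)) ?_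
        rcases le_or_gt 0 (i + j) with h | h
        · exact wordSpan_mono p n.le_succ (ih _ h _ (hbr i j x hx y hy) t ht)
        · exact prodAct_mem_wordSpan_succ h (hbr i j x hx y hy) ht
    exact key hs

/-- The span of the homogeneous components of negative degree. -/
def negPart (𝒱 : ℤ → Submodule ℂ V) : Submodule ℂ V := ⨆ i, ⨆ (_ : i < 0), 𝒱 i

lemma mem_negPart {𝒱 : ℤ → Submodule ℂ V} {i : ℤ} (hi : i < 0) {a : V} (ha : a ∈ 𝒱 i) :
    a ∈ negPart 𝒱 :=
  (le_iSup₂_of_le i hi le_rfl : 𝒱 i ≤ negPart 𝒱) ha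

lemma lie_mem_negPart {𝒱 : ℤ → Submodule ℂ V}
    (h : ∀ i j : ℤ, ∀ x ∈ 𝒢 i, ∀ w ∈ 𝒱 j, ⁅x, w⁆ ∈ 𝒱 (i + j)) {i : ℤ} (hi : i < 0) {x : 𝔤}
    (hx : x ∈ 𝒢 i) {a : V} (ha : a ∈ negPart 𝒱) : ⁅x, a⁆ ∈ negPart 𝒱 := by
  have : negPart 𝒱 ≤ (negPart 𝒱).comap (LieModule.toEnd ℂ 𝔤 V x) :=
    iSup₂_le fun j hj w hw => mem_negPart (by omega : i + j < 0) (h i j x hx w hw)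
  exact this ha

lemma eq_zero_of_mem_negPart {𝒱 : ℤ → Submodule ℂ V} (h : DirectSum.IsInternal 𝒱) {v : V}
    (hv : v ∈ 𝒱 0) (hv' : v ∈ negPart 𝒱) : v = 0 := by
  have h1 := h.submodule_iSupIndep 0
  have h2 : negPart 𝒱 ≤ ⨆ j, ⨆ (_ : j ≠ 0), 𝒱 j :=
    iSup₂_le fun j hj => le_iSup₂_of_le j hj.ne le_rfl
  exact Submodule.disjoint_def.mp h1 v hv (h2 hv')

lemma wordSpan_le {𝒱 : ℤ → Submodule ℂ V} {𝒲 : ℤ → Submodule ℂ W}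
    (hV : ∀ i j : ℤ, ∀ x ∈ 𝒢 i, ∀ w ∈ 𝒱 j, ⁅x, w⁆ ∈ 𝒱 (i + j))
    (hW : ∀ i j : ℤ, ∀ x ∈ 𝒢 i, ∀ w ∈ 𝒲 j, ⁅x, w⁆ ∈ 𝒲 (i + j)) {v : V} {w : W}
    (hv : v ∈ 𝒱 0) (hw : w ∈ 𝒲 0) (n : ℕ) :
    wordSpan 𝒢 (v, w) n ≤ Submodule.span ℂ {(v, w)} ⊔ (negPart 𝒱).prod (negPart 𝒲) := by
  induction n with
  | zero => exact le_sup_left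
  | succ n ih =>
    refine sup_le ih (Submodule.span_le.mpr ?_)
    rintro _ ⟨i, hi, y, hy, s, hs, rfl⟩
    obtain ⟨a, ha, b, hb, rfl⟩ := Submodule.mem_sup.mp (ih hs)
    obtain ⟨c, rfl⟩ := Submodule.mem_span_singleton.mp ha
    refine Submodule.mem_sup_right ?_
    rw [map_add, map_smul]
    refine add_mem (Submodule.smul_mem _ _ ?_) ?_
    · have h1 := hV i 0 y hy v hv
      have h2 := hW i 0 y hy w hw
      exact ⟨mem_negPart (by omega) h1, mem_negPart (by omega) h2⟩
    · exact ⟨lie_mem_negPart hV hi hy hb.1, lie_mem_negPart hW hi hy hb.2⟩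

/-- Two irreducible highest weight modules with the same highest weight are isomorphic: the
submodule of `V ⊕ W` generated by the sum of the highest weight vectors is the graph of an
isomorphism. -/
theorem IsIrreducibleHighestWeight.nonempty_equiv (h𝒢 : ⨆ i, 𝒢 i = ⊤)
    (hbr : ∀ i j, ∀ x ∈ 𝒢 i, ∀ y ∈ 𝒢 j, ⁅x, y⁆ ∈ 𝒢 (i + j))
    {𝒱 : ℤ → Submodule ℂ V} {𝒲 : ℤ → Submodule ℂ W} {v : V} {w : W} {lam : 𝒢 0 →ₗ[ℂ] ℂ}
    (hV : IsIrreducibleHighestWeight 𝒢 𝒱 v lam) (hW : IsIrreducibleHighestWeight 𝒢 𝒲 w lam) :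
    Nonempty (V ≃ₗ⁅ℂ,𝔤⁆ W) := by
  have := hV.irreducible
  have := hW.irreducible
  let N : Submodule ℂ (V × W) := ⨆ n, wordSpan 𝒢 (v, w) n
  have hpN : (v, w) ∈ N :=
    (le_iSup (wordSpan 𝒢 (v, w)) 0) (Submodule.mem_span_singleton_self _)
  have hp : ∀ i, 0 ≤ i → ∀ x ∈ 𝒢 i, prodAct V W x (v, w) ∈ Submodule.span ℂ {(v, w)} := by
    intro i hi x hx
    rcases hi.eq_or_lt with rfl | hi
    · refine Submodule.mem_span_singleton.mpr ⟨lam ⟨x, hx⟩, ?_⟩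
      have h1 := hV.weight ⟨x, hx⟩
      have h2 := hW.weight ⟨x, hx⟩
      simp only at h1 h2
      rw [prodAct_apply, h1, h2]
      rfl
    · rw [prodAct_apply, hV.lie_pos i hi x hx, hW.lie_pos i hi x hx]
      exact zero_mem _
  have hN : ∀ x : 𝔤, ∀ s ∈ N, prodAct V W x s ∈ N := by
    intro x s hs
    obtain ⟨n, hn⟩ := (Submodule.mem_iSup_of_directed _ (wordSpan_mono _).directed_le).mp hs
    refine mem_of_homogeneous h𝒢 ((prodAct V W).flip s) N (fun i y hy => ?_) x
    rcases le_or_gt 0 i with hi | hi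
    · exact le_iSup (wordSpan 𝒢 (v, w)) n (prodAct_mem_wordSpan hbr hp n i hi y hy s hn)
    · exact le_iSup (wordSpan 𝒢 (v, w)) (n + 1) (prodAct_mem_wordSpan_succ hi hy hn)
  have hNle : N ≤ Submodule.span ℂ {(v, w)} ⊔ (negPart 𝒱).prod (negPart 𝒲) :=
    iSup_le fun n => wordSpan_le hV.lie_mem hW.lie_mem hV.mem_zero hW.mem_zero n
  have hdec : ∀ s ∈ N, ∃ c : ℂ, s.1 - c • v ∈ negPart 𝒱 ∧ s.2 - c • w ∈ negPart 𝒲 := by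
    intro s hs
    obtain ⟨a, ha, b, hb, rfl⟩ := Submodule.mem_sup.mp (hNle hs)
    obtain ⟨c, rfl⟩ := Submodule.mem_span_singleton.mp ha
    exact ⟨c, by simpa using hb.1, by simpa using hb.2⟩
  have hz1 : ∀ a : V, (a, (0 : W)) ∈ N → a = 0 := by
    rcases eq_bot_or_eq_top_of_lie_mem (𝔤 := 𝔤) (N.comap (LinearMap.inl ℂ V W))
      (fun x a ha => by simpa using hN x _ ha) with h | h
    · intro a ha
      have : a ∈ N.comap (LinearMap.inl ℂ V W) := ha
      rwa [h] at this
    · exfalso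
      have h1 : v ∈ N.comap (LinearMap.inl ℂ V W) := h ▸ Submodule.mem_top
      obtain ⟨c, h2, h3⟩ := hdec _ h1
      simp only [LinearMap.coe_inl, zero_sub] at h2 h3
      have hc : c • w = 0 := eq_zero_of_mem_negPart hW.isInternal
        (Submodule.smul_mem _ _ hW.mem_zero) (neg_mem_iff.mp h3)
      have hc : c = 0 := (smul_eq_zero.mp hc).resolve_right hW.ne_zero
      rw [hc, zero_smul, sub_zero] at h2
      exact hV.ne_zero (eq_zero_of_mem_negPart hV.isInternal hV.mem_zero h2)
  have hz2 : ∀ b : W, ((0 : V), b) ∈ N → b = 0 := by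
    rcases eq_bot_or_eq_top_of_lie_mem (𝔤 := 𝔤) (N.comap (LinearMap.inr ℂ V W))
      (fun x a ha => by simpa using hN x _ ha) with h | h
    · intro a ha
      have : a ∈ N.comap (LinearMap.inr ℂ V W) := ha
      rwa [h] at this
    · exfalso
      have h1 : w ∈ N.comap (LinearMap.inr ℂ V W) := h ▸ Submodule.mem_top
      obtain ⟨c, h2, h3⟩ := hdec _ h1
      simp only [LinearMap.coe_inr, zero_sub] at h2 h3
      have hc : c • v = 0 := eq_zero_of_mem_negPart hV.isInternal
        (Submodule.smul_mem _ _ hV.mem_zero) (neg_mem_iff.mp h2)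
      have hc : c = 0 := (smul_eq_zero.mp hc).resolve_right hV.ne_zero
      rw [hc, zero_smul, sub_zero] at h3
      exact hW.ne_zero (eq_zero_of_mem_negPart hW.isInternal hW.mem_zero h3)
  have hs1 : N.map (LinearMap.fst ℂ V W) = ⊤ := by
    refine (eq_bot_or_eq_top_of_lie_mem (𝔤 := 𝔤) _ ?_).resolve_left fun h => ?_
    · rintro x _ ⟨s, hs, rfl⟩
      exact ⟨_, hN x s hs, rfl⟩
    · have : v ∈ N.map (LinearMap.fst ℂ V W) := ⟨_, hpN, rfl⟩
      rw [h] at this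
      exact hV.ne_zero this
  have hs2 : N.map (LinearMap.snd ℂ V W) = ⊤ := by
    refine (eq_bot_or_eq_top_of_lie_mem (𝔤 := 𝔤) _ ?_).resolve_left fun h => ?_
    · rintro x _ ⟨s, hs, rfl⟩
      exact ⟨_, hN x s hs, rfl⟩
    · have : w ∈ N.map (LinearMap.snd ℂ V W) := ⟨_, hpN, rfl⟩
      rw [h] at this
      exact hW.ne_zero this
  let e1 : N ≃ₗ[ℂ] V := LinearEquiv.ofBijective ((LinearMap.fst ℂ V W).domRestrict N) <| by
    refine ⟨(injective_iff_map_eq_zero _).mpr ?_, fun a => ?_⟩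
    · rintro ⟨⟨a, b⟩, hs⟩ (rfl : a = 0)
      simp [hz2 b hs]
    · obtain ⟨s, hs, rfl⟩ : a ∈ N.map (LinearMap.fst ℂ V W) := hs1 ▸ Submodule.mem_top
      exact ⟨⟨s, hs⟩, rfl⟩
  let e2 : N ≃ₗ[ℂ] W := LinearEquiv.ofBijective ((LinearMap.snd ℂ V W).domRestrict N) <| by
    refine ⟨(injective_iff_map_eq_zero _).mpr ?_, fun a => ?_⟩
    · rintro ⟨⟨a, b⟩, hs⟩ (rfl : b = 0)
      simp [hz1 a hs]
    · obtain ⟨s, hs, rfl⟩ : a ∈ N.map (LinearMap.snd ℂ V W) := hs2 ▸ Submodule.mem_top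
      exact ⟨⟨s, hs⟩, rfl⟩
  refine ⟨{ e1.symm.trans e2 with map_lie' := ?_ }⟩
  intro x a
  obtain ⟨⟨s, hs⟩, rfl⟩ := e1.surjective a
  have h1 : ⁅x, e1 ⟨s, hs⟩⁆ = e1 ⟨_, hN x s hs⟩ := rfl
  change e2 (e1.symm ⁅x, e1 ⟨s, hs⟩⁆) = ⁅x, e2 (e1.symm (e1 ⟨s, hs⟩))⁆
  rw [h1, LinearEquiv.symm_apply_apply, LinearEquiv.symm_apply_apply]
  rfl

end Uniqueness

/-! ### Entrywise scaling of matrices and homogeneous components -/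

section Scaling

variable {R : Type*} [CommRing R] [Algebra ℂ R]

/-- The linear map multiplying the `(i, j)` entry of a matrix by the complex number `c i j`. -/
def hadamard (c : ℤ → ℤ → ℂ) : glInf R →ₗ[ℂ] glInf R :=
  let f : glInf R → Module.End R (ℤ →₀ R) := fun A =>
    Finsupp.linearCombination R fun j =>
      Finsupp.onFinset (A.1 (basisVec j)).support (fun i => c i j • matEntry A.1 i j) fun i hi => by
        rw [Finsupp.mem_support_iff]
        exact fun h => hi (by rw [matEntry, h, smul_zero])
  have hf : ∀ A i j, matEntry (f A) i j = c i j • matEntry A.1 i j := fun A i j => by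
    simp [f, matEntry]
  { toFun := fun A => ⟨f A, by
      obtain ⟨N, hN⟩ := A.2
      exact ⟨N, fun i j h => by rw [hf, hN i j h, smul_zero]⟩⟩
    map_add' := fun A B => Subtype.ext <| matEntry_ext fun i j => by
      change matEntry (f (A + B)) i j = matEntry (f A + f B) i j
      rw [matEntry_add, hf, hf, hf, ← smul_add, ← matEntry_add]
      rfl
    map_smul' := fun a A => Subtype.ext <| matEntry_ext fun i j => by
      change matEntry (f (a • A)) i j = matEntry (a • f A) i j
      rw [matEntry_smul, hf, hf, smul_comm a, ← matEntry_smul]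
      rfl }

@[simp] lemma matEntry_hadamard (c : ℤ → ℤ → ℂ) (A : glInf R) (i j : ℤ) :
    matEntry (hadamard c A).1 i j = c i j • matEntry A.1 i j := by
  simp [hadamard, matEntry]

variable {ε : ℤˣ} {m : ℕ}

lemma hadamard_mem_Lbar {c : ℤ → ℤ → ℂ} (hc : ∀ i j, c (-j) (-i) = c i j)
    {A : glInf (TruncPoly m)} (hA : A ∈ Lbar ε m) : hadamard c A ∈ Lbar ε m := by
  refine mem_Lbar_of_rel (fun i j => ?_) ?_
  · rw [matEntry_hadamard, matEntry_hadamard, hc, map_smul, mul_smul_comm, Lbar_rel hA,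
      smul_mul_assoc, smul_neg]
  · have h := hA.1 0 0 (Or.inr ⟨rfl, rfl⟩)
    simp only [add_zero, zpow_zero, one_smul, neg_zero] at h
    rw [matEntry_hadamard, map_smul, ← smul_neg, ← h]

lemma LHat_ext {x y : LHat ε m} (h : ∀ i j, matEntry x.1.mat.1 i j = matEntry y.1.mat.1 i j)
    (h' : x.1.cent = y.1.cent) : x = y := by
  obtain ⟨⟨A, z⟩, hx⟩ := x
  obtain ⟨⟨B, w⟩, hy⟩ := y
  obtain rfl : A = B := Subtype.ext (matEntry_ext h)
  obtain rfl : z = w := h'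
  rfl

/-- The matrix entry at the place `(i, j)` as a linear map on `L_±^[m]`. -/
def entryL (ε : ℤˣ) (m : ℕ) (i j : ℤ) : LHat ε m →ₗ[ℂ] TruncPoly m where
  toFun x := matEntry x.1.mat.1 i j
  map_add' x y := matEntry_add x.1.mat.1 y.1.mat.1 i j
  map_smul' c x := matEntry_smul c x.1.mat.1 i j

/-- The central component as a linear map on `L_±^[m]`. -/
def centFun (ε : ℤˣ) (m : ℕ) : LHat ε m →ₗ[ℂ] TruncPoly m where
  toFun x := x.1.cent
  map_add' _ _ := rfl
  map_smul' _ _ := rfl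

lemma LHat_ext' {x y : LHat ε m} (h : ∀ i j, entryL ε m i j x = entryL ε m i j y)
    (h' : centFun ε m x = centFun ε m y) : x = y := LHat_ext h h'

/-- The central element `z ∈ ℂ[u] / (u ^ (m + 1))` of `L_±^[m]`. -/
def centHat (ε : ℤˣ) (m : ℕ) : TruncPoly m →ₗ[ℂ] LHat ε m where
  toFun z := ⟨glHat.mk 0 z, (Lbar ε m).zero_mem⟩
  map_add' _ _ := LHat_ext' (fun i j => by rw [map_add]; exact (add_zero (0 : TruncPoly m)).symm) rfl
  map_smul' c _ := LHat_ext' (fun i j => by rw [map_smul]; exact (smul_zero c).symm) rfl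

@[simp] lemma entryL_centHat (z : TruncPoly m) (i j : ℤ) : entryL ε m i j (centHat ε m z) = 0 := rfl

@[simp] lemma centFun_centHat (z : TruncPoly m) : centFun ε m (centHat ε m z) = z := rfl

/-- The element of `L_±^[m]` given by a matrix, with zero central component. -/
def matHat (A : glInf (TruncPoly m)) (hA : A ∈ Lbar ε m) : LHat ε m := ⟨glHat.mk A 0, hA⟩

@[simp] lemma entryL_matHat (A : glInf (TruncPoly m)) (hA : A ∈ Lbar ε m) (i j : ℤ) :
    entryL ε m i j (matHat A hA) = matEntry A.1 i j := rfl

/-- The map multiplying the `(i, j)` entry of an element of `L_±^[m]` by the complex number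
`c i j` and removing its central component. -/
def scaleL (c : ℤ → ℤ → ℂ) (hc : ∀ i j, c (-j) (-i) = c i j) (x : LHat ε m) : LHat ε m :=
  matHat (hadamard c x.1.mat) (hadamard_mem_Lbar hc x.2)

@[simp] lemma entryL_scaleL (c : ℤ → ℤ → ℂ) (hc : ∀ i j, c (-j) (-i) = c i j) (x : LHat ε m)
    (i j : ℤ) : entryL ε m i j (scaleL c hc x) = c i j • entryL ε m i j x :=
  matEntry_hadamard c x.1.mat i j

@[simp] lemma centFun_scaleL (c : ℤ → ℤ → ℂ) (hc : ∀ i j, c (-j) (-i) = c i j) (x : LHat ε m) :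
    centFun ε m (scaleL c hc x) = 0 := rfl

lemma mem_LGrade {k : ℤ} {x : LHat ε m} : x ∈ LGrade ε m k ↔
    (∀ i j, j - i ≠ k → entryL ε m i j x = 0) ∧ (k ≠ 0 → centFun ε m x = 0) := Iff.rfl

lemma centHat_mem (z : TruncPoly m) : centHat ε m z ∈ LGrade ε m 0 :=
  mem_LGrade.mpr ⟨fun _ _ _ => rfl, fun h => (h rfl).elim⟩

lemma iSup_LGrade : ⨆ k, LGrade ε m k = ⊤ := by
  refine eq_top_iff.mpr fun x _ => ?_
  obtain ⟨N, -, hN⟩ := exists_band x.1.mat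
  let c : ℤ → ℤ → ℤ → ℂ := fun k i j => if j - i = k then 1 else 0
  have hc : ∀ k i j, c k (-j) (-i) = c k i j := fun k i j => by
    simp only [c]
    congr 1
    rw [eq_iff_iff]
    omega
  have hx : x = ∑ k ∈ Finset.Icc (-N) N, scaleL (c k) (hc k) x + centHat ε m (centFun ε m x) := by
    refine LHat_ext' (fun i j => ?_) ?_
    · simp only [map_add, map_sum, entryL_scaleL, entryL_centHat, add_zero, c, ite_smul, one_smul,
        zero_smul, Finset.sum_ite_eq]
      split_ifs with h
      · rfl
      · refine hN i j ?_
        by_contra h'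
        rw [not_lt, abs_sub_comm, abs_le] at h'
        exact h (Finset.mem_Icc.mpr h')
    · simp
  rw [hx]
  refine add_mem (sum_mem fun k _ => ?_) ?_
  · refine Submodule.mem_iSup_of_mem k (mem_LGrade.mpr ⟨fun i j h => ?_, fun _ => rfl⟩)
    simp [c, h]
  · exact Submodule.mem_iSup_of_mem 0 (centHat_mem _)

lemma entryL_lie (x y : LHat ε m) (i j : ℤ) : entryL ε m i j ⁅x, y⁆ =
    matEntry (x.1.mat.1 * y.1.mat.1) i j - matEntry (y.1.mat.1 * x.1.mat.1) i j := by
  rw [← matEntry_sub]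
  have : (⁅x, y⁆ : LHat ε m).1 = ⁅x.1, y.1⁆ := rfl
  change matEntry (⁅x, y⁆ : LHat ε m).1.mat.1 i j = _
  rw [this, glHat.lie_def]
  rfl

lemma centFun_lie (x y : LHat ε m) : centFun ε m ⁅x, y⁆ = trCocycle x.1.mat y.1.mat := by
  have : (⁅x, y⁆ : LHat ε m).1 = ⁅x.1, y.1⁆ := rfl
  change (⁅x, y⁆ : LHat ε m).1.cent = _
  rw [this, glHat.lie_def]
  rfl

lemma lie_centHat (z : TruncPoly m) (x : LHat ε m) : ⁅centHat ε m z, x⁆ = 0 := by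
  refine LHat_ext' (fun i j => ?_) ?_
  · rw [entryL_lie, show (centHat ε m z).1.mat.1 = 0 from rfl]
    simp
  · rw [centFun_lie, show (centHat ε m z).1.mat = 0 from rfl]
    exact LinearMap.congr_fun (map_zero (trBilin _)) _

/-- Bracketing with a diagonal matrix scales the entries by differences of diagonal entries. -/
lemma entryL_diag_lie {x : LHat ε m} (hx : ∀ i j, i ≠ j → entryL ε m i j x = 0) (y : LHat ε m)
    (i j : ℤ) : entryL ε m i j ⁅x, y⁆ =
      (entryL ε m i i x - entryL ε m j j x) * entryL ε m i j y := by
  have h : x.1.mat.1 = diagonalOp 0 fun j => entryL ε m j j x := by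
    refine matEntry_ext fun i j => ?_
    rw [matEntry_diagonalOp, sub_zero]
    split_ifs with h
    · subst h; rfl
    · exact hx i j fun h' => h h'.symm
  rw [entryL_lie, h, matEntry_diag_mul, matEntry_mul_diag]
  change _ * entryL ε m i j y - entryL ε m i j y * _ = _
  ring

/-- The cocycle only sees the entries relating positive and nonpositive indices. -/
lemma trCocycle_eq_zero {A B : glInf R} (h : ∀ i j, ¬ (0 < i ↔ 0 < j) →
    matEntry A.1 i j = 0) : trCocycle A B = 0 := by
  obtain ⟨N, -, hN⟩ := exists_band A
  rw [trCocycle_eq_left hN]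
  refine Finset.sum_eq_zero fun i _ => Finset.sum_eq_zero fun j _ => ?_
  by_cases hij : (0 < i ↔ 0 < j)
  · rw [theta_eq hij, zero_mul, zero_mul]
  · rw [h i j hij, mul_zero, zero_mul]

lemma centFun_lie_eq_zero {x y : LHat ε m}
    (h : ∀ i j, ¬ (0 < i ↔ 0 < j) → entryL ε m i j x = 0) : centFun ε m ⁅x, y⁆ = 0 :=
  (centFun_lie x y).trans (trCocycle_eq_zero h)

lemma centFun_diag_lie {x : LHat ε m} (hx : ∀ i j, i ≠ j → entryL ε m i j x = 0) (y : LHat ε m) :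
    centFun ε m ⁅x, y⁆ = 0 :=
  centFun_lie_eq_zero fun i j h => hx i j fun hij => h (by rw [hij])

end Scaling

/-! ### Quasifiniteness forces matrices supported far away to act by zero -/

section Far

/-- Let `H` act on two finite-dimensional spaces `E₁` and `E₂` and let `y 1` map `E₁` to `E₂`. If
`y p` stands for `p(ad H)` applied to `y 1`, then a nonzero polynomial `p` depending only on `E₁`,
`E₂` and `H` makes `y p` vanish on `E₁`: the minimal polynomial of the operator `f ↦ H f - f H`
on the space of linear maps from `E₁` to `E₂`. -/
lemma exists_polynomial_lie_eq_zero {𝔤 V : Type*} [LieRing 𝔤] [LieAlgebra ℂ 𝔤] [AddCommGroup V]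
    [Module ℂ V] [LieRingModule 𝔤 V] [LieModule ℂ 𝔤 V] (E₁ E₂ : Submodule ℂ V)
    [FiniteDimensional ℂ E₁] [FiniteDimensional ℂ E₂] (H : 𝔤) (h₁ : ∀ w ∈ E₁, ⁅H, w⁆ ∈ E₁)
    (h₂ : ∀ w ∈ E₂, ⁅H, w⁆ ∈ E₂) :
    ∃ p : ℂ[X], p ≠ 0 ∧ ∀ y : ℂ[X] → 𝔤, (∀ a, y (C a) = a • y 1) →
      (∀ q r, y (q + r) = y q + y r) → (∀ q, y (q * X) = ⁅H, y q⁆) →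
      (∀ w ∈ E₁, ⁅y 1, w⁆ ∈ E₂) → ∀ w ∈ E₁, ⁅y p, w⁆ = 0 := by
  let H₁ : Module.End ℂ E₁ := (LieModule.toEnd ℂ 𝔤 V H).restrict h₁
  let H₂ : Module.End ℂ E₂ := (LieModule.toEnd ℂ 𝔤 V H).restrict h₂
  let Θ : Module.End ℂ (E₁ →ₗ[ℂ] E₂) :=
    { toFun := fun f => H₂ ∘ₗ f - f ∘ₗ H₁
      map_add' := fun f g => by
        rw [LinearMap.comp_add, LinearMap.add_comp]; abel
      map_smul' := fun c f => by
        rw [LinearMap.comp_smul, LinearMap.smul_comp, RingHom.id_apply, smul_sub] }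
  refine ⟨minpoly ℂ Θ, minpoly.ne_zero (Algebra.IsIntegral.isIntegral Θ),
    fun y hC hadd hX hy => ?_⟩
  let ρ : E₁ →ₗ[ℂ] E₂ := (LieModule.toEnd ℂ 𝔤 V (y 1)).restrict hy
  have key : ∀ p : ℂ[X], ∀ w : E₁, (((aeval Θ p) ρ w : E₂) : V) = ⁅y p, (w : V)⁆ := by
    intro p
    induction p using Polynomial.induction_on with
    | C a =>
      intro w
      rw [hC, aeval_C, Module.algebraMap_end_apply, smul_lie]
      rfl
    | add p q hp hq =>
      intro w
      rw [hadd, map_add, add_lie, ← hp, ← hq]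
      rfl
    | monomial r a ih =>
      intro w
      have e : C a * X ^ (r + 1) = C a * X ^ r * X := by ring
      rw [e, hX, mul_comm _ X, map_mul, aeval_X, Module.End.mul_apply, lie_lie, ← ih w]
      have : ∀ f : E₁ →ₗ[ℂ] E₂, ((Θ f w : E₂) : V) = ⁅H, (f w : V)⁆ - f (H₁ w) := fun f => rfl
      rw [this, ih (H₁ w)]
      rfl
  intro w hw
  have h0 : aeval Θ (minpoly ℂ Θ) = 0 := minpoly.aeval ℂ Θ
  rw [← key (minpoly ℂ Θ) ⟨w, hw⟩, h0]
  rfl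

lemma matEntry_shift_commutator {R : Type*} [CommRing R] [Algebra ℂ R] (a b : ℤ → R) (i j : ℤ) :
    matEntry (diagonalOp 1 a * diagonalOp (-1) b) i j -
      matEntry (diagonalOp (-1) b * diagonalOp 1 a) i j =
        if j = i then a (j + 1) * b j - b (j - 1) * a j else 0 := by
  rw [diagonalOp_mul, diagonalOp_mul, matEntry_diagonalOp, matEntry_diagonalOp]
  simp only [add_neg_cancel, neg_add_cancel, sub_zero, sub_neg_eq_add]
  split_ifs with h
  · rfl
  · rw [sub_zero]

variable {ε : ℤˣ} {m : ℕ}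

/-- `x` is a matrix concentrated on the diagonal `k`, all of whose nonzero entries are in columns
of absolute value greater than `N`. -/
def IsFar (k N : ℤ) (x : LHat ε m) : Prop :=
  centFun ε m x = 0 ∧ (∀ i j, j - i ≠ k → entryL ε m i j x = 0) ∧
    ∀ i j, |j| ≤ N → entryL ε m i j x = 0

lemma IsFar.mono {k N M : ℤ} {x : LHat ε m} (h : IsFar k N x) (hM : M ≤ N) : IsFar k M x :=
  ⟨h.1, h.2.1, fun i j hj => h.2.2 i j (hj.trans hM)⟩

variable (ε m) in
/-- The diagonal matrix with entries `j ^ 3`. The adjoint action of this element multiplies the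
`(i, j)` entries by `i ^ 3 - j ^ 3`, and on each diagonal but the main one this scalar takes each
value finitely often. -/
def cubeL : LHat ε m :=
  matHat ⟨diagonalOp 0 fun j => ((j : TruncPoly m) ^ 3), diagonalOp_mem _ _⟩ <| by
    refine mem_Lbar_of_rel (fun i j => ?_) ?_
    · simp only [matEntry_diagonalOp, sub_zero]
      by_cases h : j = i
      · subst h
        simp
        ring
      · have h' : ¬ -i = -j := fun h' => h (by omega)
        simp [h, h']
    · simp [matEntry_diagonalOp]

lemma entryL_cubeL (i j : ℤ) :
    entryL ε m i j (cubeL ε m) = if j = i then (j : TruncPoly m) ^ 3 else 0 := by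
  rw [cubeL, entryL_matHat, matEntry_diagonalOp, sub_zero]

lemma entryL_cubeL_self (j : ℤ) : entryL ε m j j (cubeL ε m) = (j : TruncPoly m) ^ 3 := by
  rw [entryL_cubeL, if_pos (Eq.refl j)]

lemma cubeL_mem : cubeL ε m ∈ LGrade ε m 0 := by
  refine mem_LGrade.mpr ⟨fun i j h => ?_, fun h => (h rfl).elim⟩
  rw [entryL_cubeL, if_neg (by omega)]

lemma cube_symm (p : ℂ[X]) (i j : ℤ) :
    p.eval (((-j : ℤ) : ℂ) ^ 3 - ((-i : ℤ) : ℂ) ^ 3) = p.eval ((i : ℂ) ^ 3 - (j : ℂ) ^ 3) := by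
  congr 1
  push_cast
  ring

/-- The entrywise scaling by the values of the polynomial `p` at `i ^ 3 - j ^ 3`. -/
def scaleCube (p : ℂ[X]) (x : LHat ε m) : LHat ε m :=
  scaleL (fun i j => p.eval ((i : ℂ) ^ 3 - (j : ℂ) ^ 3)) (cube_symm p) x

@[simp] lemma entryL_scaleCube (p : ℂ[X]) (x : LHat ε m) (i j : ℤ) :
    entryL ε m i j (scaleCube p x) = p.eval ((i : ℂ) ^ 3 - (j : ℂ) ^ 3) • entryL ε m i j x :=
  entryL_scaleL _ _ _ _ _

@[simp] lemma centFun_scaleCube (p : ℂ[X]) (x : LHat ε m) : centFun ε m (scaleCube p x) = 0 := rfl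

lemma scaleCube_C (a : ℂ) {x : LHat ε m} (hx : centFun ε m x = 0) : scaleCube (C a) x = a • x :=
  LHat_ext' (fun i j => by rw [map_smul]; simp) (by rw [map_smul]; simp [hx])

lemma scaleCube_add (p q : ℂ[X]) (x : LHat ε m) :
    scaleCube (p + q) x = scaleCube p x + scaleCube q x :=
  LHat_ext' (fun i j => by rw [map_add]; simp [add_smul]) (by rw [map_add]; simp)

lemma cube_smul {R : Type*} [CommRing R] [Algebra ℂ R] (i j : ℤ) (a : ℂ) (x : R) :
    (a * ((i : ℂ) ^ 3 - (j : ℂ) ^ 3)) • x = ((i : R) ^ 3 - (j : R) ^ 3) * a • x := by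
  rw [mul_comm a, mul_smul, Algebra.smul_def]
  simp

lemma scaleCube_mul_X (p : ℂ[X]) (x : LHat ε m) :
    scaleCube (p * X) x = ⁅cubeL ε m, scaleCube p x⁆ := by
  have h : ∀ i j, i ≠ j → entryL ε m i j (cubeL ε m) = 0 := fun i j h => by
    rw [entryL_cubeL, if_neg h.symm]
  refine LHat_ext' (fun i j => ?_) ?_
  · rw [entryL_diag_lie h, entryL_cubeL_self, entryL_cubeL_self, entryL_scaleCube,
      entryL_scaleCube, eval_mul, eval_X]
    exact cube_smul _ _ _ _
  · rw [centFun_diag_lie h, centFun_scaleCube]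

section Module

variable {V : Type*} [AddCommGroup V] [Module ℂ V] [LieRingModule (LHat ε m) V]
  [LieModule ℂ (LHat ε m) V] {𝒱 : ℤ → Submodule ℂ V}

/-- For a fixed degree, some nonzero polynomial in the adjoint action of the matrix with entries
`j ^ 3` maps into the elements acting by zero on a given finite-dimensional component. -/
lemma exists_scaleCube_lie_eq_zero
    (hlie : ∀ i j : ℤ, ∀ x ∈ LGrade ε m i, ∀ w ∈ 𝒱 j, ⁅x, w⁆ ∈ 𝒱 (i + j))
    (hfin : IsQuasifinite 𝒱) (k n : ℤ) :
    ∃ p : ℂ[X], p ≠ 0 ∧ ∀ x ∈ LGrade ε m k, centFun ε m x = 0 →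
      ∀ w ∈ 𝒱 n, ⁅scaleCube p x, w⁆ = 0 := by
  have := hfin n
  have := hfin (k + n)
  have hH : ∀ l, ∀ w ∈ 𝒱 l, ⁅cubeL ε m, w⁆ ∈ 𝒱 l := fun l w hw => by
    have := hlie 0 l _ cubeL_mem w hw
    rwa [zero_add] at this
  obtain ⟨p, hp, h⟩ := exists_polynomial_lie_eq_zero (𝒱 n) (𝒱 (k + n)) (cubeL ε m) (hH _) (hH _)
  refine ⟨p, hp, fun x hx hx' => h (fun q => scaleCube q x) (fun a => ?_)
    (fun q r => scaleCube_add q r x) (fun q => scaleCube_mul_X q x) fun w hw => ?_⟩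
  · have h1 : scaleCube 1 x = x := by rw [← C_1, scaleCube_C 1 hx', one_smul]
    change scaleCube (C a) x = a • scaleCube 1 x
    rw [h1, scaleCube_C a hx']
  · have h1 : scaleCube 1 x = x := by rw [← C_1, scaleCube_C 1 hx', one_smul]
    change ⁅scaleCube 1 x, w⁆ ∈ _
    rw [h1]
    exact hlie k n x hx w hw

/-- For `k ≠ 0` the scalar `(j - k) ^ 3 - j ^ 3` is a nonconstant polynomial in `j`, so it meets
the roots of `p` for finitely many `j` only. -/
lemma exists_bound_of_cube {p : ℂ[X]} (hp : p ≠ 0) {k : ℤ} (hk : k ≠ 0) :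
    ∃ N : ℤ, ∀ i j : ℤ, j - i = k → N < |j| → p.eval ((i : ℂ) ^ 3 - (j : ℂ) ^ 3) ≠ 0 := by
  let q : ℂ[X] := (X - C (k : ℂ)) ^ 3 - X ^ 3
  have hq : p.comp q ≠ 0 := by
    rw [Ne, comp_eq_zero_iff, not_or]
    refine ⟨hp, fun h => ?_⟩
    -- `q` takes the values `-k ^ 3` at `0` and `-7 k ^ 3` at `2 k`
    have h0 : q.eval 0 = q.eval (2 * k : ℂ) := by rw [h.2, eval_C, eval_C]
    have h1 : (k : ℂ) ^ 3 = 0 := by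
      simp only [q, eval_sub, eval_pow, eval_X, eval_C] at h0
      linear_combination h0 / 6
    exact hk (by exact_mod_cast (pow_eq_zero_iff three_ne_zero).mp h1)
  have hfin : {j : ℤ | (p.comp q).IsRoot (j : ℂ)}.Finite :=
    (finite_setOfPred_isRoot hq).preimage Int.cast_injective.injOn
  obtain ⟨N, hN⟩ := (hfin.image fun j => |j|).bddAbove
  refine ⟨N, fun i j hij hj h => ?_⟩
  refine absurd (hN ⟨j, ?_, rfl⟩) (not_le.mpr hj)
  change (p.comp q).eval (j : ℂ) = 0
  obtain rfl : i = j - k := by omega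
  rw [eval_comp, ← h]
  simp [q]

/-- Off the main diagonal, an element supported far from the origin is obtained by applying the
annihilating polynomial to the element with entries divided by the values of that polynomial. -/
lemma exists_far_lie_eq_zero_of_ne
    (hlie : ∀ i j : ℤ, ∀ x ∈ LGrade ε m i, ∀ w ∈ 𝒱 j, ⁅x, w⁆ ∈ 𝒱 (i + j))
    (hfin : IsQuasifinite 𝒱) {k : ℤ} (hk : k ≠ 0) (n : ℤ) :
    ∃ N : ℤ, ∀ x : LHat ε m, IsFar k N x → ∀ w ∈ 𝒱 n, ⁅x, w⁆ = 0 := by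
  obtain ⟨p, hp, h⟩ := exists_scaleCube_lie_eq_zero hlie hfin k n
  obtain ⟨N, hN⟩ := exists_bound_of_cube hp hk
  refine ⟨N, fun x hx w hw => ?_⟩
  let x' : LHat ε m := scaleL (fun i j => (p.eval ((i : ℂ) ^ 3 - (j : ℂ) ^ 3))⁻¹)
    (fun i j => by rw [cube_symm]) x
  have e : scaleCube p x' = x := by
    refine LHat_ext' (fun i j => ?_) hx.1.symm
    rw [entryL_scaleCube, entryL_scaleL, smul_smul]
    by_cases hij : j - i = k
    · rcases le_or_gt |j| N with hj | hj
      · rw [hx.2.2 i j hj, smul_zero]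
      · rw [mul_inv_cancel₀ (hN i j hij hj), one_smul]
    · rw [hx.2.1 i j hij, smul_zero]
  rw [← e]
  refine h x' (mem_LGrade.mpr ⟨fun i j hij => ?_, fun _ => rfl⟩) rfl w hw
  rw [entryL_scaleL, hx.2.1 i j hij, smul_zero]

end Module

/-- The entries of a matrix on the diagonal `k`, indexed by the column `j`: they are `b j` at the
places `(j - k, j)` in the positive quadrant, in the negative quadrant they are determined by the
defining relations of `Lbar ε m`, and they vanish in the other quadrants and on the axes. -/
def quadrantSeq (ε : ℤˣ) {m : ℕ} (k : ℤ) (b : ℤ → TruncPoly m) (j : ℤ) : TruncPoly m :=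
  if 0 < j ∧ 0 < j - k then b j else
    if j < 0 ∧ j - k < 0 then -(zsign (-ε) k * negU m (b (k - j))) else 0

lemma quadrantSeq_mem (k : ℤ) (b : ℤ → TruncPoly m) :
    (⟨diagonalOp k (quadrantSeq ε k b), diagonalOp_mem _ _⟩ : glInf (TruncPoly m)) ∈ Lbar ε m := by
  have h0 : ∀ j, j = 0 ∨ j - k = 0 ∨ (j < 0 ∧ 0 < j - k) ∨ (0 < j ∧ j - k < 0) →
      quadrantSeq ε k b j = 0 := fun j h => by
    rw [quadrantSeq, if_neg (by omega), if_neg (by omega)]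
  have he : ∀ i j : ℤ, 0 < i * j ∨ i = 0 ∧ j = 0 →
      matEntry (diagonalOp k (quadrantSeq ε k b)) i j = -(zsign (-ε) (i + j) *
        negU m (matEntry (diagonalOp k (quadrantSeq ε k b)) (-j) (-i))) := by
    intro i j hij
    rw [matEntry_diagonalOp, matEntry_diagonalOp]
    by_cases hk : j - k = i
    · obtain rfl : k = j - i := by omega
      have hz : (zsign (-ε) (j - i) : TruncPoly m) = zsign (-ε) (i + j) := by
        rw [sub_eq_add_neg, zsign_add, zsign_neg, ← zsign_add, add_comm j i]
      have hs := zsign_mul_self (R := TruncPoly m) (-ε) (i + j)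
      rw [if_pos hk, if_pos (by omega)]
      rcases hij with hij | ⟨rfl, rfl⟩
      · rcases pos_and_pos_or_neg_and_neg_of_mul_pos hij with ⟨hi, hj⟩ | ⟨hi, hj⟩
        · rw [quadrantSeq, quadrantSeq, if_pos (by omega), if_neg (by omega), if_pos (by omega), hz,
            map_neg, map_mul, negU_zsign, negU_negU]
          have : j - i - -i = j := by omega
          rw [this]
          linear_combination (-b j) * hs
        · rw [quadrantSeq, quadrantSeq, if_neg (by omega), if_pos (by omega), if_pos (by omega), hz]
          have : j - i - j = -i := by omega
          rw [this]
      · rw [h0 _ (by omega), h0 _ (by omega)]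
        simp
    · rw [if_neg hk, if_neg (by omega)]
      simp
  refine ⟨fun i j h => by rw [zsign_smul]; exact he i j h, fun i j hij => ?_, fun i hi => ?_,
    fun i hi => ?_⟩
  · have h1 : matEntry (diagonalOp k (quadrantSeq ε k b)) i j = 0 := by
      rw [matEntry_diagonalOp]
      split_ifs with h
      · exact h0 _ (by rcases mul_neg_iff.mp hij with h | h <;> omega)
      · rfl
    have h2 : matEntry (diagonalOp k (quadrantSeq ε k b)) (-j) (-i) = 0 := by
      rw [matEntry_diagonalOp]
      split_ifs with h
      · exact h0 _ (by rcases mul_neg_iff.mp hij with h | h <;> omega)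
      · rfl
    rw [h1, h2, map_zero, smul_zero]
  · have h1 : matEntry (diagonalOp k (quadrantSeq ε k b)) (-i) 0 = 0 := by
      rw [matEntry_diagonalOp]
      split_ifs with h
      · exact h0 _ (by omega)
      · rfl
    have h2 : matEntry (diagonalOp k (quadrantSeq ε k b)) 0 i = 0 := by
      rw [matEntry_diagonalOp]
      split_ifs with h
      · exact h0 _ (by omega)
      · rfl
    rw [h1, h2, map_zero, mul_zero, smul_zero]
  · have h1 : matEntry (diagonalOp k (quadrantSeq ε k b)) i 0 = 0 := by
      rw [matEntry_diagonalOp]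
      split_ifs with h
      · exact h0 _ (by omega)
      · rfl
    have h2 : matEntry (diagonalOp k (quadrantSeq ε k b)) 0 (-i) = 0 := by
      rw [matEntry_diagonalOp]
      split_ifs with h
      · exact h0 _ (by omega)
      · rfl
    rw [h1, h2, map_zero, mul_zero, smul_zero, neg_zero]

/-- The element of `L_±^[m]` with matrix given by `quadrantSeq`. -/
def quadrantL (ε : ℤˣ) {m : ℕ} (k : ℤ) (b : ℤ → TruncPoly m) : LHat ε m :=
  matHat ⟨diagonalOp k (quadrantSeq ε k b), diagonalOp_mem _ _⟩ (quadrantSeq_mem k b)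

lemma entryL_quadrantL (k : ℤ) (b : ℤ → TruncPoly m) (i j : ℤ) :
    entryL ε m i j (quadrantL ε k b) = if j - k = i then quadrantSeq ε k b j else 0 :=
  matEntry_diagonalOp _ _ _ _

/-- The defining relations determine the diagonal entries at the negative places by those at the
positive ones. -/
lemma diag_ext {x y : LHat ε m} (hx : ∀ i j, i ≠ j → entryL ε m i j x = 0)
    (hy : ∀ i j, i ≠ j → entryL ε m i j y = 0) (hc : centFun ε m x = centFun ε m y)
    (h : ∀ i, 0 ≤ i → entryL ε m i i x = entryL ε m i i y) : x = y := by
  refine LHat_ext' (fun i j => ?_) hc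
  by_cases hij : i = j
  · subst hij
    rcases le_or_gt 0 i with hi | hi
    · exact h i hi
    · have h1 := x.2.1 i i (Or.inl (mul_pos_of_neg_of_neg hi hi))
      have h2 := y.2.1 i i (Or.inl (mul_pos_of_neg_of_neg hi hi))
      change entryL ε m i i x = -(_ • negU m (entryL ε m (-i) (-i) x)) at h1
      change entryL ε m i i y = -(_ • negU m (entryL ε m (-i) (-i) y)) at h2
      rw [h1, h2, h (-i) (by omega)]
  · rw [hx i j hij, hy i j hij]

lemma quadrantSeq_of_pos {k j : ℤ} (hj : 0 < j) (hjk : 0 < j - k) (b : ℤ → TruncPoly m) :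
    quadrantSeq ε k b j = b j :=
  if_pos ⟨hj, hjk⟩

lemma quadrantSeq_eq_zero {k j : ℤ} (h : ¬ (0 < j ∧ 0 < j - k)) (h' : ¬ (j < 0 ∧ j - k < 0))
    (b : ℤ → TruncPoly m) : quadrantSeq ε k b j = 0 :=
  (if_neg h).trans (if_neg h')

lemma quadrantSeq_commutator_zero (s : ℤ → TruncPoly m) :
    quadrantSeq ε 1 (fun _ => 1) (0 + 1) * quadrantSeq ε (-1) s 0 -
      quadrantSeq ε (-1) s (0 - 1) * quadrantSeq ε 1 (fun _ => 1) 0 = 0 := by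
  rw [quadrantSeq_eq_zero (j := 0) (by omega) (by omega),
    quadrantSeq_eq_zero (j := 0) (by omega) (by omega), mul_zero, mul_zero, sub_zero]

lemma quadrantSeq_commutator_one (s : ℤ → TruncPoly m) :
    quadrantSeq ε 1 (fun _ => 1) (1 + 1) * quadrantSeq ε (-1) s 1 -
      quadrantSeq ε (-1) s (1 - 1) * quadrantSeq ε 1 (fun _ => 1) 1 = s 1 := by
  rw [quadrantSeq_of_pos (by omega) (by omega), quadrantSeq_of_pos (by omega) (by omega),
    quadrantSeq_eq_zero (j := 1) (by omega) (by omega), one_mul, mul_zero, sub_zero]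

lemma quadrantSeq_commutator_of_one_lt (s : ℤ → TruncPoly m) {i : ℤ} (hi : 1 < i) :
    quadrantSeq ε 1 (fun _ => 1) (i + 1) * quadrantSeq ε (-1) s i -
      quadrantSeq ε (-1) s (i - 1) * quadrantSeq ε 1 (fun _ => 1) i = s i - s (i - 1) := by
  rw [quadrantSeq_of_pos (by omega) (by omega), quadrantSeq_of_pos (by omega) (by omega),
    quadrantSeq_of_pos (by omega) (by omega), quadrantSeq_of_pos (by omega) (by omega), one_mul,
    mul_one]

lemma exists_partial_sums {M : Type*} [AddCommGroup M] (d : ℤ → M) (N : ℤ)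
    (hd : ∀ l, 1 ≤ l → l ≤ N → d l = 0) :
    ∃ s : ℤ → M, (∀ j, j ≤ N → s j = 0) ∧ ∀ j, 1 ≤ j → s j = s (j - 1) + d j := by
  refine ⟨fun j => ∑ l ∈ Finset.Icc 1 j, d l, fun j hj => Finset.sum_eq_zero fun l hl => ?_,
    fun j hj => ?_⟩
  · rw [Finset.mem_Icc] at hl
    exact hd l hl.1 (hl.2.trans hj)
  · have : Finset.Icc 1 j = insert j (Finset.Icc 1 (j - 1)) := by
      ext a; simp only [Finset.mem_Icc, Finset.mem_insert]; omega
    simp only [this]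
    rw [Finset.sum_insert (by simp), add_comm]

/-- A diagonal matrix supported far from the origin is the bracket of the shift matrix and a
matrix of degree `-1` supported far from the origin, whose entries are partial sums. -/
lemma IsFar.exists_lie_eq {N : ℤ} (hN : 0 ≤ N) {x : LHat ε m} (hx : IsFar 0 N x) :
    ∃ y ∈ LGrade ε m 1, ∃ z : LHat ε m, IsFar (-1) N z ∧ ⁅y, z⁆ = x := by
  obtain ⟨s, hs, hs'⟩ := exists_partial_sums (fun l => entryL ε m l l x) N fun l h h' =>
    hx.2.2 l l (abs_le.mpr (by omega))
  refine ⟨quadrantL ε 1 fun _ => 1, mem_LGrade.mpr ⟨fun i j h => ?_, fun _ => rfl⟩,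
    quadrantL ε (-1) s, ⟨rfl, fun i j h => ?_, fun i j h => ?_⟩, ?_⟩
  · rw [entryL_quadrantL, if_neg (by omega)]
  · rw [entryL_quadrantL, if_neg (by omega)]
  · rw [abs_le] at h
    rw [entryL_quadrantL]
    split_ifs with hij
    · unfold quadrantSeq
      split_ifs with h1 h2
      · exact hs _ (by omega)
      · rw [hs _ (by omega), map_zero, mul_zero, neg_zero]
      · rfl
    · rfl
  · have e : ∀ i j, entryL ε m i j ⁅quadrantL ε (m := m) 1 fun _ => 1, quadrantL ε (-1) s⁆ =
        if j = i then quadrantSeq ε 1 (fun _ => 1) (j + 1) * quadrantSeq ε (-1) s j -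
          quadrantSeq ε (-1) s (j - 1) * quadrantSeq ε 1 (fun _ => 1) j else 0 := by
      intro i j
      rw [entryL_lie]
      exact matEntry_shift_commutator _ _ i j
    refine diag_ext (fun i j h => by rw [e, if_neg h.symm]) (fun i j h => hx.2.1 i j (by omega)) ?_
      fun i hi => ?_
    · refine (centFun_lie_eq_zero fun i j hij => ?_).trans hx.1.symm
      rw [entryL_quadrantL]
      split_ifs with h
      · rw [quadrantSeq, if_neg (by omega), if_neg (by omega)]
      · rfl
    · refine ((e i i).trans (if_pos rfl)).trans ?_
      rcases hi.eq_or_lt with rfl | hi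
      · exact (quadrantSeq_commutator_zero s).trans (hx.2.2 0 0 (by simpa using hN)).symm
      · rcases (show 1 ≤ i by omega).eq_or_lt with rfl | hi'
        · refine (quadrantSeq_commutator_one s).trans ((hs' 1 le_rfl).trans ?_)
          rw [hs (1 - 1) (by omega)]
          exact zero_add _
        · exact (quadrantSeq_commutator_of_one_lt s hi').trans (sub_eq_iff_eq_add'.mpr (hs' i hi))

section Module

variable {V : Type*} [AddCommGroup V] [Module ℂ V] [LieRingModule (LHat ε m) V]
  [LieModule ℂ (LHat ε m) V] {𝒱 : ℤ → Submodule ℂ V}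

/-- Quasifiniteness implies continuity of the action on each homogeneous component: elements of
degree `k` supported outside of a sufficiently large box act by zero. -/
theorem exists_far_lie_eq_zero
    (hlie : ∀ i j : ℤ, ∀ x ∈ LGrade ε m i, ∀ w ∈ 𝒱 j, ⁅x, w⁆ ∈ 𝒱 (i + j))
    (hfin : IsQuasifinite 𝒱) (k n : ℤ) :
    ∃ N : ℤ, ∀ x : LHat ε m, IsFar k N x → ∀ w ∈ 𝒱 n, ⁅x, w⁆ = 0 := by
  rcases eq_or_ne k 0 with rfl | hk
  · obtain ⟨N₁, h₁⟩ := exists_far_lie_eq_zero_of_ne hlie hfin (k := -1) (by norm_num) n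
    obtain ⟨N₂, h₂⟩ := exists_far_lie_eq_zero_of_ne hlie hfin (k := -1) (by norm_num) (1 + n)
    refine ⟨max 0 (max N₁ N₂), fun x hx w hw => ?_⟩
    obtain ⟨y, hy, z, hz, rfl⟩ := hx.exists_lie_eq (le_max_left _ _)
    rw [lie_lie, h₁ z (hz.mono (le_max_of_le_right (le_max_left _ _))) w hw, lie_zero,
      h₂ z (hz.mono (le_max_of_le_right (le_max_right _ _))) _ (hlie 1 n y hy w hw), sub_zero]
  · exact exists_far_lie_eq_zero_of_ne hlie hfin hk n

end Module

end Far

/-! ### Interpolation of matrices by differential operators -/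

section Interpolation

variable {ε : ℤˣ} {m : ℕ}

lemma wgt_mul_self (ε : ℤˣ) (m : ℕ) {i : ℤ} (hi : i ≠ 0) : wgt ε m i * wgt ε m i = 1 := by
  rcases lt_or_gt_of_ne hi with h | h
  · rw [wgt_neg ε m h, neg_mul_neg, zsign_mul_self]
  · rw [wgt_pos ε m h, zsign_mul_self]

/-- The factor relating the `(i, j)` entry of the image of `tᵏ f(D) D` to the value of `f` at
`u - j`. -/
def imageFactor (m : ℕ) (i j : ℤ) : TruncPoly m :=
  (tau m i j : TruncPoly m) * (truncU m - (j : TruncPoly m))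

lemma isUnit_imageFactor (i : ℤ) {j : ℤ} (hj : j ≠ 0) : IsUnit (imageFactor m i j) :=
  (tau m i j).isUnit.mul (isUnit_truncU_sub m hj)

/-- The factors are compatible with the defining relations of `Lbar ε m`. -/
lemma imageFactor_reflect (i j : ℤ) : negU m (imageFactor m (-j) (-i)) * wgt ε m j =
    -(zsign ε (j - i) * wgt ε m i * imageFactor m i j) := by
  have h2 := tau_reflect m j
  have h3 := congrArg (negU m) (tau_reflect m (-i))
  simp only [map_mul, negU_negU, neg_neg, negU_wgt_neg] at h3
  have h4 : (zsign ε i * zsign ε (j - i) : TruncPoly m) = zsign ε j := by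
    rw [← zsign_add]; congr 1; ring
  simp only [imageFactor, map_mul]
  rw [← tau_mul m i 0 j, ← tau_mul m (-j) 0 (-i), wgt_eq ε m i, wgt_eq ε m j, Units.val_mul,
    Units.val_mul, map_mul]
  linear_combination
    (zsign ε i * wgt 1 m i * (tau m i 0 : TruncPoly m) * zsign ε (j - i)) * h2 +
    (negU m (tau m (-j) 0 : TruncPoly m) * zsign ε j * wgt 1 m j) * h3 +
    (wgt 1 m i * (tau m i 0 : TruncPoly m) * wgt 1 m j *
      negU m (tau m (-j) 0 : TruncPoly m)) * h4

lemma matEntry_of_reflect {A : glInf (TruncPoly m)} (hA : A ∈ Lbar ε m) {i : ℤ} (hi : i ≠ 0)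
    (j : ℤ) {g : TruncPoly m} (h : matEntry A.1 (-j) (-i) = imageFactor m (-j) (-i) * g) :
    matEntry A.1 i j = imageFactor m i j * (zsign ε (j - i) * negU m g) := by
  have h1 := Lbar_rel hA i j
  rw [h, map_mul] at h1
  have h2 := imageFactor_reflect (ε := ε) (m := m) i j
  have h3 := wgt_mul_self ε m hi
  linear_combination (-matEntry A.1 i j + imageFactor m i j * zsign ε (j - i) * negU m g) * h3 +
    wgt ε m i * h1 - wgt ε m i * negU m g * h2

lemma exists_aeval_truncU (x : TruncPoly m) : ∃ P : ℂ[X], aeval (truncU m) P = x := by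
  obtain ⟨P, rfl⟩ := AdjoinRoot.mk_surjective x
  exact ⟨P, AdjoinRoot.aeval_eq P⟩

lemma aeval_half_mul_two {R : Type*} [CommRing R] [Algebra ℂ R] (s : R) :
    aeval s (C (1 / 2 : ℂ)) * 2 = 1 := by
  have e : (2 : R) = algebraMap ℂ R 2 := (map_ofNat _ 2).symm
  rw [aeval_C, e, ← map_mul]
  norm_num

/-- An odd element of `ℂ[u] / (u ^ (m + 1))` is `u` times an even element. -/
lemma exists_truncU_mul_eq {x : TruncPoly m} (hx : x = -negU m x) :
    ∃ g, x = truncU m * g ∧ negU m g = g := by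
  obtain ⟨P, rfl⟩ := exists_aeval_truncU x
  obtain ⟨Q, hQ⟩ : X ∣ P - P.comp (-X) := by
    rw [X_dvd_iff, coeff_zero_eq_eval_zero, eval_sub, eval_comp]
    simp
  have hQ' : Q.comp (-X) = Q := by
    have h := congrArg (fun p => p.comp (-X)) hQ
    simp only [sub_comp, mul_comp, X_comp, comp_assoc, neg_comp, neg_neg, comp_X] at h
    have h2 : X * (Q.comp (-X)) = X * Q := by linear_combination h + hQ
    exact mul_left_cancel₀ X_ne_zero h2
  have h1 : negU m (aeval (truncU m) P) = aeval (truncU m) (P.comp (-X)) := by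
    rw [negU_aeval, negU_truncU, aeval_comp, map_neg, aeval_X]
  have h2 : aeval (truncU m) P - aeval (truncU m) (P.comp (-X)) =
      truncU m * aeval (truncU m) Q := by
    rw [← map_sub, hQ, map_mul, aeval_X]
  have h3 : negU m (aeval (truncU m) Q) = aeval (truncU m) Q := by
    conv_rhs => rw [← hQ']
    rw [negU_aeval, negU_truncU, aeval_comp, map_neg, aeval_X]
  refine ⟨aeval (truncU m) (C (1 / 2) * Q), ?_, ?_⟩
  · rw [map_mul, mul_left_comm, ← h2, ← h1, sub_eq_add_neg, ← hx, ← two_mul, ← mul_assoc]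
    rw [aeval_half_mul_two, one_mul]
  · rw [map_mul, map_mul, h3]
    rw [aeval_C, AlgHom.commutes]

/-- Every matrix in `Lbar ε m` on the diagonal `k` has the form of the image of `tᵏ f(D) D`, with
the values `f(u - j)` replaced by a sequence `g j` with the symmetry of such values. The column
`j = 0`, where the factor `u - j` is not invertible, is recovered from its mirror image if `k ≠ 0`,
and from the oddness of the central entry if `k = 0`. -/
lemma exists_jets {A : glInf (TruncPoly m)} (hA : A ∈ Lbar ε m) (k : ℤ) :
    ∃ g : ℤ → TruncPoly m, (∀ j, matEntry A.1 (j - k) j = imageFactor m (j - k) j * g j) ∧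
      ∀ j, g j = zsign ε k * negU m (g (k - j)) := by
  have hg : ∀ j, ∃ g : TruncPoly m, j ≠ 0 →
      matEntry A.1 (j - k) j = imageFactor m (j - k) j * g := fun j => by
    by_cases hj : j = 0
    · exact ⟨0, fun h => (h hj).elim⟩
    · obtain ⟨c, hc⟩ := (isUnit_imageFactor (m := m) (j - k) hj).exists_right_inv
      exact ⟨c * matEntry A.1 (j - k) j, fun _ => by rw [← mul_assoc, hc, one_mul]⟩
  choose g hg using hg
  have hrefl : ∀ j, j ≠ k → matEntry A.1 (j - k) j =
      imageFactor m (j - k) j * (zsign ε k * negU m (g (k - j))) := fun j hjk => by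
    have h1 := hg (k - j) (by omega)
    have e1 : k - j - k = -j := by omega
    have e2 : k - j = -(j - k) := by omega
    have h2 := matEntry_of_reflect hA (i := j - k) (by omega) j (g := g (k - j))
      (by rw [e1] at h1; rw [← e2]; exact h1)
    have e3 : j - (j - k) = k := by omega
    rw [e3] at h2
    exact h2
  have hsymm : ∀ j, j ≠ 0 → j ≠ k → g j = zsign ε k * negU m (g (k - j)) := fun j hj hjk =>
    (isUnit_imageFactor (j - k) hj).mul_left_cancel ((hg j hj).symm.trans (hrefl j hjk))
  obtain ⟨g₀, h₀, h₀'⟩ : ∃ g₀ : TruncPoly m,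
      matEntry A.1 (0 - k) 0 = imageFactor m (0 - k) 0 * g₀ ∧
      (if k = 0 then negU m g₀ = g₀ else g₀ = zsign ε k * negU m (g k)) := by
    by_cases hk : k = 0
    · subst hk
      have h1 := hA.1 0 0 (Or.inr ⟨rfl, rfl⟩)
      rw [add_zero, zpow_zero, one_smul, neg_zero] at h1
      obtain ⟨g₀, h2, h3⟩ := exists_truncU_mul_eq h1
      refine ⟨g₀, ?_, by rw [if_pos rfl]; exact h3⟩
      rw [imageFactor, sub_zero, tau_self, Units.val_one, one_mul, Int.cast_zero, sub_zero]
      exact h2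
    · refine ⟨zsign ε k * negU m (g k), ?_, by rw [if_neg hk]⟩
      have h1 := hrefl 0 (Ne.symm hk)
      rwa [sub_zero] at h1
  have hz := zsign_mul_self (R := TruncPoly m) ε k
  refine ⟨fun j => if j = 0 then g₀ else g j, fun j => ?_, fun j => ?_⟩ <;> beta_reduce
  · by_cases hj : j = 0
    · subst hj
      rw [if_pos rfl]
      exact h₀
    · rw [if_neg hj]
      exact hg j hj
  · by_cases hj : j = 0
    · subst hj
      rw [if_pos rfl, sub_zero]
      by_cases hk : k = 0
      · subst hk
        rw [if_pos rfl] at h₀'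
        rw [if_pos rfl, h₀', zsign_zero, one_mul]
      · rw [if_neg hk] at h₀' ⊢
        exact h₀'
    · rw [if_neg hj]
      by_cases hjk : j = k
      · subst hjk
        rw [if_neg hj] at h₀'
        rw [sub_self, if_pos rfl, h₀', map_mul, negU_negU, negU_zsign, ← mul_assoc, hz, one_mul]
      · rw [if_neg (by omega)]
        exact hsymm j hj hjk

/-- Hermite interpolation at the points `-j`, by the Chinese remainder theorem. -/
lemma exists_aeval_eq (g : ℤ → TruncPoly m) (S : Finset ℤ) :
    ∃ F : ℂ[X], ∀ j ∈ S, aeval (truncU m - (j : TruncPoly m)) F = g j := by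
  choose G hG using fun j => exists_aeval_truncU (g j)
  have hcop : Pairwise (Function.onFun IsCoprime fun j : S =>
      Ideal.span {(X + C ((j : ℤ) : ℂ)) ^ (m + 1)}) := by
    intro i j hij
    rw [Function.onFun, Ideal.isCoprime_span_singleton_iff]
    refine IsCoprime.pow ?_
    have := isCoprime_X_sub_C_of_isUnit_sub (R := ℂ) (a := -((i : ℤ) : ℂ)) (b := -((j : ℤ) : ℂ))
      (IsUnit.mk0 _ (by
        rw [sub_neg_eq_add, neg_add_eq_sub]
        exact sub_ne_zero.mpr fun h => hij (Subtype.ext (by exact_mod_cast h.symm))))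
    simpa using this
  obtain ⟨F, hF⟩ := Ideal.exists_forall_sub_mem_ideal hcop
    fun j : S => (G j).comp (X + C ((j : ℤ) : ℂ))
  refine ⟨F, fun j hj => ?_⟩
  obtain ⟨q, hq⟩ := Ideal.mem_span_singleton'.mp (hF ⟨j, hj⟩)
  have h1 := congrArg (aeval (truncU m - (j : TruncPoly m))) hq
  have h2 : aeval (truncU m - (j : TruncPoly m)) (X + C (j : ℂ)) = truncU m := by simp
  rw [map_mul, map_pow, h2, truncU_pow, mul_zero, map_sub, aeval_comp, h2, hG] at h1
  exact (sub_eq_zero.mp h1.symm)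

/-- Averaging an interpolating polynomial over the involution `f(w) ↦ (±1)ᵏ f(-w - k)` makes it
symmetric and preserves the interpolated values, as these have the same symmetry. -/
lemma exists_symmetric_aeval_eq {k : ℤ} {g : ℤ → TruncPoly m}
    (hg : ∀ j, g j = zsign ε k * negU m (g (k - j))) (N : ℤ) :
    ∃ f : ℂ[X], (ε ^ k) • f.comp (-X - C (k : ℂ)) = f ∧
      ∀ j, |j| ≤ N → aeval (truncU m - (j : TruncPoly m)) f = g j := by
  obtain ⟨F, hF⟩ := exists_aeval_eq g (Finset.Icc (-(N + |k|)) (N + |k|))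
  have hs : ∀ q : ℂ[X], (ε ^ k) • q = zsign ε k * q := fun q => zsign_smul ε k q
  have hz := zsign_mul_self (R := ℂ[X]) ε k
  have hz' := zsign_mul_self (R := TruncPoly m) ε k
  have hzc : (zsign ε k : ℂ[X]).comp (-X - C (k : ℂ)) = zsign ε k := by simp [zsign]
  have hF2 : (F.comp (-X - C (k : ℂ))).comp (-X - C (k : ℂ)) = F := by
    rw [comp_assoc]
    simp
  refine ⟨C (1 / 2) * (F + zsign ε k * F.comp (-X - C (k : ℂ))), ?_, fun j hj => ?_⟩
  · rw [hs, mul_comp, add_comp, mul_comp, hzc, hF2, C_comp]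
    linear_combination C (1 / 2) * F * hz
  · have h1 : aeval (truncU m - (j : TruncPoly m)) F = g j := hF j <| by
      rw [Finset.mem_Icc]
      have := abs_nonneg k
      rw [abs_le] at hj
      omega
    have h2 : aeval (truncU m - ((k - j : ℤ) : TruncPoly m)) F = g (k - j) := hF (k - j) <| by
      rw [Finset.mem_Icc]
      have := neg_le_abs k
      have := le_abs_self k
      rw [abs_le] at hj
      omega
    have h3 : aeval (truncU m - (j : TruncPoly m)) (F.comp (-X - C (k : ℂ))) =
        negU m (g (k - j)) := by
      rw [← h2, negU_aeval, aeval_comp]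
      congr 2
      simp [negU_truncU]
      ring
    have h4 : aeval (truncU m - (j : TruncPoly m)) (zsign ε k : ℂ[X]) = zsign ε k := by
      simp [zsign]
    rw [map_mul, map_add, map_mul, h1, h3, h4, ← hg j, ← two_mul, ← mul_assoc]
    rw [aeval_half_mul_two, one_mul]

lemma entryL_phiHatL (x : DxHat ε) (i j : ℤ) : entryL ε m i j (phiHatL ε m x) =
    (tau m i j : TruncPoly m) *
      aeval (truncU m - (j : TruncPoly m)) (DiffOp.coeff (j - i) x.1.op) := by
  change matEntry (twist m (phi (truncU m) x.1.op)).1 i j = _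
  rw [matEntry_twist, matEntry_phi]

lemma centFun_phiHatL (x : DxHat ε) : centFun ε m (phiHatL ε m x) =
    alpha (truncU m) (DiffOp.coeff 0 x.1.op) + algebraMap ℂ (TruncPoly m) x.1.cent := rfl

lemma entryL_sub_add_centHat (x y : LHat ε m) (z : TruncPoly m) (i j : ℤ) :
    entryL ε m i j (x - (y + centHat ε m z)) = entryL ε m i j x - entryL ε m i j y := by
  rw [map_sub (entryL ε m i j) x, map_add (entryL ε m i j) y]
  exact congrArg _ (add_zero _)

lemma centFun_sub_add_centHat (x y : LHat ε m) (z : TruncPoly m) :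
    centFun ε m (x - (y + centHat ε m z)) = centFun ε m x - centFun ε m y - z := by
  rw [map_sub (centFun ε m) x, map_add (centFun ε m) y]
  exact (sub_sub _ _ _).symm

/-- Up to a central element and a matrix supported far away, every homogeneous element of
`L_±^[m]` is the image of an element of `D̂_x^±`. -/
theorem exists_isFar_sub_phiHatL {k : ℤ} {x : LHat ε m} (hx : x ∈ LGrade ε m k) (N : ℤ) :
    ∃ (d : DxHat ε) (z : TruncPoly m), IsFar k N (x - (phiHatL ε m d + centHat ε m z)) := by
  obtain ⟨g, hg, hg'⟩ := exists_jets x.2 k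
  obtain ⟨f, hf, hf'⟩ := exists_symmetric_aeval_eq hg' N
  let d : DxHat ε := ⟨DiffOpHat.mk (DiffOp.mono k (f * X)) 0, mono_mem_Dx hf⟩
  have hd : ∀ i j, entryL ε m i j (phiHatL ε m d) =
      (tau m i j : TruncPoly m) * aeval (truncU m - (j : TruncPoly m))
        (if k = j - i then f * X else 0) := fun i j =>
    (entryL_phiHatL d i j).trans (by rw [← DiffOp.coeff_mono]; rfl)
  refine ⟨d, centFun ε m x - centFun ε m (phiHatL ε m d), ?_, fun i j hij => ?_, fun i j hj => ?_⟩
  · exact (centFun_sub_add_centHat _ _ _).trans (sub_self _)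
  · refine (entryL_sub_add_centHat _ _ _ i j).trans ?_
    refine (congrArg₂ (· - ·) (hx.1 i j hij) (hd i j)).trans ?_
    rw [if_neg (Ne.symm hij), map_zero, mul_zero, sub_zero]
  · refine (entryL_sub_add_centHat _ _ _ i j).trans (sub_eq_zero.mpr ?_)
    refine Eq.trans ?_ (hd i j).symm
    by_cases hij : k = j - i
    · obtain rfl : i = j - k := by omega
      rw [if_pos hij, map_mul, aeval_X, hf' j hj]
      refine (hg j).trans ?_
      rw [imageFactor, mul_assoc, mul_comm (g j)]
    · rw [if_neg hij, map_zero, mul_zero]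
      exact hx.1 i j (Ne.symm hij)

end Interpolation

/-! ### The gradation of the algebra of differential operators -/

section DxGradation

variable {ε : ℤˣ} {m : ℕ}

lemma mem_DxGrade {k : ℤ} {x : DxHat ε} : x ∈ DxGrade ε k ↔
    (∀ l, l ≠ k → DiffOp.coeff l x.1.op = 0) ∧ (k ≠ 0 → x.1.cent = 0) := Iff.rfl

lemma DxHat_ext {x y : DxHat ε} (h : x.1.op = y.1.op) (h' : x.1.cent = y.1.cent) : x = y := by
  obtain ⟨⟨F, c⟩, hx⟩ := x
  obtain ⟨⟨G, d⟩, hy⟩ := y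
  obtain rfl : F = G := h
  obtain rfl : c = d := h'
  rfl

lemma op_eq_mono {k : ℤ} {x : DxHat ε} (hx : x ∈ DxGrade ε k) :
    x.1.op = DiffOp.mono k (DiffOp.coeff k x.1.op) := by
  refine DiffOp.ext fun l => ?_
  rw [DiffOp.coeff_mono]
  split_ifs with h
  · rw [h]
  · exact hx.1 l (Ne.symm h)

lemma lie_mem_DxGrade (i j : ℤ) (x : DxHat ε) (hx : x ∈ DxGrade ε i) (y : DxHat ε)
    (hy : y ∈ DxGrade ε j) : ⁅x, y⁆ ∈ DxGrade ε (i + j) := by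
  have e : (⁅x, y⁆ : DxHat ε).1 = DiffOpHat.mk ⁅x.1.op, y.1.op⁆ (psi x.1.op y.1.op) :=
    DiffOpHat.lie_def x.1 y.1
  refine mem_DxGrade.mpr ⟨fun l hl => ?_, fun h => ?_⟩
  · rw [e]
    change DiffOp.coeff l ⁅x.1.op, y.1.op⁆ = 0
    rw [op_eq_mono hx, op_eq_mono hy, DiffOp.lie_mono_mono, DiffOp.coeff_mono, if_neg (Ne.symm hl)]
  · rw [e]
    change psi x.1.op y.1.op = 0
    rw [op_eq_mono hx, op_eq_mono hy, psi_mono, if_neg h]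

/-- The element `F` of `D̂_x^±` for `F ∈ Dx ε`. -/
def opHat (ε : ℤˣ) : Dx ε →ₗ[ℂ] DxHat ε where
  toFun F := ⟨DiffOpHat.mk F.1 0, F.2⟩
  map_add' _ _ := DxHat_ext rfl (add_zero (0 : ℂ)).symm
  map_smul' c _ := DxHat_ext rfl (smul_zero c).symm

lemma iSup_DxGrade : ⨆ k, DxGrade ε k = ⊤ := by
  refine eq_top_iff.mpr fun x _ => ?_
  have h : ∀ F : DiffOp, F ∈ Dx ε → ∃ hF : F ∈ Dx ε, opHat ε ⟨F, hF⟩ ∈ ⨆ k, DxGrade ε k := by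
    intro F hF
    refine Dx_induction (p := fun F => ∃ hF : F ∈ Dx ε, opHat ε ⟨F, hF⟩ ∈ ⨆ k, DxGrade ε k) hF
      ⟨zero_mem _, ?_⟩ ?_ ?_
    · exact (map_zero (opHat ε)).symm ▸ zero_mem _
    · rintro F G ⟨hF, hF'⟩ ⟨hG, hG'⟩
      exact ⟨add_mem hF hG, (map_add (opHat ε) ⟨F, hF⟩ ⟨G, hG⟩).symm ▸ add_mem hF' hG'⟩
    · intro k f hf
      refine ⟨mono_mem_Dx hf, Submodule.mem_iSup_of_mem k (mem_DxGrade.mpr ⟨fun l hl => ?_,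
        fun _ => rfl⟩)⟩
      change DiffOp.coeff l (DiffOp.mono k (f * X)) = 0
      rw [DiffOp.coeff_mono, if_neg (Ne.symm hl)]
  obtain ⟨hF, hF'⟩ := h x.1.op x.2
  have hx : x = opHat ε ⟨x.1.op, hF⟩ + x.1.cent • (centD ε : DxHat ε) := by
    refine DxHat_ext ?_ ?_
    · change x.1.op = x.1.op + x.1.cent • (0 : DiffOp)
      rw [smul_zero, add_zero]
    · change x.1.cent = 0 + x.1.cent * 1
      ring
  rw [hx]
  exact add_mem hF' (Submodule.mem_iSup_of_mem 0 (Submodule.smul_mem _ _ (centD ε).2))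

lemma phiHatL_mem {k : ℤ} {x : DxHat ε} (hx : x ∈ DxGrade ε k) :
    phiHatL ε m x ∈ LGrade ε m k := by
  refine mem_LGrade.mpr ⟨fun i j hij => ?_, fun hk => ?_⟩
  · rw [entryL_phiHatL, hx.1 _ hij, map_zero, mul_zero]
  · rw [centFun_phiHatL, hx.1 0 (Ne.symm hk), hx.2 hk, map_zero, map_zero, add_zero]

/-- The restriction of `phiHatL` to the components of degree zero. -/
def phiHatL₀ (ε : ℤˣ) (m : ℕ) : DxGrade ε 0 →ₗ[ℂ] LGrade ε m 0 :=
  (phiHatL ε m : DxHat ε →ₗ[ℂ] LHat ε m).restrict fun _ hx => phiHatL_mem hx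

variable (ε m) in
/-- The image of `D` in `L_±^[m]`. -/
def imageD : LHat ε m := phiHatL ε m (powD ε 0 Even.zero)

lemma imageD_mem : imageD ε m ∈ LGrade ε m 0 := phiHatL_mem (powD ε 0 Even.zero).2

lemma entryL_imageD (i j : ℤ) : entryL ε m i j (imageD ε m) =
    if i = j then truncU m - (j : TruncPoly m) else 0 := by
  refine (entryL_phiHatL _ i j).trans ?_
  change _ * aeval _ (DiffOp.coeff (j - i) (DiffOp.mono 0 (X ^ 0 * X))) = _
  rw [DiffOp.coeff_mono]
  by_cases h : i = j
  · subst h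
    rw [if_pos (sub_self i).symm, if_pos rfl, tau_self, pow_zero, one_mul, aeval_X, Units.val_one,
      one_mul]
  · rw [if_neg (by omega), if_neg h, map_zero, mul_zero]

lemma truncU_sub_sub_mul (i j : ℤ) (x : TruncPoly m) :
    (truncU m - (i : TruncPoly m) - (truncU m - (j : TruncPoly m))) * x = ((j - i : ℤ) : ℂ) • x := by
  rw [Algebra.smul_def, map_intCast]
  push_cast
  ring

/-- The adjoint action of `D` on `L_±^[m]` is the derivation given by the gradation. -/
lemma imageD_lie {k : ℤ} {x : LHat ε m} (hx : x ∈ LGrade ε m k) :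
    ⁅imageD ε m, x⁆ = (k : ℂ) • x := by
  have h : ∀ i j, i ≠ j → entryL ε m i j (imageD ε m) = 0 := fun i j hij =>
    (entryL_imageD i j).trans (if_neg hij)
  refine LHat_ext' (fun i j => ?_) ?_
  · refine (entryL_diag_lie h x i j).trans ((?_ : _ = (k : ℂ) • entryL ε m i j x).trans
      (map_smul (entryL ε m i j) _ x).symm)
    rw [entryL_imageD, entryL_imageD, if_pos (Eq.refl i), if_pos (Eq.refl j), truncU_sub_sub_mul]
    by_cases hij : j - i = k
    · rw [hij]
    · rw [show entryL ε m i j x = 0 from hx.1 i j hij, smul_zero, smul_zero]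
  · refine (centFun_diag_lie h x).trans (Eq.trans ?_ (map_smul (centFun ε m) _ x).symm)
    by_cases hk : k = 0
    · rw [hk, Int.cast_zero, zero_smul]
    · rw [show centFun ε m x = 0 from hx.2 hk, smul_zero]

end DxGradation

/-! ### Restriction of irreducible modules to the algebra of differential operators -/

section Restriction

lemma aeval_apply_of_eq_smul {V : Type*} [AddCommGroup V] [Module ℂ V] {T : Module.End ℂ V} {a : ℂ}
    {w : V} (h : T w = a • w) (p : ℂ[X]) : aeval T p w = p.eval a • w := by
  induction p using Polynomial.induction_on with
  | C c => rw [aeval_C, Module.algebraMap_end_apply, eval_C]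
  | add p q hp hq => rw [map_add, LinearMap.add_apply, hp, hq, eval_add, add_smul]
  | monomial n c ih =>
    have e : C c * X ^ (n + 1) = C c * X ^ n * X := by ring
    rw [e, map_mul, aeval_X, Module.End.mul_apply, h, map_smul, ih, eval_mul (p := C c * X ^ n),
      eval_X, smul_smul, mul_comm a]

lemma aeval_apply_mem {V : Type*} [AddCommGroup V] [Module ℂ V] {T : Module.End ℂ V}
    {N : Submodule ℂ V} (hN : ∀ w ∈ N, T w ∈ N) (p : ℂ[X]) : ∀ w ∈ N, aeval T p w ∈ N := by
  induction p using Polynomial.induction_on with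
  | C c =>
    intro w hw
    rw [aeval_C, Module.algebraMap_end_apply]
    exact N.smul_mem c hw
  | add p q hp hq =>
    intro w hw
    rw [map_add, LinearMap.add_apply]
    exact add_mem (hp w hw) (hq w hw)
  | monomial n c ih =>
    intro w hw
    have e : C c * X ^ (n + 1) = C c * X ^ n * X := by ring
    rw [e, map_mul, aeval_X, Module.End.mul_apply]
    exact ih _ (hN w hw)

/-- A subspace stable under an operator acting on the components of a gradation by distinct
scalars contains the components of its elements. -/
lemma component_mem_of_eigenvalues {V : Type*} [AddCommGroup V] [Module ℂ V] {T : Module.End ℂ V}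
    {N : Submodule ℂ V} (hN : ∀ w ∈ N, T w ∈ N) {a : ℤ → ℂ} (ha : Function.Injective a)
    (f : ℤ →₀ V) (hf : ∀ n, T (f n) = a n • f n) (hsum : (f.sum fun _ w => w) ∈ N) (n : ℤ) :
    f n ∈ N := by
  by_cases hn : n ∈ f.support
  · have h := aeval_apply_mem hN (Lagrange.basis f.support a n) _ hsum
    rw [Finsupp.sum, map_sum, Finset.sum_eq_single_of_mem n hn fun k hk hkn => by
      rw [aeval_apply_of_eq_smul (hf k), Lagrange.eval_basis_of_ne (Ne.symm hkn) hk, zero_smul],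
      aeval_apply_of_eq_smul (hf n), Lagrange.eval_basis_self ha.injOn hn, one_smul] at h
    exact h
  · rw [Finsupp.notMem_support_iff.mp hn]
    exact zero_mem N

/-- A central element with an eigenvector acts by a scalar on an irreducible module: the eigenspace
is a submodule. No countability of the dimension is needed, unlike in Schur's lemma. -/
lemma lie_eq_smul_of_central {𝔤 V : Type*} [LieRing 𝔤] [LieAlgebra ℂ 𝔤] [AddCommGroup V]
    [Module ℂ V] [LieRingModule 𝔤 V] [LieModule ℂ 𝔤 V] [LieModule.IsIrreducible ℂ 𝔤 V] {z : 𝔤}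
    (hz : ∀ x : 𝔤, ⁅z, x⁆ = 0) {a : ℂ} {v : V} (hv : v ≠ 0) (hva : ⁅z, v⁆ = a • v) (w : V) :
    ⁅z, w⁆ = a • w := by
  let A : Submodule ℂ V := LinearMap.ker (LieModule.toEnd ℂ 𝔤 V z - a • LinearMap.id)
  have hA : ∀ w, w ∈ A ↔ ⁅z, w⁆ = a • w := fun w => by
    simp [A, sub_eq_zero]
  rw [← hA]
  have h : A = ⊤ := (eq_bot_or_eq_top_of_lie_mem (𝔤 := 𝔤) A fun x w hw => by
    rw [hA] at hw ⊢
    rw [leibniz_lie, hz, zero_lie, zero_add, hw, lie_smul]).resolve_left fun h => by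
      have h1 : v ∈ A := (hA v).mpr hva
      rw [h] at h1
      exact hv h1
  rw [h]
  exact Submodule.mem_top

/-- If the bracket with `D` multiplies the elements of degree `k` by `k`, then `D` acts on the
component of degree `n` of a highest weight module by its value on the highest weight vector
plus `n`. -/
lemma IsIrreducibleHighestWeight.lie_eq_smul_of_derivation {𝔤 V : Type*} [LieRing 𝔤]
    [LieAlgebra ℂ 𝔤] {𝒢 : ℤ → Submodule ℂ 𝔤} [AddCommGroup V] [Module ℂ V] [LieRingModule 𝔤 V]
    [LieModule ℂ 𝔤 V] {𝒱 : ℤ → Submodule ℂ V} {v : V} {lam : 𝒢 0 →ₗ[ℂ] ℂ}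
    (hV : IsIrreducibleHighestWeight 𝒢 𝒱 v lam) (h𝒢 : ⨆ k, 𝒢 k = ⊤) {D : 𝔤}
    (hD : ∀ k, ∀ x ∈ 𝒢 k, ⁅D, x⁆ = (k : ℂ) • x) {a : ℂ} (ha : ⁅D, v⁆ = a • v) (n : ℤ) :
    ∀ w ∈ 𝒱 n, ⁅D, w⁆ = (a + n) • w := by
  have := hV.irreducible
  let E : ℤ → Submodule ℂ V := fun n => 𝒱 n ⊓ LinearMap.ker
    (LieModule.toEnd ℂ 𝔤 V D - (a + n) • LinearMap.id)
  have hE : ∀ n w, w ∈ E n ↔ w ∈ 𝒱 n ∧ ⁅D, w⁆ = (a + n) • w := fun n w => by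
    simp [E, sub_eq_zero]
  have h : ⨆ n, E n = ⊤ := by
    refine (eq_bot_or_eq_top_of_lie_mem (𝔤 := 𝔤) _ fun x w hw => ?_).resolve_left fun h => ?_
    · refine mem_of_homogeneous h𝒢
        ((LieModule.toEnd ℂ 𝔤 V : 𝔤 →ₗ[ℂ] Module.End ℂ V).flip w) _ (fun k x hx => ?_) x
      have h1 : ⨆ n, E n ≤ (⨆ n, E n).comap (LieModule.toEnd ℂ 𝔤 V x) := by
        refine iSup_le fun n w hw => Submodule.mem_iSup_of_mem (k + n) ?_
        rw [hE] at hw ⊢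
        refine ⟨hV.lie_mem k n x hx w hw.1, ?_⟩
        rw [LieModule.toEnd_apply_apply, leibniz_lie, hD k x hx, hw.2, smul_lie, lie_smul,
          ← add_smul]
        congr 1
        push_cast
        ring
      exact h1 hw
    · have h1 : v ∈ ⨆ n, E n := Submodule.mem_iSup_of_mem 0 <| by
        rw [hE, Int.cast_zero, add_zero]
        exact ⟨hV.mem_zero, ha⟩
      rw [h] at h1
      exact hV.ne_zero h1
  intro w hw
  have h1 : w ∈ ⨆ n, E n := h ▸ Submodule.mem_top
  rw [iSup_split_single _ n] at h1
  obtain ⟨a, ha, b, hb, rfl⟩ := Submodule.mem_sup.mp h1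
  have hb' : b ∈ ⨆ k, ⨆ (_ : k ≠ n), 𝒱 k :=
    (iSup₂_mono fun k _ => (inf_le_left : E k ≤ 𝒱 k)) hb
  have hb0 : b = 0 := Submodule.disjoint_def.mp (hV.isInternal.submodule_iSupIndep n) b
    (((𝒱 n).add_mem_iff_right ((hE n a).mp ha).1).mp hw) hb'
  rw [hb0, add_zero]
  exact ((hE n a).mp ha).2

variable {ε : ℤˣ} {m : ℕ} {lam : LGrade ε m 0 →ₗ[ℂ] ℂ} {V : Type*} [AddCommGroup V] [Module ℂ V]
  [LieRingModule (LHat ε m) V] [LieModule ℂ (LHat ε m) V] {𝒱 : ℤ → Submodule ℂ V} {v₀ : V}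

lemma centHat_lie (hV : IsIrreducibleHighestWeight (LGrade ε m) 𝒱 v₀ lam) (z : TruncPoly m)
    (w : V) : ⁅centHat ε m z, w⁆ = lam ⟨centHat ε m z, centHat_mem z⟩ • w := by
  have := hV.irreducible
  exact lie_eq_smul_of_central (lie_centHat z) hV.ne_zero
    (hV.weight ⟨centHat ε m z, centHat_mem z⟩) w

/-- The operator `D` acts on the component of degree `n` by its value on the highest weight vector
plus `n`. -/
lemma imageD_lie_of_mem (hV : IsIrreducibleHighestWeight (LGrade ε m) 𝒱 v₀ lam) (n : ℤ) :
    ∀ w ∈ 𝒱 n, ⁅imageD ε m, w⁆ = (lam ⟨imageD ε m, imageD_mem⟩ + n) • w :=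
  hV.lie_eq_smul_of_derivation iSup_LGrade (fun _ _ hx => imageD_lie hx)
    (hV.weight ⟨imageD ε m, imageD_mem⟩) n

/-- The restriction of a quasifinite irreducible highest weight module to the image of the algebra
of differential operators remains irreducible. -/
theorem eq_bot_or_eq_top_of_phiHatL_mem
    (hV : IsIrreducibleHighestWeight (LGrade ε m) 𝒱 v₀ lam) (hfin : IsQuasifinite 𝒱)
    (N : Submodule ℂ V) (hN : ∀ (d : DxHat ε), ∀ w ∈ N, ⁅phiHatL ε m d, w⁆ ∈ N) :
    N = ⊥ ∨ N = ⊤ := by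
  have := hV.irreducible
  refine eq_bot_or_eq_top_of_lie_mem (𝔤 := LHat ε m) N fun x w hw => ?_
  obtain ⟨f, hf, hsum⟩ := (Submodule.mem_iSup_iff_exists_finsupp _ _).mp
    (hV.isInternal.submodule_iSup_eq_top ▸ Submodule.mem_top : w ∈ ⨆ n, 𝒱 n)
  have hcomp : ∀ n, f n ∈ N := by
    refine component_mem_of_eigenvalues (T := LieModule.toEnd ℂ (LHat ε m) V (imageD ε m))
      (fun w hw => hN _ w hw)
      (a := fun n => lam ⟨imageD ε m, imageD_mem⟩ + n) (fun n n' h => ?_) f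
      (fun n => imageD_lie_of_mem hV n _ (hf n)) (hsum.symm ▸ hw)
    exact_mod_cast add_left_cancel h
  refine mem_of_homogeneous iSup_LGrade
    ((LieModule.toEnd ℂ (LHat ε m) V : LHat ε m →ₗ[ℂ] Module.End ℂ V).flip w) N
    (fun k x hx => ?_) x
  change ⁅x, w⁆ ∈ N
  rw [← hsum, Finsupp.sum, lie_sum]
  refine sum_mem fun n _ => ?_
  obtain ⟨M, hM⟩ := exists_far_lie_eq_zero hV.lie_mem hfin k n
  obtain ⟨d, z, hd⟩ := exists_isFar_sub_phiHatL hx M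
  have h1 := hM _ hd (f n) (hf n)
  rw [sub_lie, add_lie, sub_eq_zero] at h1
  rw [h1, centHat_lie hV]
  exact add_mem (hN d _ (hcomp n)) (N.smul_mem _ (hcomp n))

/-- The restricted module is a highest weight module with respect to the same gradation, and the
highest weight is the composition with `phiHatL`. -/
theorem exists_isIrreducibleHighestWeight_pullback
    (hV : IsIrreducibleHighestWeight (LGrade ε m) 𝒱 v₀ lam) (hfin : IsQuasifinite 𝒱) :
    ∃ (𝒲 : ℤ → Submodule ℂ (Pullback (phiHatL ε m) V)) (w : Pullback (phiHatL ε m) V),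
      IsIrreducibleHighestWeight (DxGrade ε) 𝒲 w (lam ∘ₗ phiHatL₀ ε m) ∧ IsQuasifinite 𝒲 := by
  have hirr : ∀ N : LieSubmodule ℂ (DxHat ε) (Pullback (phiHatL ε m) V), N = ⊥ ∨ N = ⊤ := by
    intro N
    rcases eq_bot_or_eq_top_of_phiHatL_mem hV hfin (N : Submodule ℂ (Pullback (phiHatL ε m) V))
      (fun d w hw => N.lie_mem hw) with h | h
    · left
      exact LieSubmodule.toSubmodule_injective h
    · right
      exact LieSubmodule.toSubmodule_injective h
  have hspan : ∀ w : Pullback (phiHatL ε m) V, w ≠ 0 →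
      LieSubmodule.lieSpan ℂ (DxHat ε) {w} = ⊤ := fun w hw =>
    (hirr _).resolve_left fun h => hw <| by
      have h1 : w ∈ LieSubmodule.lieSpan ℂ (DxHat ε) {w} := LieSubmodule.subset_lieSpan rfl
      rw [h] at h1
      exact h1
  have hnt : Nontrivial (Pullback (phiHatL ε m) V) := ⟨⟨v₀, 0, hV.ne_zero⟩⟩
  refine ⟨𝒱, v₀, ?_, hfin⟩
  exact
    { isInternal := hV.isInternal
      lie_mem := fun i j x hx w hw => hV.lie_mem i j _ (phiHatL_mem hx) w hw
      mem_zero := hV.mem_zero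
      ne_zero := hV.ne_zero
      weight := fun h => hV.weight (phiHatL₀ ε m h)
      lie_pos := fun i hi x hx => hV.lie_pos i hi _ (phiHatL_mem hx)
      generates := hspan v₀ hV.ne_zero
      irreducible :=
        { toNontrivial := (LieSubmodule.nontrivial_iff ℂ (DxHat ε) _).mpr hnt
          eq_bot_or_eq_top := hirr } }

end Restriction

/-! ### Exponents and multiplicities determine the highest weight -/

section Determination

lemma coeff_expS (a : ℂ) (n : ℕ) :
    PowerSeries.coeff n (expS a) = a ^ n / (n.factorial : ℂ) := by
  rw [expS, PowerSeries.coeff_rescale, PowerSeries.coeff_exp]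
  simp [div_eq_mul_inv]

lemma expS_mul (a b : ℂ) : expS a * expS b = expS (a + b) :=
  PowerSeries.exp_mul_exp_eq_exp_add a b

lemma expS_zero : expS 0 = 1 := by
  ext n
  rw [coeff_expS, PowerSeries.coeff_one]
  rcases n with _ | n <;> simp

lemma constantCoeff_coshS (a : ℂ) : PowerSeries.constantCoeff (coshS a) = 1 := by
  rw [coshS, ← PowerSeries.coeff_zero_eq_constantCoeff_apply, PowerSeries.coeff_C_mul, map_add,
    coeff_expS, coeff_expS]
  norm_num

lemma sinhS_half_ne_zero : PowerSeries.C (2 : ℂ) * sinhS (1 / 2) ≠ 0 := by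
  intro h
  have := congrArg (PowerSeries.coeff 1) h
  rw [sinhS, PowerSeries.coeff_C_mul, PowerSeries.coeff_C_mul, map_sub, coeff_expS, coeff_expS,
    map_zero] at this
  norm_num at this

variable {ε : ℤˣ}

/-- The differential operator underlying an element of degree zero. -/
def opDx (ε : ℤˣ) : DxGrade ε 0 →ₗ[ℂ] DiffOp where
  toFun y := (y : DxHat ε).1.op
  map_add' _ _ := rfl
  map_smul' _ _ := rfl

/-- The central component of an element of degree zero. -/
def centDx (ε : ℤˣ) : DxGrade ε 0 →ₗ[ℂ] ℂ where
  toFun y := (y : DxHat ε).1.cent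
  map_add' _ _ := rfl
  map_smul' _ _ := rfl

lemma DxGrade_ext {x y : DxGrade ε 0} (h : opDx ε x = opDx ε y) (h' : centDx ε x = centDx ε y) :
    x = y := Subtype.ext (DxHat_ext h h')

/-- The component of degree zero is spanned by the odd powers of `D` and the central element. -/
lemma exists_eq_sum_powD (x : DxGrade ε 0) : ∃ (S : Finset ℕ) (hS : ∀ l ∈ S, Even l) (f : ℂ[X]),
    x = (∑ l ∈ S.attach, f.coeff l • powD ε l (hS l l.2)) + centDx ε x • centD ε := by
  obtain ⟨f, hf, hf'⟩ := mem_Dx_iff.mp x.1.2 0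
  have hodd : ∀ l ∈ f.support, Even l := by
    intro l hl
    by_contra ho
    have h1 : f.comp (-X) = f := by simpa using hf'
    have h2 := congrArg (fun p => p.coeff l) h1
    rw [show (-X : ℂ[X]) = C (-1) * X by simp, comp_C_mul_X_coeff,
      (Nat.not_even_iff_odd.mp ho).neg_one_pow] at h2
    refine mem_support_iff.mp hl ?_
    linear_combination (-1 / 2 : ℂ) * h2
  refine ⟨f.support, hodd, f, DxGrade_ext ?_ ?_⟩
  · have hx : opDx ε x = DiffOp.mono 0 (f * X) := by
      refine (op_eq_mono x.2).trans ?_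
      rw [hf]
    have hc : opDx ε (centD ε) = 0 := rfl
    have hp : ∀ l : f.support, opDx ε (powD ε l (hodd l l.2)) = DiffOp.mono 0 (X ^ (l : ℕ) * X) :=
      fun l => rfl
    rw [map_add, map_smul, hc, smul_zero, add_zero, map_sum, hx]
    simp_rw [map_smul, hp]
    rw [Finset.sum_attach f.support fun l => f.coeff l • DiffOp.mono 0 (X ^ l * X)]
    simp_rw [← map_smul, ← map_sum, ← smul_mul_assoc, ← Finset.sum_mul]
    congr 2
    conv_lhs => rw [f.as_sum_support_C_mul_X_pow]
    simp_rw [smul_eq_C_mul]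
  · have hc : centDx ε (centD ε) = 1 := rfl
    have hp : ∀ l : f.support, centDx ε (powD ε l (hodd l l.2)) = 0 := fun l => rfl
    rw [map_add, map_smul, hc, map_sum]
    simp_rw [map_smul, hp]
    simp

/-- The central charge is the constant coefficient of the expansion, and the generating series of
the labels is obtained by dividing by `2 sinh(x/2)` and differentiating. -/
lemma HasExponents.unique {lam lam' : DxGrade ε 0 →ₗ[ℂ] ℂ} {eP eM : ℂ →₀ ℂ[X]}
    (h : HasExponents lam eP eM) (h' : HasExponents lam' eP eM) : lam = lam' := by
  obtain ⟨φ, Γ, h1, h2, h3, h4⟩ := h.expansion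
  obtain ⟨φ', Γ', h1', h2', h3', h4'⟩ := h'.expansion
  rw [← h4'] at h4
  have hc : lam (centD ε) = lam' (centD ε) := by
    have := congrArg PowerSeries.constantCoeff h4
    simpa [constantCoeff_coshS, h1, h1'] using this
  rw [hc, add_left_inj] at h4
  rw [← h2, ← h2'] at h4
  have hΔ : DeltaSeries lam = DeltaSeries lam' := by
    rw [← h3, ← h3', mul_left_cancel₀ sinhS_half_ne_zero h4]
  have hp : ∀ l (hl : Even l), lam (powD ε l hl) = lam' (powD ε l hl) := by
    intro l hl
    have := congrArg (PowerSeries.coeff l) hΔ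
    rw [DeltaSeries, DeltaSeries, PowerSeries.coeff_mk, PowerSeries.coeff_mk, dif_pos hl,
      dif_pos hl, div_left_inj' (Nat.cast_ne_zero.mpr l.factorial_ne_zero), neg_inj] at this
    exact this
  refine LinearMap.ext fun x => ?_
  obtain ⟨S, hS, f, hx⟩ := exists_eq_sum_powD x
  rw [hx]
  simp only [map_add, map_sum, map_smul, hc, hp]

end Determination

/-! ### Generating series of functionals -/

section Series

/-- The substitution `x ↦ -x` of formal power series. -/
def reflectS : PowerSeries ℂ →+* PowerSeries ℂ := PowerSeries.rescale (-1)

lemma coeff_reflectS (F : PowerSeries ℂ) (n : ℕ) :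
    PowerSeries.coeff n (reflectS F) = (-1) ^ n * PowerSeries.coeff n F :=
  PowerSeries.coeff_rescale F (-1) n

lemma reflectS_reflectS (F : PowerSeries ℂ) : reflectS (reflectS F) = F := by
  ext n
  rw [coeff_reflectS, coeff_reflectS, ← mul_assoc, ← mul_pow]
  simp

lemma reflectS_expS (a : ℂ) : reflectS (expS a) = expS (-a) := by
  ext n
  rw [coeff_reflectS, coeff_expS, coeff_expS, neg_pow a, mul_div_assoc]

lemma reflectS_C (a : ℂ) : reflectS (PowerSeries.C a) = PowerSeries.C a := by
  ext n
  rw [coeff_reflectS, PowerSeries.coeff_C]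
  split_ifs with h
  · simp [h]
  · simp

/-- The generating series `∑ₚ ℓ(sᵖ) xᵖ / p!`, that is, `ℓ(e^{sx})`. -/
def genSeries {S : Type*} [CommRing S] [Algebra ℂ S] (l : S →ₗ[ℂ] ℂ) (s : S) : PowerSeries ℂ :=
  PowerSeries.mk fun p => l (s ^ p) / (p.factorial : ℂ)

lemma coeff_genSeries {S : Type*} [CommRing S] [Algebra ℂ S] (l : S →ₗ[ℂ] ℂ) (s : S) (p : ℕ) :
    PowerSeries.coeff p (genSeries l s) = l (s ^ p) / (p.factorial : ℂ) :=
  PowerSeries.coeff_mk _ _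

lemma genSeries_add_algebraMap {S : Type*} [CommRing S] [Algebra ℂ S] (l : S →ₗ[ℂ] ℂ) (s : S)
    (a : ℂ) : genSeries l (s + algebraMap ℂ S a) = expS a * genSeries l s := by
  ext p
  rw [coeff_genSeries, PowerSeries.coeff_mul, add_comm s, (Commute.all _ _).add_pow', map_sum,
    Finset.sum_div]
  refine Finset.sum_congr rfl fun q hq => ?_
  obtain rfl : q.1 + q.2 = p := Finset.HasAntidiagonal.mem_antidiagonal.mp hq
  rw [← map_pow, ← Algebra.smul_def, map_nsmul, map_smul, coeff_expS, coeff_genSeries]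
  have h := Nat.choose_mul_factorial_mul_factorial (Nat.le_add_right q.1 q.2)
  rw [Nat.add_sub_cancel_left] at h
  have h' : ((q.1 + q.2).choose q.1 : ℂ) * (q.1.factorial : ℂ) * (q.2.factorial : ℂ) =
      ((q.1 + q.2).factorial : ℂ) := by exact_mod_cast h
  have h1 : (q.1.factorial : ℂ) ≠ 0 := Nat.cast_ne_zero.mpr (Nat.factorial_ne_zero _)
  have h2 : (q.2.factorial : ℂ) ≠ 0 := Nat.cast_ne_zero.mpr (Nat.factorial_ne_zero _)
  rw [← h']
  have h3 : ((q.1 + q.2).choose q.1 : ℂ) ≠ 0 :=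
    Nat.cast_ne_zero.mpr (Nat.choose_pos (Nat.le_add_right _ _)).ne'
  rw [nsmul_eq_mul, smul_eq_mul]
  field_simp

lemma coeff_expS_mul_genSeries {S : Type*} [CommRing S] [Algebra ℂ S] (l : S →ₗ[ℂ] ℂ) (s : S)
    (a : ℂ) (p : ℕ) : PowerSeries.coeff p (expS a * genSeries l s) =
      l ((s + algebraMap ℂ S a) ^ p) / (p.factorial : ℂ) := by
  rw [← genSeries_add_algebraMap, coeff_genSeries]

lemma reflectS_genSeries {S : Type*} [CommRing S] [Algebra ℂ S] {l : S →ₗ[ℂ] ℂ} {s : S}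
    (f : S →ₐ[ℂ] S) (hs : f s = -s) (hl : ∀ a, l (f a) = -l a) :
    reflectS (genSeries l s) = -genSeries l s := by
  ext i
  have h := hl (s ^ i)
  rw [map_pow, hs, neg_pow, ← map_one (algebraMap ℂ S), ← map_neg, ← map_pow, ← Algebra.smul_def,
    map_smul, smul_eq_mul] at h
  rw [coeff_reflectS, map_neg, coeff_genSeries, ← mul_div_assoc, h, neg_div]

/-- The functional `α` has generating series `-(e^{zx} - 1) / (e^x - 1)`. -/
lemma expS_one_sub_one_mul_genSeries_alpha {S : Type*} [CommRing S] [Algebra ℂ S] (l : S →ₗ[ℂ] ℂ)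
    (z : S) : (expS 1 - 1) * genSeries (l ∘ₗ alpha z) X =
      PowerSeries.C (l 1) - genSeries l z := by
  rw [sub_mul, one_mul, ← genSeries_add_algebraMap]
  ext p
  rw [map_sub, map_sub, coeff_genSeries, coeff_genSeries, coeff_genSeries, PowerSeries.coeff_C,
    ← sub_div, LinearMap.comp_apply, LinearMap.comp_apply, ← map_sub]
  have h := alpha_comp z (X ^ p : ℂ[X])
  rw [pow_comp, X_comp, map_pow (aeval z), aeval_X, eval_pow, eval_X] at h
  rw [show (algebraMap ℂ ℂ[X]) 1 = C 1 from rfl, h, map_neg, map_sub, neg_sub, sub_div]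
  congr 1
  rcases p with _ | p
  · simp
  · simp

/-- Even and odd parts of a series as multiplicities of an exponent give the even part of its
product with the exponential. -/
lemma mul_coshS_add_mul_sinhS {P Q H : PowerSeries ℂ} (a : ℂ)
    (hP : P = PowerSeries.C (1 / 2) * (H + reflectS H))
    (hQ : Q = PowerSeries.C (1 / 2) * (H - reflectS H)) :
    P * coshS a + Q * sinhS a =
      PowerSeries.C (1 / 2) * (H * expS a + reflectS (H * expS a)) := by
  have h : PowerSeries.C (1 / 2 : ℂ) * 2 = 1 := by
    rw [show (2 : PowerSeries ℂ) = PowerSeries.C 2 from (map_ofNat _ 2).symm, ← map_mul]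
    norm_num
  rw [hP, hQ, coshS, sinhS, map_mul, reflectS_expS]
  linear_combination (PowerSeries.C (1 / 2 : ℂ) * (H * expS a + reflectS H * expS (-a))) * h

/-- Summation by parts: the combined generating series of the labels determines the expansion of
`2 sinh(x/2) Γ + c cosh(x/2)`, where `Γ` is minus the odd part of
`Λ₀ / 2 + ∑_{j > 0} e^{-jx} Λⱼ + A`. -/
lemma expansion_identity {Λ : ℕ → PowerSeries ℂ} {A c' G : PowerSeries ℂ} {c : ℂ} {N : ℕ}
    (hΛ : Λ (N + 1) = 0) (h0 : reflectS (Λ 0) = -Λ 0)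
    (hA : (expS 1 - 1) * A = PowerSeries.C c - c')
    (hG : G = PowerSeries.C (1 / 2) * Λ 0 +
      ∑ j ∈ Finset.range N, expS (-((j : ℂ) + 1)) * Λ (j + 1) + A) :
    PowerSeries.C 2 * sinhS (1 / 2) * (PowerSeries.C (-1 / 2) * (G - reflectS G)) +
        PowerSeries.C c * coshS (1 / 2) =
      ∑ j ∈ Finset.range (N + 1), PowerSeries.C (1 / 2) *
        ((Λ j - Λ (j + 1) + if j = 0 then c' else 0) * expS (-(j : ℂ) - 1 / 2) +
          reflectS ((Λ j - Λ (j + 1) + if j = 0 then c' else 0) * expS (-(j : ℂ) - 1 / 2))) := by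
  set t := expS (1 / 2) with ht
  set t' := expS (-(1 / 2)) with ht'
  have htt : t * t' = 1 := by rw [ht, ht', expS_mul, add_neg_cancel, expS_zero]
  have ht2 : t * t = expS 1 := by rw [ht, expS_mul]; norm_num
  have h2 : PowerSeries.C (1 / 2 : ℂ) * 2 = 1 := by
    rw [show (2 : PowerSeries ℂ) = PowerSeries.C 2 from (map_ofNat _ 2).symm, ← map_mul]
    norm_num
  have hm : PowerSeries.C (-1 / 2 : ℂ) = -PowerSeries.C (1 / 2) := by
    rw [← map_neg]; norm_num
  have hC2 : PowerSeries.C (2 : ℂ) = 2 := map_ofNat _ 2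
  have hσt : reflectS t = t' := reflectS_expS _
  have hσt' : reflectS t' = t := by rw [← hσt, reflectS_reflectS]
  set B := ∑ j ∈ Finset.range N, expS (-((j : ℂ) + 1)) * Λ (j + 1) with hB
  have hK : ∑ j ∈ Finset.range (N + 1), (Λ j - Λ (j + 1) + if j = 0 then c' else 0) *
      expS (-(j : ℂ) - 1 / 2) = Λ 0 * t' - (t - t') * B + c' * t' := by
    have e1 : ∑ j ∈ Finset.range (N + 1), Λ j * expS (-(j : ℂ) - 1 / 2) = Λ 0 * t' + t' * B := by
      rw [Finset.sum_range_succ', add_comm, hB, Finset.mul_sum]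
      congr 1
      · rw [ht']; norm_num
      · refine Finset.sum_congr rfl fun j _ => ?_
        rw [← mul_assoc, ht', expS_mul, mul_comm]
        congr 2
        push_cast
        ring
    have e2 : ∑ j ∈ Finset.range (N + 1), Λ (j + 1) * expS (-(j : ℂ) - 1 / 2) = t * B := by
      rw [Finset.sum_range_succ, hΛ, zero_mul, add_zero, hB, Finset.mul_sum]
      refine Finset.sum_congr rfl fun j _ => ?_
      rw [← mul_assoc, ht, expS_mul, mul_comm]
      congr 2
      ring
    have e3 : ∑ j ∈ Finset.range (N + 1), (if j = 0 then c' else 0) * expS (-(j : ℂ) - 1 / 2) =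
        c' * t' := by
      rw [Finset.sum_eq_single 0]
      · rw [if_pos rfl, ht']; norm_num
      · intro j _ hj
        rw [if_neg hj, zero_mul]
      · intro h
        exact absurd (Finset.mem_range.mpr (Nat.succ_pos N)) h
    simp_rw [add_mul, sub_mul]
    rw [Finset.sum_add_distrib, Finset.sum_sub_distrib, e1, e2, e3]
    ring
  rw [← Finset.mul_sum, Finset.sum_add_distrib, ← map_sum, hK]
  have hA' := congrArg reflectS hA
  have hσ1 : reflectS (expS 1) = t' * t' := by rw [← ht2, map_mul, hσt]
  rw [map_mul, map_sub, map_sub, map_one, hσ1, reflectS_C] at hA'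
  rw [← ht2] at hA
  have hGσ := congrArg reflectS hG
  rw [map_add, map_add, map_mul, reflectS_C, h0] at hGσ
  rw [map_add, map_sub, map_mul, map_mul, map_mul, map_sub, hσt, hσt', h0, hGσ, hG, sinhS, coshS,
    ← ht, ← ht', hm, hC2]
  generalize reflectS A = A' at *
  generalize reflectS B = B' at *
  generalize reflectS c' = d at *
  generalize PowerSeries.C (1 / 2 : ℂ) = k at *
  generalize PowerSeries.C c = e at *
  linear_combination (-k * t') * hA - (k * t) * hA' + (k * t * A + k * t' * A') * htt -
    k * (t - t') * ((k * 2 + 1) * Λ 0 + B - B' + A - A') * h2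

end Series

/-! ### The exponents of the pulled back highest weight -/

section Multiplicities

/-- The sum of the terms of `∑ᵢ hᵢ xⁱ / i!`, `i ≤ m`, with index `i` satisfying `p`. -/
def partialGen (m : ℕ) (p : ℕ → Prop) [DecidablePred p] (h : ℕ → ℂ) : ℂ[X] :=
  ∑ i ∈ (Finset.range (m + 1)).filter p, monomial i (h i / (i.factorial : ℂ))

variable {m : ℕ} {h : ℕ → ℂ}

lemma coeff_partialGen (p : ℕ → Prop) [DecidablePred p] (hm : ∀ i, m < i → h i = 0) (i : ℕ) :
    (partialGen m p h).coeff i = if p i then h i / (i.factorial : ℂ) else 0 := by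
  rw [partialGen, finsetSum_coeff]
  simp_rw [coeff_monomial]
  rw [Finset.sum_ite_eq']
  by_cases hi : i < m + 1
  · simp [hi]
  · simp [hm i (by omega)]

lemma partialGen_even_comp : (partialGen m Even h).comp (-X) = partialGen m Even h := by
  rw [partialGen, Polynomial.sum_comp]
  refine Finset.sum_congr rfl fun i hi => ?_
  rw [monomial_comp, (Finset.mem_filter.mp hi).2.neg_pow, C_mul_X_pow_eq_monomial]

lemma partialGen_odd_comp : (partialGen m Odd h).comp (-X) = -partialGen m Odd h := by
  rw [partialGen, Polynomial.sum_comp, ← Finset.sum_neg_distrib]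
  refine Finset.sum_congr rfl fun i hi => ?_
  rw [monomial_comp, (Finset.mem_filter.mp hi).2.neg_pow, mul_neg, C_mul_X_pow_eq_monomial]

lemma coe_partialGen_even (hm : ∀ i, m < i → h i = 0) {H : PowerSeries ℂ}
    (hH : ∀ i, PowerSeries.coeff i H = h i / (i.factorial : ℂ)) :
    (partialGen m Even h : PowerSeries ℂ) = PowerSeries.C (1 / 2) * (H + reflectS H) := by
  ext i
  rw [Polynomial.coeff_coe, coeff_partialGen _ hm, PowerSeries.coeff_C_mul, map_add,
    coeff_reflectS, hH]
  split_ifs with hi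
  · rw [hi.neg_one_pow]; ring
  · rw [(Nat.not_even_iff_odd.mp hi).neg_one_pow]; ring

lemma coe_partialGen_odd (hm : ∀ i, m < i → h i = 0) {H : PowerSeries ℂ}
    (hH : ∀ i, PowerSeries.coeff i H = h i / (i.factorial : ℂ)) :
    (partialGen m Odd h : PowerSeries ℂ) = PowerSeries.C (1 / 2) * (H - reflectS H) := by
  ext i
  rw [Polynomial.coeff_coe, coeff_partialGen _ hm, PowerSeries.coeff_C_mul, map_sub,
    coeff_reflectS, hH]
  split_ifs with hi
  · rw [hi.neg_one_pow]; ring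
  · rw [(Nat.not_odd_iff_even.mp hi).neg_one_pow]; ring

/-- The family of polynomials `P j` attached to the exponents `-j - 1/2`, `j ≤ N`. -/
def halfIntegerFamily (N : ℕ) (P : ℕ → ℂ[X]) : ℂ →₀ ℂ[X] :=
  ∑ j ∈ Finset.range (N + 1), Finsupp.single (-(j : ℂ) - 1 / 2) (P j)

lemma halfIntegerFamily_apply {N : ℕ} {P : ℕ → ℂ[X]} (hP : ∀ j, N < j → P j = 0) (j : ℕ) :
    halfIntegerFamily N P (-(j : ℂ) - 1 / 2) = P j := by
  classical
  rw [halfIntegerFamily, Finsupp.finsetSum_apply]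
  simp_rw [Finsupp.single_apply, sub_left_inj, neg_inj, Nat.cast_inj]
  rw [Finset.sum_ite_eq']
  split_ifs with hj
  · rfl
  · exact (hP j (by simpa using hj)).symm

lemma halfIntegerFamily_apply_of_ne {N : ℕ} {P : ℕ → ℂ[X]} {e : ℂ}
    (he : ∀ j : ℕ, e ≠ -(j : ℂ) - 1 / 2) : halfIntegerFamily N P e = 0 := by
  classical
  rw [halfIntegerFamily, Finsupp.finsetSum_apply]
  exact Finset.sum_eq_zero fun j _ => by rw [Finsupp.single_apply, if_neg (he j).symm]

lemma halfIntegerFamily_comp {N : ℕ} {P : ℕ → ℂ[X]} (hP : ∀ j, N < j → P j = 0) {s : ℤˣ}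
    (h : ∀ j, (P j).comp (-X) = s • P j) (e : ℂ) :
    (halfIntegerFamily N P e).comp (-X) = s • halfIntegerFamily N P e := by
  by_cases he : ∃ j : ℕ, e = -(j : ℂ) - 1 / 2
  · obtain ⟨j, rfl⟩ := he
    rw [halfIntegerFamily_apply hP, h]
  · rw [halfIntegerFamily_apply_of_ne (fun j hj => he ⟨j, hj⟩), zero_comp, smul_zero]

/-- The exponents `-j - 1/2` lie on one side of the origin. -/
lemma neg_notMem_support_halfIntegerFamily {N : ℕ} {P : ℕ → ℂ[X]} {e : ℂ}
    (he : e ∈ (halfIntegerFamily N P).support) : -e ∉ (halfIntegerFamily N P).support := by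
  have key : ∀ a : ℂ, a ∈ (halfIntegerFamily N P).support → ∃ j : ℕ, a = -(j : ℂ) - 1 / 2 := by
    intro a ha
    by_contra hj
    exact Finsupp.mem_support_iff.mp ha
      (halfIntegerFamily_apply_of_ne fun j h => hj ⟨j, h⟩)
  intro he'
  obtain ⟨i, hi⟩ := key e he
  obtain ⟨j, hj⟩ := key (-e) he'
  have h1 : ((i : ℂ) + j + 1) = 0 := by linear_combination hi + hj
  exact Nat.succ_ne_zero (i + j) (by exact_mod_cast h1)

lemma sum_halfIntegerFamily (N : ℕ) (P : ℕ → ℂ[X]) (F : ℂ → PowerSeries ℂ) :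
    ((halfIntegerFamily N P).sum fun e q => (q : PowerSeries ℂ) * F e) =
      ∑ j ∈ Finset.range (N + 1), (P j : PowerSeries ℂ) * F (-(j : ℂ) - 1 / 2) := by
  rw [halfIntegerFamily, ← Finsupp.sum_finsetSum_index (by simp) (by simp [add_mul])]
  refine Finset.sum_congr rfl fun j _ => ?_
  rw [Finsupp.sum_single_index (by simp)]

end Multiplicities

section Pullback

variable {ε : ℤˣ} {m : ℕ}

/-- The element `a E i i - a(-u) E (-i) (-i)` of degree zero, as a linear function of `a`. -/
def diagLin (ε : ℤˣ) (m : ℕ) (i : ℤ) : TruncPoly m →ₗ[ℂ] LGrade ε m 0 where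
  toFun a := ⟨matHat (diagMat m i a) (diagMat_mem_Lbar ε m i a), mem_LGrade.mpr
    ⟨fun k l hkl => by
      rw [entryL_matHat, matEntry_diagMat, if_neg (by omega), if_neg (by omega), sub_zero],
      fun h => (h rfl).elim⟩⟩
  map_add' a b := Subtype.ext <| LHat_ext' (fun k l => by
      refine Eq.trans ?_ (map_add (entryL ε m k l) (matHat _ (diagMat_mem_Lbar ε m i a))
        (matHat _ (diagMat_mem_Lbar ε m i b))).symm
      rw [entryL_matHat, entryL_matHat, entryL_matHat, matEntry_diagMat, matEntry_diagMat,
        matEntry_diagMat, map_add]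
      split_ifs <;> ring) (add_zero (0 : TruncPoly m)).symm
  map_smul' c a := Subtype.ext <| LHat_ext' (fun k l => by
      refine Eq.trans ?_ (map_smul (entryL ε m k l) c
        (matHat _ (diagMat_mem_Lbar ε m i a))).symm
      rw [entryL_matHat, entryL_matHat, matEntry_diagMat, matEntry_diagMat, map_smul, smul_sub,
        smul_ite, smul_ite, smul_zero]) (smul_zero c).symm

lemma entryL_diagLin (i k l : ℤ) (a : TruncPoly m) : entryL ε m k l (diagLin ε m i a) =
    (if k = i ∧ l = i then a else 0) - if k = -i ∧ l = -i then negU m a else 0 :=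
  matEntry_diagMat m i a k l

lemma centFun_diagLin (i : ℤ) (a : TruncPoly m) : centFun ε m (diagLin ε m i a) = 0 := rfl

/-- The central elements as a linear map into the component of degree zero. -/
def centLin (ε : ℤˣ) (m : ℕ) : TruncPoly m →ₗ[ℂ] LGrade ε m 0 :=
  (centHat ε m).codRestrict (LGrade ε m 0) centHat_mem

lemma diagLin_zero_negU (a : TruncPoly m) : diagLin ε m 0 (negU m a) = -diagLin ε m 0 a := by
  refine Subtype.ext (LHat_ext' (fun k l => ?_) (neg_zero (G := TruncPoly m)).symm)
  refine Eq.trans ?_ (map_neg (entryL ε m k l) (diagLin ε m 0 a : LHat ε m)).symm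
  rw [entryL_diagLin, entryL_diagLin, neg_zero, negU_negU]
  ring

/-- A diagonal element is far as soon as its entries at the places `0 ≤ i ≤ N` vanish. -/
lemma isFar_of_nonneg {N : ℤ} {x : LHat ε m} (hc : centFun ε m x = 0)
    (hx : ∀ i j, i ≠ j → entryL ε m i j x = 0)
    (h : ∀ i, 0 ≤ i → i ≤ N → entryL ε m i i x = 0) : IsFar 0 N x := by
  refine ⟨hc, fun i j hij => hx i j fun h => hij (by omega), fun i j hj => ?_⟩
  by_cases hij : i = j
  · subst hij
    obtain ⟨h1, h2⟩ := abs_le.mp hj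
    rcases le_or_gt 0 i with hi | hi
    · exact h i hi h2
    · have h3 := x.2.1 i i (Or.inl (mul_pos_of_neg_of_neg hi hi))
      change entryL ε m i i x = -(_ • negU m (entryL ε m (-i) (-i) x)) at h3
      rw [h3, h (-i) (by omega) (by omega), map_zero, smul_zero, neg_zero]
  · exact hx i j hij

lemma diagLin_offDiag (i k l : ℤ) (hkl : k ≠ l) (a : TruncPoly m) :
    entryL ε m k l (diagLin ε m i a) = 0 := by
  rw [entryL_diagLin, if_neg (by omega), if_neg (by omega), sub_zero]

lemma entryL_diagLin_self {i : ℤ} (hi : 0 < i) {k : ℤ} (hk : 0 ≤ k) (a : TruncPoly m) :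
    entryL ε m k k (diagLin ε m i a) = if k = i then a else 0 := by
  rw [entryL_diagLin, if_neg (show ¬ (k = -i ∧ k = -i) by omega), sub_zero]
  simp only [and_self]

lemma isFar_diagLin {N i : ℤ} (hN : 0 ≤ N) (hi : N < i) (a : TruncPoly m) :
    IsFar 0 N (diagLin ε m i a : LHat ε m) :=
  isFar_of_nonneg (centFun_diagLin i a) (fun k l hkl => diagLin_offDiag i k l hkl a)
    fun k hk hkN => by rw [entryL_diagLin_self (hN.trans_lt hi) hk, if_neg (by omega)]

/-- The element of degree zero with diagonal entries `a j` at the places `0 ≤ j ≤ N`, zero entries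
at the places `j > N` and prescribed central component. The entry of `diagLin ε m 0 a` at the
origin is `a - a(-u)`, which accounts for the factor `1 / 2` if `a 0` is odd. -/
def boxDiag (ε : ℤˣ) (m N : ℕ) (a : ℕ → TruncPoly m) (z : TruncPoly m) : LGrade ε m 0 :=
  (1 / 2 : ℂ) • diagLin ε m 0 (a 0) +
    ∑ j ∈ Finset.range N, diagLin ε m ((j : ℤ) + 1) (a (j + 1)) + centLin ε m z

variable (ε m) in
/-- The matrix entry as a linear map on the component of degree zero. -/
def entryL₀ (i j : ℤ) : LGrade ε m 0 →ₗ[ℂ] TruncPoly m := entryL ε m i j ∘ₗ (LGrade ε m 0).subtype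

variable (ε m) in
/-- The central component as a linear map on the component of degree zero. -/
def centFun₀ : LGrade ε m 0 →ₗ[ℂ] TruncPoly m := centFun ε m ∘ₗ (LGrade ε m 0).subtype

lemma entryL₀_of_ne {i j : ℤ} (hij : i ≠ j) (x : LGrade ε m 0) : entryL₀ ε m i j x = 0 :=
  (mem_LGrade.mp x.2).1 i j (by omega)

lemma entryL₀_centLin (i j : ℤ) (z : TruncPoly m) : entryL₀ ε m i j (centLin ε m z) = 0 :=
  entryL_centHat (ε := ε) z i j

lemma entryL₀_diagLin (i k l : ℤ) (a : TruncPoly m) : entryL₀ ε m k l (diagLin ε m i a) =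
    (if k = i ∧ l = i then a else 0) - if k = -i ∧ l = -i then negU m a else 0 :=
  entryL_diagLin (ε := ε) i k l a

lemma entryL₀_diagLin_self {i : ℤ} (hi : 0 < i) {k : ℤ} (hk : 0 ≤ k) (a : TruncPoly m) :
    entryL₀ ε m k k (diagLin ε m i a) = if k = i then a else 0 :=
  entryL_diagLin_self (ε := ε) hi hk a

lemma eq_of_natCast {T : Type*} {N : ℕ} {f g : ℤ → T} (h : ∀ k : ℕ, k ≤ N → f k = g k) (i : ℤ)
    (hi : 0 ≤ i) (hiN : i ≤ N) : f i = g i := by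
  obtain ⟨k, rfl⟩ := Int.eq_ofNat_of_zero_le hi
  exact h k (by omega)

lemma map_smul_add_sum_add {M T : Type*} [AddCommGroup M] [Module ℂ M] [AddCommGroup T]
    [Module ℂ T] (E : M →ₗ[ℂ] T) (c : ℂ) (d z : M) (N : ℕ) (f : ℕ → M) :
    E (c • d + ∑ j ∈ Finset.range N, f j + z) =
      c • E d + ∑ j ∈ Finset.range N, E (f j) + E z := by
  rw [map_add, map_add, map_smul, map_sum]

lemma map_sub_eq_zero {M T : Type*} [AddCommGroup M] [Module ℂ M] [AddCommGroup T]
    [Module ℂ T] (E : M →ₗ[ℂ] T) {x y : M} (h : E x = E y) : E (x - y) = 0 := by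
  rw [map_sub, h, sub_self]

lemma map_boxDiag {T : Type*} [AddCommGroup T] [Module ℂ T] (E : LGrade ε m 0 →ₗ[ℂ] T) (N : ℕ)
    (a : ℕ → TruncPoly m) (z : TruncPoly m) : E (boxDiag ε m N a z) =
      (1 / 2 : ℂ) • E (diagLin ε m 0 (a 0)) +
        ∑ j ∈ Finset.range N, E (diagLin ε m ((j : ℤ) + 1) (a (j + 1))) + E (centLin ε m z) :=
  map_smul_add_sum_add E _ _ _ _ _

lemma half_smul_sub_neg {R : Type*} [CommRing R] [Algebra ℂ R] (a : R) :
    (1 / 2 : ℂ) • (a - -a) = a := by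
  rw [sub_neg_eq_add, ← two_smul ℂ, smul_smul]
  norm_num

lemma half_smul_add_sum_add {T : Type*} [AddCommGroup T] [Module ℂ T] {N : ℕ} {s d c t : T}
    {f : ℕ → T} (hd : (1 / 2 : ℂ) • d = s) (hf : ∑ j ∈ Finset.range N, f j = t) :
    (1 / 2 : ℂ) • d + ∑ j ∈ Finset.range N, f j + c = s + t + c := by
  rw [hd, hf]

lemma entryL₀_boxDiag_zero {N : ℕ} {a : ℕ → TruncPoly m} (h0 : negU m (a 0) = -a 0)
    (z : TruncPoly m) : entryL₀ ε m 0 0 (boxDiag ε m N a z) = a 0 := by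
  have h1 : entryL₀ ε m 0 0 (diagLin ε m 0 (a 0)) = a 0 - -a 0 := by
    rw [entryL₀_diagLin, if_pos ⟨Eq.refl (0 : ℤ), Eq.refl (0 : ℤ)⟩,
      if_pos ⟨neg_zero.symm, neg_zero.symm⟩, h0]
  have h2 : ∀ j : ℕ, entryL₀ ε m 0 0 (diagLin ε m ((j : ℤ) + 1) (a (j + 1))) = 0 := fun j => by
    rw [entryL₀_diagLin_self (by omega) le_rfl, if_neg (by omega)]
  rw [map_boxDiag, half_smul_add_sum_add ((congrArg _ h1).trans (half_smul_sub_neg (a 0)))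
    (Finset.sum_eq_zero fun j _ => h2 j), entryL₀_centLin, add_zero, add_zero]

lemma entryL₀_boxDiag_of_pos {N : ℕ} (a : ℕ → TruncPoly m) (z : TruncPoly m) {k : ℕ} (hk : k < N) :
    entryL₀ ε m ((k : ℤ) + 1) ((k : ℤ) + 1) (boxDiag ε m N a z) = a (k + 1) := by
  have h1 : entryL₀ ε m ((k : ℤ) + 1) ((k : ℤ) + 1) (diagLin ε m 0 (a 0)) = 0 := by
    rw [entryL₀_diagLin, if_neg (by omega), if_neg (by omega), sub_zero]
  have h2 : ∀ j : ℕ, entryL₀ ε m ((k : ℤ) + 1) ((k : ℤ) + 1)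
      (diagLin ε m ((j : ℤ) + 1) (a (j + 1))) = if k = j then a (j + 1) else 0 := fun j => by
    rw [entryL₀_diagLin_self (by omega) (by omega)]
    exact if_congr (by omega) rfl rfl
  have h3 : ∑ j ∈ Finset.range N, entryL₀ ε m ((k : ℤ) + 1) ((k : ℤ) + 1)
      (diagLin ε m ((j : ℤ) + 1) (a (j + 1))) = a (k + 1) := by
    rw [Finset.sum_congr rfl fun j _ => h2 j, Finset.sum_ite_eq, if_pos (Finset.mem_range.mpr hk)]
  rw [map_boxDiag, half_smul_add_sum_add ((congrArg _ h1).trans (smul_zero _)) h3,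
    entryL₀_centLin, zero_add, add_zero]

lemma centFun₀_boxDiag {N : ℕ} (a : ℕ → TruncPoly m) (z : TruncPoly m) :
    centFun₀ ε m (boxDiag ε m N a z) = z := by
  have h1 : ∀ i b, centFun₀ ε m (diagLin ε m i b) = 0 := fun i b => centFun_diagLin (ε := ε) i b
  have h3 : centFun₀ ε m (centLin ε m z) = z := centFun_centHat (ε := ε) z
  rw [map_boxDiag, half_smul_add_sum_add ((congrArg _ (h1 0 _)).trans (smul_zero _))
    (Finset.sum_eq_zero fun j _ => h1 _ _), h3, zero_add, zero_add]

lemma isFar_of_nonneg₀ {N : ℤ} {x : LGrade ε m 0} (hc : centFun₀ ε m x = 0)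
    (h : ∀ i, 0 ≤ i → i ≤ N → entryL₀ ε m i i x = 0) : IsFar 0 N (x : LHat ε m) :=
  isFar_of_nonneg hc (fun _ _ hij => entryL₀_of_ne hij x) h

/-- A functional vanishing on the far elements only depends on finitely many diagonal entries and
on the central component. -/
lemma apply_eq_apply_boxDiag {lam : LGrade ε m 0 →ₗ[ℂ] ℂ} {N : ℕ}
    (hN : ∀ x : LGrade ε m 0, IsFar 0 N (x : LHat ε m) → lam x = 0) {x : LGrade ε m 0}
    {a : ℕ → TruncPoly m} (ha : ∀ j : ℕ, entryL₀ ε m j j x = a j) (h0 : negU m (a 0) = -a 0) :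
    lam x = lam (boxDiag ε m N a (centFun₀ ε m x)) := by
  have hd : ∀ k : ℕ, k ≤ N →
      entryL₀ ε m k k x = entryL₀ ε m k k (boxDiag ε m N a (centFun₀ ε m x)) := by
    intro k hk
    refine (ha k).trans ?_
    rcases k with _ | k
    · exact (entryL₀_boxDiag_zero h0 _).symm
    · exact (entryL₀_boxDiag_of_pos a _ (by omega)).symm
  have hfar : IsFar 0 N ((x - boxDiag ε m N a (centFun₀ ε m x) : LGrade ε m 0) : LHat ε m) := by
    refine isFar_of_nonneg₀ (map_sub_eq_zero (centFun₀ ε m) (centFun₀_boxDiag a _).symm) ?_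
    exact fun i hi hiN => map_sub_eq_zero (entryL₀ ε m i i) (eq_of_natCast (f := fun i =>
      entryL₀ ε m i i x) (g := fun i => entryL₀ ε m i i (boxDiag ε m N a (centFun₀ ε m x)))
      hd i hi hiN)
  exact sub_eq_zero.mp ((map_sub lam x _).symm.trans (hN _ hfar))

end Pullback

/-! ### Exponents of the restricted module -/

section Exponents

variable {ε : ℤˣ} {m : ℕ} {lam : LGrade ε m 0 →ₗ[ℂ] ℂ}

lemma truncU_pow_eq_zero {i : ℕ} (hi : m < i) : truncU m ^ i = 0 := by
  obtain ⟨k, rfl⟩ := Nat.exists_eq_add_of_le (Nat.succ_le_of_lt hi)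
  have h : truncU m ^ (m + 1) = 0 := by
    have := AdjoinRoot.eval₂_root (X ^ (m + 1) : ℂ[X])
    rwa [eval₂_X_pow] at this
  exact (pow_add (truncU m) (m + 1) k).trans ((congrArg (· * truncU m ^ k) h).trans (zero_mul _))

lemma entryL₀_powD (l : ℕ) (hl : Even l) (j : ℕ) :
    entryL₀ ε m j j (phiHatL₀ ε m (powD ε l hl)) =
      (truncU m + algebraMap ℂ (TruncPoly m) (-(j : ℂ))) ^ (l + 1) := by
  refine (entryL_phiHatL (powD ε l hl : DxHat ε) j j).trans ?_
  change _ * aeval _ (DiffOp.coeff (_ - _) (DiffOp.mono 0 (X ^ l * X))) = _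
  rw [DiffOp.coeff_mono, if_pos (sub_self (j : ℤ)).symm, tau_self, ← pow_succ, map_pow (aeval _),
    aeval_X, Units.val_one, one_mul, map_neg, map_natCast, Int.cast_natCast, sub_eq_add_neg]

lemma centFun₀_powD (l : ℕ) (hl : Even l) :
    centFun₀ ε m (phiHatL₀ ε m (powD ε l hl)) = alpha (truncU m) (X ^ (l + 1)) := by
  refine (centFun_phiHatL (powD ε l hl : DxHat ε)).trans ?_
  change alpha (truncU m) (DiffOp.coeff 0 (DiffOp.mono 0 (X ^ l * X))) + algebraMap ℂ _ 0 = _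
  rw [DiffOp.coeff_mono, if_pos (Eq.refl (0 : ℤ)), map_zero, add_zero, ← pow_succ]

lemma phiHatL₀_centD : phiHatL₀ ε m (centD ε) = centLin ε m 1 := by
  refine Subtype.ext (LHat_ext' (fun i j => ?_) ?_)
  · refine (entryL_phiHatL (centD ε : DxHat ε) i j).trans (Eq.trans ?_ (entryL_centHat 1 i j).symm)
    change _ * aeval _ (DiffOp.coeff (j - i) 0) = _
    rw [map_zero, map_zero, mul_zero]
  · refine (centFun_phiHatL (centD ε : DxHat ε)).trans (Eq.trans ?_ (centFun_centHat 1).symm)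
    change alpha (truncU m) (DiffOp.coeff 0 0) + algebraMap ℂ _ 1 = _
    rw [map_zero, map_zero, map_one, zero_add]

lemma negU_truncU_pow {l : ℕ} (hl : Even l) :
    negU m ((truncU m + algebraMap ℂ (TruncPoly m) (-((0 : ℕ) : ℂ))) ^ (l + 1)) =
      -(truncU m + algebraMap ℂ (TruncPoly m) (-((0 : ℕ) : ℂ))) ^ (l + 1) := by
  rw [Nat.cast_zero, neg_zero, map_zero, add_zero, map_pow, negU_truncU, hl.add_one.neg_pow]

/-- The highest weight of the restricted module on the odd powers of `D`. -/
lemma lam_phiHatL₀_powD {N : ℕ}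
    (hN : ∀ x : LGrade ε m 0, IsFar 0 N (x : LHat ε m) → lam x = 0) (l : ℕ) (hl : Even l) :
    lam (phiHatL₀ ε m (powD ε l hl)) =
      (1 / 2 : ℂ) • lam (diagLin ε m 0
          ((truncU m + algebraMap ℂ (TruncPoly m) (-((0 : ℕ) : ℂ))) ^ (l + 1))) +
        ∑ j ∈ Finset.range N, lam (diagLin ε m ((j : ℤ) + 1)
          ((truncU m + algebraMap ℂ (TruncPoly m) (-((j + 1 : ℕ) : ℂ))) ^ (l + 1))) +
        lam (centLin ε m (alpha (truncU m) (X ^ (l + 1)))) := by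
  refine (apply_eq_apply_boxDiag hN (entryL₀_powD l hl) (negU_truncU_pow hl)).trans ?_
  exact (congrArg (fun z => lam (boxDiag ε m N _ z)) (centFun₀_powD l hl)).trans
    (map_boxDiag lam N _ _)

/-- The generating series of the labels of `lam` at the place `j`. -/
def labelSeries (lam : LGrade ε m 0 →ₗ[ℂ] ℂ) (j : ℤ) : PowerSeries ℂ :=
  genSeries (lam ∘ₗ diagLin ε m j) (truncU m)

/-- The generating series of the central charges of `lam`. -/
def chargeSeries (lam : LGrade ε m 0 →ₗ[ℂ] ℂ) : PowerSeries ℂ :=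
  genSeries (lam ∘ₗ centLin ε m) (truncU m)

/-- The contribution of the functional `α` to the highest weight of the restricted module. -/
def alphaSeries (lam : LGrade ε m 0 →ₗ[ℂ] ℂ) : PowerSeries ℂ :=
  genSeries ((lam ∘ₗ centLin ε m) ∘ₗ alpha (truncU m)) X

lemma coeff_labelSeries (j : ℤ) (i : ℕ) :
    PowerSeries.coeff i (labelSeries lam j) = labelL lam j i / (i.factorial : ℂ) :=
  coeff_genSeries _ _ _

lemma coeff_chargeSeries (i : ℕ) :
    PowerSeries.coeff i (chargeSeries lam) = lam (centL ε m i) / (i.factorial : ℂ) :=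
  coeff_genSeries _ _ _

lemma reflectS_labelSeries_zero : reflectS (labelSeries lam 0) = -labelSeries lam 0 :=
  reflectS_genSeries (negU m) (negU_truncU m) fun a =>
    (congrArg lam (diagLin_zero_negU (ε := ε) a)).trans (map_neg lam _)

lemma labelL_eq_zero_of_far {N : ℕ}
    (hN : ∀ x : LGrade ε m 0, IsFar 0 N (x : LHat ε m) → lam x = 0) {j : ℤ} (hj : N < j) (i : ℕ) :
    labelL lam j i = 0 :=
  hN (diagLin ε m j (truncU m ^ i)) (isFar_diagLin (Int.natCast_nonneg N) hj _)

lemma labelL_eq_zero_of_lt (j : ℤ) {i : ℕ} (hi : m < i) : labelL lam j i = 0 :=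
  (congrArg (lam ∘ₗ diagLin ε m j) (truncU_pow_eq_zero hi)).trans (map_zero _)

lemma lam_centL_eq_zero_of_lt {i : ℕ} (hi : m < i) : lam (centL ε m i) = 0 :=
  (congrArg (lam ∘ₗ centLin ε m) (truncU_pow_eq_zero hi)).trans (map_zero _)

lemma labelH_eq_zero_of_lt (j : ℤ) {i : ℕ} (hi : m < i) : labelH lam j i = 0 := by
  rw [labelH, labelL_eq_zero_of_lt j hi, labelL_eq_zero_of_lt (j + 1) hi,
    lam_centL_eq_zero_of_lt hi, ite_self, sub_zero, add_zero]

lemma labelH_eq_zero_of_far {N : ℕ}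
    (hN : ∀ x : LGrade ε m 0, IsFar 0 N (x : LHat ε m) → lam x = 0) {j : ℤ} (hj : N < j) (i : ℕ) :
    labelH lam j i = 0 := by
  rw [labelH, labelL_eq_zero_of_far hN hj, labelL_eq_zero_of_far hN (by omega), if_neg (by omega),
    sub_zero, add_zero]

lemma coeff_half_add_sum_add_div {A B : PowerSeries ℂ} {f : ℕ → PowerSeries ℂ} {a b n : ℂ}
    {g : ℕ → ℂ} {N p : ℕ} (hA : PowerSeries.coeff p A = a / n)
    (hf : ∀ j, PowerSeries.coeff p (f j) = g j / n) (hB : PowerSeries.coeff p B = b / n) :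
    PowerSeries.coeff p (PowerSeries.C (1 / 2) * A + ∑ j ∈ Finset.range N, f j + B) =
      ((1 / 2 : ℂ) • a + ∑ j ∈ Finset.range N, g j + b) / n := by
  rw [map_add, map_add, map_sum, PowerSeries.coeff_C_mul, add_div, add_div, Finset.sum_div, hA, hB,
    Finset.sum_congr rfl fun j _ => hf j, smul_eq_mul, mul_div_assoc]

lemma derivative_odd_part_coeff {F : PowerSeries ℂ} {l : ℕ} {a : ℂ} (hl : Even l)
    (hF : PowerSeries.coeff (l + 1) F = a / ((l + 1).factorial : ℂ)) :
    PowerSeries.coeff l (PowerSeries.derivative ℂ (PowerSeries.C (-1 / 2) * (F - reflectS F))) =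
      -a / (l.factorial : ℂ) := by
  have h1 : (l.factorial : ℂ) ≠ 0 := Nat.cast_ne_zero.mpr l.factorial_ne_zero
  have h2 : (l : ℂ) + 1 ≠ 0 := Nat.cast_add_one_ne_zero l
  rw [PowerSeries.coeff_derivative, PowerSeries.coeff_C_mul, map_sub, coeff_reflectS, hF,
    hl.add_one.neg_one_pow, Nat.factorial_succ]
  push_cast
  field_simp
  ring

lemma derivative_odd_part_coeff_of_odd (F : PowerSeries ℂ) {l : ℕ} (hl : Odd l) :
    PowerSeries.coeff l (PowerSeries.derivative ℂ (PowerSeries.C (-1 / 2) * (F - reflectS F))) =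
      0 := by
  rw [PowerSeries.coeff_derivative, PowerSeries.coeff_C_mul, map_sub, coeff_reflectS,
    hl.add_one.neg_one_pow]
  ring

lemma sub_div_add_eq {x x' y y' z w n : ℂ} (hx : x = x' / n) (hy : y = y' / n) (hz : z = w / n) :
    x - y + z = (x' - y' + w) / n := by
  rw [hx, hy, hz, add_div, sub_div]

/-- Minus the odd part of this series is an antiderivative of `Δ`. -/
def weightSeries (lam : LGrade ε m 0 →ₗ[ℂ] ℂ) (N : ℕ) : PowerSeries ℂ :=
  PowerSeries.C (1 / 2) * labelSeries lam 0 +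
    ∑ j ∈ Finset.range N, expS (-((j : ℂ) + 1)) * labelSeries lam ((j : ℤ) + 1) + alphaSeries lam

lemma coeff_weightSeries {N : ℕ}
    (hN : ∀ x : LGrade ε m 0, IsFar 0 N (x : LHat ε m) → lam x = 0) (l : ℕ) (hl : Even l) :
    PowerSeries.coeff (l + 1) (weightSeries lam N) =
      lam (phiHatL₀ ε m (powD ε l hl)) / ((l + 1).factorial : ℂ) := by
  refine Eq.trans ?_ (congrArg (· / ((l + 1).factorial : ℂ)) (lam_phiHatL₀_powD hN l hl).symm)
  refine coeff_half_add_sum_add_div ?_ (fun j => ?_) ?_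
  · refine Eq.trans ?_ (coeff_expS_mul_genSeries (lam ∘ₗ diagLin ε m 0) (truncU m)
      (-((0 : ℕ) : ℂ)) (l + 1))
    rw [Nat.cast_zero, neg_zero, expS_zero, one_mul, labelSeries]
  · refine Eq.trans ?_ (coeff_expS_mul_genSeries (lam ∘ₗ diagLin ε m ((j : ℤ) + 1)) (truncU m)
      (-((j + 1 : ℕ) : ℂ)) (l + 1))
    rw [Nat.cast_succ, labelSeries]
  · exact coeff_genSeries _ _ _

lemma coeff_DeltaSeries_of_even (lam : DxGrade ε 0 →ₗ[ℂ] ℂ) {l : ℕ} (hl : Even l) :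
    PowerSeries.coeff l (DeltaSeries lam) = -lam (powD ε l hl) / (l.factorial : ℂ) := by
  rw [DeltaSeries, PowerSeries.coeff_mk, dif_pos hl]

lemma coeff_DeltaSeries_of_odd (lam : DxGrade ε 0 →ₗ[ℂ] ℂ) {l : ℕ} (hl : ¬ Even l) :
    PowerSeries.coeff l (DeltaSeries lam) = 0 := by
  rw [DeltaSeries, PowerSeries.coeff_mk, dif_neg hl]

lemma derivative_weightSeries {N : ℕ}
    (hN : ∀ x : LGrade ε m 0, IsFar 0 N (x : LHat ε m) → lam x = 0) :
    PowerSeries.derivative ℂ (PowerSeries.C (-1 / 2) *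
      (weightSeries lam N - reflectS (weightSeries lam N))) =
        DeltaSeries (lam ∘ₗ phiHatL₀ ε m) := by
  ext l
  by_cases hl : Even l
  · exact (derivative_odd_part_coeff hl (coeff_weightSeries hN l hl)).trans
      (coeff_DeltaSeries_of_even (lam ∘ₗ phiHatL₀ ε m) hl).symm
  · exact (derivative_odd_part_coeff_of_odd _ (Nat.not_even_iff_odd.mp hl)).trans
      (coeff_DeltaSeries_of_odd (lam ∘ₗ phiHatL₀ ε m) hl).symm

/-- The even multiplicity polynomials. -/
def evenFamily (lam : LGrade ε m 0 →ₗ[ℂ] ℂ) (N : ℕ) : ℂ →₀ ℂ[X] :=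
  halfIntegerFamily N fun j => partialGen m Even (labelH lam j)

/-- The odd multiplicity polynomials. -/
def oddFamily (lam : LGrade ε m 0 →ₗ[ℂ] ℂ) (N : ℕ) : ℂ →₀ ℂ[X] :=
  halfIntegerFamily N fun j => partialGen m Odd (labelH lam j)

lemma partialGen_eq_zero {h : ℕ → ℂ} (hh : ∀ i, h i = 0) (p : ℕ → Prop) [DecidablePred p] :
    partialGen m p h = 0 :=
  Finset.sum_eq_zero fun i _ => by rw [hh, zero_div, map_zero]

lemma partialGen_labelH_eq_zero {N : ℕ}
    (hN : ∀ x : LGrade ε m 0, IsFar 0 N (x : LHat ε m) → lam x = 0) (p : ℕ → Prop)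
    [DecidablePred p] (j : ℕ) (hj : N < j) : partialGen m p (labelH lam j) = 0 :=
  partialGen_eq_zero (fun i => labelH_eq_zero_of_far hN (by exact_mod_cast hj) i) p

lemma coeff_labelSeries_succ (j i : ℕ) :
    PowerSeries.coeff i (labelSeries lam ((j + 1 : ℕ) : ℤ)) =
      labelL lam ((j : ℤ) + 1) i / (i.factorial : ℂ) :=
  (coeff_labelSeries _ i).trans
    (congrArg (fun k => labelL lam k i / (i.factorial : ℂ)) (Nat.cast_succ j))

lemma coeff_charge_ite (j i : ℕ) :
    PowerSeries.coeff i (if j = 0 then chargeSeries lam else 0) =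
      (if (j : ℤ) = 0 then lam (centL ε m i) else 0) / (i.factorial : ℂ) := by
  rcases j with _ | j
  · exact coeff_chargeSeries i
  · rw [if_neg (Nat.succ_ne_zero j), if_neg (Nat.cast_ne_zero.mpr (Nat.succ_ne_zero j)), map_zero,
      zero_div]

lemma coeff_labelH_series (j i : ℕ) : PowerSeries.coeff i
    (labelSeries lam j - labelSeries lam ((j + 1 : ℕ) : ℤ) + if j = 0 then chargeSeries lam else 0) =
      labelH lam j i / (i.factorial : ℂ) := by
  rw [map_add, map_sub]
  exact sub_div_add_eq (coeff_labelSeries (lam := lam) (j : ℤ) i)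
    (coeff_labelSeries_succ (lam := lam) j i) (coeff_charge_ite (lam := lam) j i)

/-- The generating series of the restricted highest weight is computed from the labels by
summation by parts. -/
theorem hasExponents_phiHatL₀ {N : ℕ}
    (hN : ∀ x : LGrade ε m 0, IsFar 0 N (x : LHat ε m) → lam x = 0) :
    HasExponents (lam ∘ₗ phiHatL₀ ε m) (evenFamily lam N) (oddFamily lam N) where
  even e := by
    have := halfIntegerFamily_comp (partialGen_labelH_eq_zero hN Even) (s := 1)
      (fun j => by rw [one_smul]; exact partialGen_even_comp) e
    rwa [one_smul] at this
  odd e := by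
    have := halfIntegerFamily_comp (partialGen_labelH_eq_zero hN Odd) (s := -1)
      (fun j => by rw [Units.neg_smul, one_smul]; exact partialGen_odd_comp) e
    rwa [Units.neg_smul, one_smul] at this
  even_distinct _ he he' := absurd he' (neg_notMem_support_halfIntegerFamily he)
  odd_distinct _ he := neg_notMem_support_halfIntegerFamily he
  expansion := by
    have hid := expansion_identity (Λ := fun j : ℕ => labelSeries lam j) (A := alphaSeries lam)
      (c' := chargeSeries lam) (G := weightSeries lam N) (c := lam (centLin ε m 1)) (N := N)
      (PowerSeries.ext fun i => by
        rw [coeff_labelSeries, labelL_eq_zero_of_far hN (by omega), zero_div, map_zero])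
      reflectS_labelSeries_zero
      (expS_one_sub_one_mul_genSeries_alpha (lam ∘ₗ centLin ε m) (truncU m)) rfl
    refine ⟨_, PowerSeries.C (-1 / 2) * (weightSeries lam N - reflectS (weightSeries lam N)),
      ?_, rfl, derivative_weightSeries hN, ?_⟩
    · have h0 : PowerSeries.constantCoeff (sinhS (1 / 2)) = 0 := by
        rw [sinhS, ← PowerSeries.coeff_zero_eq_constantCoeff_apply, PowerSeries.coeff_C_mul,
          map_sub, coeff_expS, coeff_expS]
        norm_num
      rw [map_mul, map_mul, h0, mul_zero, zero_mul]
    · rw [LinearMap.comp_apply, phiHatL₀_centD, hid, evenFamily, oddFamily,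
        sum_halfIntegerFamily, sum_halfIntegerFamily, ← Finset.sum_add_distrib]
      refine Finset.sum_congr rfl fun j _ => ?_
      exact (mul_coshS_add_mul_sinhS _
        (coe_partialGen_even (fun i => labelH_eq_zero_of_lt j) (coeff_labelH_series j))
        (coe_partialGen_odd (fun i => labelH_eq_zero_of_lt j) (coeff_labelH_series j))).symm

/-- The highest weight of a quasifinite module depends on finitely many diagonal entries only. -/
lemma exists_far_lam_eq_zero {V : Type*} [AddCommGroup V] [Module ℂ V] [LieRingModule (LHat ε m) V]
    [LieModule ℂ (LHat ε m) V] {𝒱 : ℤ → Submodule ℂ V} {v₀ : V}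
    (hV : IsIrreducibleHighestWeight (LGrade ε m) 𝒱 v₀ lam) (hfin : IsQuasifinite 𝒱) :
    ∃ N : ℕ, ∀ x : LGrade ε m 0, IsFar 0 N (x : LHat ε m) → lam x = 0 := by
  obtain ⟨N, hN⟩ := exists_far_lie_eq_zero hV.lie_mem hfin 0 0
  refine ⟨N.toNat, fun x hx => ?_⟩
  have h := hN x (hx.mono (Int.self_le_toNat N)) v₀ hV.mem_zero
  exact (smul_eq_zero.mp ((hV.weight x).symm.trans h)).resolve_right hV.ne_zero

end Exponents

end WInfinity

end

theorem mainTheorem7 (ε : ℤˣ) (m : ℕ) (lam : LGrade ε m 0 →ₗ[ℂ] ℂ)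
    {V : Type v} [AddCommGroup V] [Module ℂ V] [LieRingModule (LHat ε m) V]
    [LieModule ℂ (LHat ε m) V] (𝒱 : ℤ → Submodule ℂ V) (v₀ : V)
    (hV : IsIrreducibleHighestWeight (LGrade ε m) 𝒱 v₀ lam) (hfin : IsQuasifinite 𝒱) :
    ∃ eP eM : ℂ →₀ ℂ[X],
      (∀ j : ℕ, eP (-(j : ℂ) - 1 / 2) =
        ∑ i ∈ (Finset.range (m + 1)).filter Even,
          monomial i (labelH lam (j : ℤ) i / (i.factorial : ℂ))) ∧
      (∀ j : ℕ, eM (-(j : ℂ) - 1 / 2) =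
        ∑ i ∈ (Finset.range (m + 1)).filter Odd,
          monomial i (labelH lam (j : ℤ) i / (i.factorial : ℂ))) ∧
      (∀ e : ℂ, (∀ j : ℕ, e ≠ -(j : ℂ) - 1 / 2) → eP e = 0 ∧ eM e = 0) ∧
      IsModuleWithExponents ε (Pullback (phiHatL ε m) V) eP eM ∧
      ∀ (W : Type w) [AddCommGroup W] [Module ℂ W] [LieRingModule (DxHat ε) W]
        [LieModule ℂ (DxHat ε) W], IsModuleWithExponents ε W eP eM →
        Nonempty (Pullback (phiHatL ε m) V ≃ₗ⁅ℂ,DxHat ε⁆ W) := by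
  obtain ⟨𝒲, w, hirr, hqf⟩ := exists_isIrreducibleHighestWeight_pullback hV hfin
  obtain ⟨N, hN⟩ := exists_far_lam_eq_zero hV hfin
  have hexp := hasExponents_phiHatL₀ hN
  refine ⟨evenFamily lam N, oddFamily lam N,
    halfIntegerFamily_apply (partialGen_labelH_eq_zero hN Even),
    halfIntegerFamily_apply (partialGen_labelH_eq_zero hN Odd),
    fun e he => ⟨halfIntegerFamily_apply_of_ne he, halfIntegerFamily_apply_of_ne he⟩,
    ⟨𝒲, w, _, hirr, hqf, hexp⟩, ?_⟩
  rintro W _ _ _ _ ⟨𝒲', w', lam', hirr', -, hexp'⟩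
  obtain rfl := hexp'.unique hexp
  exact hirr.nonempty_equiv iSup_DxGrade lie_mem_DxGrade hirr'
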